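/- **Setting.** A *tail copula* is a function $R(x,y)=x+y+\log G\bigl(\frac{x^{-\gamma_1}-1}{\gamma_1},\frac{y^{-\gamma_2}-1}{\gamma_2}\bigr)$, $x,y>0$ (with $-\log x$ for $\frac{x^{-\gamma}-1}{\gamma}$ when $\gamma=0$), where $G$ is a bivariate extreme value distribution function with margins $\exp\{-(1+\gamma_j x)^{-1/\gamma_j}\}$ for $1+\gamma_jx>0$; with $R(x,\infty)=R(\infty,x)=x$ it defines a measure $R$ on $[0,\infty]^2\setminus\{(\infty,\infty)\}$ by $R([0,x]\times[0,y])=R(x,y)$. Let $\{R_\theta:\theta\in\Theta\}$, $\Theta\subset\mathbb R^d$ open, be a family of tail copulas, let $\theta_0\in\Theta$, $\gamma_1,\gamma_2\in\mathbb R$ and $0<\delta<T<\infty$. Assume: * (B2 at $\theta_0$) the first-order partial derivatives $R_{\theta(1)}=\partial_xR_\theta$, $R_{\theta(2)}=\partial_yR_\theta$, $\partial_{\theta_i}R_\theta$ exist at $\theta=\theta_0$ and are continuous in $(x,y)\in(0,\infty)^2$; * (B4 at $\theta_0$) for all $\theta$ in some open neighbourhood $B\subset\Theta$ of $\theta_0$,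 $R_\theta=R^{(c)}_\theta+R^{(s)}_\theta$, where $R^{(s)}_\theta([0,\infty)^2)=0$ and $R^{(c)}_\theta$ has a positive Lebesgue density $r_\theta$ on $(0,\infty)^2$; the partial derivatives $\partial_xr_{\theta_0},\partial_yr_{\theta_0}$ exist and are continuous on $(0,\infty)^2$, and the partial derivatives $\partial_{\theta_i}r_\theta(x,y)$ exist on $(0,\infty)^2\times B$ and are, as functions of $(x,y,\theta)$, continuous at all points of $(0,\infty)^2\times\{\theta_0\}$. For $j=1,2$ and $x>0$ let $f_j(x)=x(x^{\gamma_j}-1)/\gamma_j$, $g_j(x)=-x^{\gamma_j+1}$, $h_j(x)=x(1-x^{\gamma_j})/\gamma_j^2+x\log x/\gamma_j$, with $f_j(x)=x\log x$ and $h_j(x)=-(x\log^2x)/2$ if $\gamma_j=0$. Let $V$ be a Wiener process with time $R_{\theta_0}$, that is, a zero-mean Gaussian process on $[0,\infty]^2\setminus\{(\infty,\infty)\}$ with $E[V(x,y)V(x',y')]=R_{\theta_0}(x\wedge x',y\wedge y')$, let $A_1,A_2,B_1,B_2,\Gamma_1,\Gamma_2,\zeta_1,\dots,\zeta_d$ be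 arbitrary random variables on the same probability space, and put $$\widehat\eta(x,y)=V(x,y)+R_{\theta_0(1)}(x,y)[f_1(x)A_1+g_1(x)B_1+h_1(x)\Gamma_1]+R_{\theta_0(2)}(x,y)[f_2(y)A_2+g_2(y)B_2+h_2(y)\Gamma_2]+\sum_{i=1}^d\partial_{\theta_i}R_\theta(x,y)\big|_{\theta=\theta_0}\zeta_i .$$ Let $\mathbf q=(q_1,\dots,q_{6+d})^\top$ with $q_1,q_2,q_3=\phi'(x)+\phi(x)\,\partial_x\log r_{\theta_0}(x,y)$ for $\phi=f_1,g_1,h_1$, $q_4,q_5,q_6=\phi'(y)+\phi(y)\,\partial_y\log r_{\theta_0}(x,y)$ for $\phi=f_2,g_2,h_2$, and $q_{6+i}=\partial_{\theta_i}\log r_\theta(x,y)|_{\theta=\theta_0}$. Assume that the matrices $$\mathbf I(t)=\int_\delta^T\!\!\int_t^T\mathbf q(s',t')\mathbf q^\top(s',t')\,dR_{\theta_0}(s',t'),\qquad t\in[\delta,T),$$ are invertible. The integral of a deterministic function over a rectangle against a random field such as $\widehat\eta$ is the limit in probability of the integrals of step functions on rectangles (defined through the rectangle increments of the field) that approximate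 the function in $L^2(R_{\theta_0})$ on that rectangle. **Claim.** The integrals $\mathbf J(t)=\int_\delta^T\!\int_t^T\mathbf q(s',t')\,d\widehat\eta(s',t')$, $t\in[\delta,T)$, exist and have a version that is jointly measurable in $t$ and the random outcome. For every such version and every $(x,y)\in[\delta,T]\times[\delta,T)$, the process $$W_R([\delta,x]\times[\delta,y])=\widehat\eta([\delta,x]\times[\delta,y])-\int_\delta^x\!\!\int_\delta^y\mathbf q^\top(s,t)\,\mathbf I^{-1}(t)\,\mathbf J(t)\,dR_{\theta_0}(s,t)$$ is almost surely well defined, where $\widehat\eta([\delta,x]\times[\delta,y])=\widehat\eta(x,y)-\widehat\eta(\delta,y)-\widehat\eta(x,\delta)+\widehat\eta(\delta,\delta)$; the integrals below exist, and almost surely $$W([\delta,x]\times[\delta,y]):=\int_\delta^x\!\!\int_\delta^y\frac{1}{\sqrt{r_{\theta_0}(s,t)}}\,dW_R([\delta,s]\times[\delta,t]) =\int_\delta^x\!\!\int_\delta^y\frac{1}{\sqrt{r_{\theta_0}(s,t)}}\,d\widehat\eta(s,t)-\int_\delta^x\!\!\int_\delta^y\mathbf q^\top(s,t)\,\mathbf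 I^{-1}(t)\,\mathbf J(t)\sqrt{r_{\theta_0}(s,t)}\,dt\,ds .$$ The process $W$ is a standard Wiener process on $[\delta,T]\times[\delta,T)$: it is a zero-mean Gaussian process with $E\bigl[W([\delta,x]\times[\delta,y])\,W([\delta,x']\times[\delta,y'])\bigr]=(x\wedge x'-\delta)(y\wedge y'-\delta)$. -/

import Mathlib

open MeasureTheory ProbabilityTheory Filter Set
open scoped ENNReal Topology Matrix

noncomputable section

namespace TailCopula

/-! ### Tail copulas -/

/-- Bivariate distribution function of a law on the plane. -/
def cdf2 (F : Measure (ℝ × ℝ)) (x y : ℝ) : ℝ := F.real (Iic x ×ˢ Iic y)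

/-- `(1 + γ x) ^ (-1/γ)`, read as `exp (-x)` when `γ = 0`. -/
def gevTail (γ x : ℝ) : ℝ :=
  if γ = 0 then Real.exp (-x) else (1 + γ * x) ^ (-1 / γ)

/-- `(x ^ (-γ) - 1) / γ`, read as `-log x` when `γ = 0`. -/
def gevInv (γ x : ℝ) : ℝ :=
  if γ = 0 then -Real.log x else (x ^ (-γ) - 1) / γ

/-- `G` is a bivariate extreme value law (the limit law of normalized component-wise maxima of
i.i.d. vectors with some law `F`) with standardized margins of indices `γ₁` and `γ₂`. -/
structure IsExtremeValueLaw (G : Measure (ℝ × ℝ)) (γ₁ γ₂ : ℝ) : Prop where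
  isProb : IsProbabilityMeasure G
  domain : ∃ (F : Measure (ℝ × ℝ)) (a₁ a₂ b₁ b₂ : ℕ → ℝ),
    IsProbabilityMeasure F ∧ (∀ n, 0 < a₁ n) ∧ (∀ n, 0 < a₂ n) ∧
    ∀ x y : ℝ, ContinuousAt (fun p : ℝ × ℝ => cdf2 G p.1 p.2) (x, y) →
      Tendsto (fun n : ℕ => cdf2 F (a₁ n * x + b₁ n) (a₂ n * y + b₂ n) ^ n) atTop
        (𝓝 (cdf2 G x y))
  margin₁ : ∀ x : ℝ, 0 < 1 + γ₁ * x →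
    G.real (Iic x ×ˢ (univ : Set ℝ)) = Real.exp (-gevTail γ₁ x)
  margin₂ : ∀ y : ℝ, 0 < 1 + γ₂ * y →
    G.real ((univ : Set ℝ) ×ˢ Iic y) = Real.exp (-gevTail γ₂ y)

/-- `R`, viewed as a measure on `[0,∞]²` without mass at the corner `(∞,∞)`, is a tail copula:
`R([0,x]×[0,y]) = x + y + log G(...)` for a bivariate extreme value law `G`, and
`R(x,∞) = R(∞,x) = x`. -/
structure IsTailCopula (R : Measure (ℝ≥0∞ × ℝ≥0∞)) : Prop where
  corner : R {((⊤ : ℝ≥0∞), (⊤ : ℝ≥0∞))} = 0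
  margin₁ : ∀ x : ℝ, 0 ≤ x → R (Iic (ENNReal.ofReal x) ×ˢ univ) = ENNReal.ofReal x
  margin₂ : ∀ y : ℝ, 0 ≤ y → R (univ ×ˢ Iic (ENNReal.ofReal y)) = ENNReal.ofReal y
  extreme : ∃ (γ₁ γ₂ : ℝ) (G : Measure (ℝ × ℝ)), IsExtremeValueLaw G γ₁ γ₂ ∧
    ∀ x y : ℝ, 0 < x → 0 < y →
      R.real (Iic (ENNReal.ofReal x) ×ˢ Iic (ENNReal.ofReal y)) =
        x + y + Real.log (cdf2 G (gevInv γ₁ x) (gevInv γ₂ y))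

/-- The function `R(x,y) = R([0,x]×[0,y])` at finite arguments. -/
def fn (R : Measure (ℝ≥0∞ × ℝ≥0∞)) (x y : ℝ) : ℝ :=
  R.real (Iic (ENNReal.ofReal x) ×ˢ Iic (ENNReal.ofReal y))

/-- The part of the measure `R` that lives on `[0,∞)²`, as a measure on the real plane. -/
def finitePart (R : Measure (ℝ≥0∞ × ℝ≥0∞)) : Measure (ℝ × ℝ) :=
  (R.restrict {p | p.1 ≠ ⊤ ∧ p.2 ≠ ⊤}).map fun p => (p.1.toReal, p.2.toReal)

/-- The open quadrant `(0,∞)²`. -/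
def quadrant : Set (ℝ × ℝ) := Ioi 0 ×ˢ Ioi 0

/-! ### Smoothness assumptions on a parametric family, at `θ₀` -/

variable {d : ℕ}

/-- Partial derivative in `θ i`. -/
def dTheta (Φ : (Fin d → ℝ) → ℝ) (i : Fin d) (θ : Fin d → ℝ) : ℝ :=
  deriv (fun u => Φ (Function.update θ i u)) (θ i)

/-- The first-order partial derivatives of `R_θ(x,y)` in `x`, `y`, `θ₁, …, θ_d` exist at
`θ = θ₀` and are continuous on `(0,∞)²`. -/
structure SmoothCopulaAt (R : (Fin d → ℝ) → Measure (ℝ≥0∞ × ℝ≥0∞)) (θ₀ : Fin d → ℝ) : Prop where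
  diff_x : ∀ p ∈ quadrant, DifferentiableAt ℝ (fun s => fn (R θ₀) s p.2) p.1
  diff_y : ∀ p ∈ quadrant, DifferentiableAt ℝ (fun t => fn (R θ₀) p.1 t) p.2
  diff_θ : ∀ i, ∀ p ∈ quadrant,
    DifferentiableAt ℝ (fun u => fn (R (Function.update θ₀ i u)) p.1 p.2) (θ₀ i)
  cont_x : ContinuousOn (fun p : ℝ × ℝ => deriv (fun s => fn (R θ₀) s p.2) p.1) quadrant
  cont_y : ContinuousOn (fun p : ℝ × ℝ => deriv (fun t => fn (R θ₀) p.1 t) p.2) quadrant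
  cont_θ : ∀ i,
    ContinuousOn (fun p : ℝ × ℝ => dTheta (fun θ => fn (R θ) p.1 p.2) i θ₀) quadrant

/-- On a neighbourhood `B ⊆ Θ` of `θ₀`, the measure `R_θ` is the sum of a part without mass on
`[0,∞)²` and a part with a positive Lebesgue density `r_θ` on `(0,∞)²` (equivalently, its
restriction to `[0,∞)²` is given by that density). The partial derivatives of `r` in `x` and `y`
exist at `θ₀` and are continuous there; those in `θ` exist on `(0,∞)² × B` and are, as functions
of `(x,y,θ)`, continuous at all points of `(0,∞)² × {θ₀}`. -/
structure SmoothDensityAt (R : (Fin d → ℝ) → Measure (ℝ≥0∞ × ℝ≥0∞))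
    (r : (Fin d → ℝ) → ℝ × ℝ → ℝ) (Θ B : Set (Fin d → ℝ)) (θ₀ : Fin d → ℝ) : Prop where
  isOpen : IsOpen B
  mem : θ₀ ∈ B
  subset : B ⊆ Θ
  meas : ∀ θ ∈ B, AEMeasurable (r θ) (volume.restrict quadrant)
  pos : ∀ θ ∈ B, ∀ p ∈ quadrant, 0 < r θ p
  density : ∀ θ ∈ B, finitePart (R θ) =
    (volume.restrict quadrant).withDensity fun p => ENNReal.ofReal (r θ p)
  diff_x : ∀ p ∈ quadrant, DifferentiableAt ℝ (fun s => r θ₀ (s, p.2)) p.1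
  diff_y : ∀ p ∈ quadrant, DifferentiableAt ℝ (fun t => r θ₀ (p.1, t)) p.2
  diff_θ : ∀ i, ∀ θ ∈ B, ∀ p ∈ quadrant,
    DifferentiableAt ℝ (fun u => r (Function.update θ i u) p) (θ i)
  cont_x : ContinuousOn (fun p : ℝ × ℝ => deriv (fun s => r θ₀ (s, p.2)) p.1) quadrant
  cont_y : ContinuousOn (fun p : ℝ × ℝ => deriv (fun t => r θ₀ (p.1, t)) p.2) quadrant
  cont_θ : ∀ i, ∀ p ∈ quadrant,
    ContinuousAt (fun z : (ℝ × ℝ) × (Fin d → ℝ) => dTheta (fun θ => r θ z.1) i z.2) (p, θ₀)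

/-! ### The functions `f`, `g`, `h`, the scores `q` and the matrices `I(t)` -/

def fFun (γ x : ℝ) : ℝ := if γ = 0 then x * Real.log x else x * (x ^ γ - 1) / γ

def gFun (γ x : ℝ) : ℝ := -x ^ (γ + 1)

def hFun (γ x : ℝ) : ℝ :=
  if γ = 0 then -(x * Real.log x ^ 2) / 2
  else x * (1 - x ^ γ) / γ ^ 2 + x * Real.log x / γ

/-- The column vector `(q₁, …, q_{6+d})`. -/
def score (r : (Fin d → ℝ) → ℝ × ℝ → ℝ) (θ₀ : Fin d → ℝ) (γ₁ γ₂ : ℝ) (p : ℝ × ℝ) :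
    Fin 6 ⊕ Fin d → ℝ :=
  let ρ₁ := deriv (fun s => Real.log (r θ₀ (s, p.2))) p.1
  let ρ₂ := deriv (fun t => Real.log (r θ₀ (p.1, t))) p.2
  Sum.elim
    ![deriv (fFun γ₁) p.1 + fFun γ₁ p.1 * ρ₁,
      deriv (gFun γ₁) p.1 + gFun γ₁ p.1 * ρ₁,
      deriv (hFun γ₁) p.1 + hFun γ₁ p.1 * ρ₁,
      deriv (fFun γ₂) p.2 + fFun γ₂ p.2 * ρ₂,
      deriv (gFun γ₂) p.2 + gFun γ₂ p.2 * ρ₂,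
      deriv (hFun γ₂) p.2 + hFun γ₂ p.2 * ρ₂]
    (fun i => dTheta (fun θ => Real.log (r θ p)) i θ₀)

/-- `I(t) = ∫_δ^T ∫_t^T q qᵀ dm`. -/
def fisher (q : ℝ × ℝ → Fin 6 ⊕ Fin d → ℝ) (m : Measure (ℝ × ℝ)) (δ T t : ℝ) :
    Matrix (Fin 6 ⊕ Fin d) (Fin 6 ⊕ Fin d) ℝ :=
  Matrix.of fun i j => ∫ p in Icc (δ, t) (T, T), q p i * q p j ∂m

/-! ### Wiener processes, the limit process, and integrals against random fields -/

variable {Ω : Type*} [MeasurableSpace Ω]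

/-- `V` is a Wiener process with time `R` on `[0,∞]² \ {(∞,∞)}`: a zero-mean Gaussian process with
`E[V(x,y) V(x',y')] = R(x ∧ x', y ∧ y')`. -/
structure IsWienerWithTime (V : {p : ℝ≥0∞ × ℝ≥0∞ // p ≠ (⊤, ⊤)} → Ω → ℝ)
    (R : Measure (ℝ≥0∞ × ℝ≥0∞)) (P : Measure Ω) : Prop where
  gaussian : IsGaussianProcess V P
  mean : ∀ p, ∫ ω, V p ω ∂P = 0
  cov : ∀ p p', ∫ ω, V p ω * V p' ω ∂P =
    R.real (Iic (min p.1.1 p'.1.1) ×ˢ Iic (min p.1.2 p'.1.2))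

/-- A real point, as a point of `[0,∞]² \ {(∞,∞)}`. -/
def pt (p : ℝ × ℝ) : {p : ℝ≥0∞ × ℝ≥0∞ // p ≠ (⊤, ⊤)} :=
  ⟨(ENNReal.ofReal p.1, ENNReal.ofReal p.2), fun h => ENNReal.ofReal_ne_top (congrArg Prod.fst h)⟩

/-- A random field `W`, whose value at `p ∈ D` is that of the rectangle `[δ,x]×[δ,y]`, `p = (x,y)`,
is a standard Wiener process: zero-mean Gaussian with the covariance
`Leb(([δ,x]×[δ,y]) ∩ ([δ,x']×[δ,y']))`. -/
structure IsStandardWienerOn (W : ℝ × ℝ → Ω → ℝ) (δ : ℝ) (D : Set (ℝ × ℝ)) (P : Measure Ω) :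
    Prop where
  gaussian : IsGaussianProcess (fun p : D => W p) P
  mean : ∀ p ∈ D, ∫ ω, W p ω ∂P = 0
  cov : ∀ p ∈ D, ∀ p' ∈ D, ∫ ω, W p ω * W p' ω ∂P =
    (volume : Measure (ℝ × ℝ)).real (Icc (δ, δ) p ∩ Icc (δ, δ) p')

/-- The limit process `η̂` at a real point. -/
def etaHat (R : (Fin d → ℝ) → Measure (ℝ≥0∞ × ℝ≥0∞)) (θ₀ : Fin d → ℝ) (γ₁ γ₂ : ℝ)
    (V : {p : ℝ≥0∞ × ℝ≥0∞ // p ≠ (⊤, ⊤)} → Ω → ℝ)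
    (A₁ A₂ B₁ B₂ Γ₁ Γ₂ : Ω → ℝ) (ζ : Fin d → Ω → ℝ) (p : ℝ × ℝ) (ω : Ω) : ℝ :=
  V (pt p) ω
    + deriv (fun s => fn (R θ₀) s p.2) p.1 *
        (fFun γ₁ p.1 * A₁ ω + gFun γ₁ p.1 * B₁ ω + hFun γ₁ p.1 * Γ₁ ω)
    + deriv (fun t => fn (R θ₀) p.1 t) p.2 *
        (fFun γ₂ p.2 * A₂ ω + gFun γ₂ p.2 * B₂ ω + hFun γ₂ p.2 * Γ₂ ω)
    + ∑ i, dTheta (fun θ => fn (R θ) p.1 p.2) i θ₀ * ζ i ω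

/-- Increment of the field `X` over the rectangle with corners `a` and `b`. -/
def increment (X : ℝ × ℝ → Ω → ℝ) (a b : ℝ × ℝ) (ω : Ω) : ℝ :=
  X b ω - X (a.1, b.2) ω - X (b.1, a.2) ω + X a ω

/-- Step functions `∑ cᵢ 1_{(aᵢ,bᵢ]}` on rectangles. -/
structure RectStep where
  n : ℕ
  coef : Fin n → ℝ
  lo : Fin n → ℝ × ℝ
  hi : Fin n → ℝ × ℝ

namespace RectStep

def toFun (S : RectStep) (p : ℝ × ℝ) : ℝ :=
  ∑ i, (Ioc (S.lo i).1 (S.hi i).1 ×ˢ Ioc (S.lo i).2 (S.hi i).2).indicator (fun _ => S.coef i) p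

/-- The rectangles are contained in `[a,b]`. -/
def Within (S : RectStep) (a b : ℝ × ℝ) : Prop :=
  ∀ i, a ≤ S.lo i ∧ S.lo i ≤ S.hi i ∧ S.hi i ≤ b

/-- The integral of the step function against a random field. -/
def integral (S : RectStep) (X : ℝ × ℝ → Ω → ℝ) (ω : Ω) : ℝ :=
  ∑ i, S.coef i * increment X (S.lo i) (S.hi i) ω

end RectStep

/-- Step functions on the rectangle `[a,b]` that converge to `φ` in `L²(m)` there. -/
def Approximates (S : ℕ → RectStep) (φ : ℝ × ℝ → ℝ) (m : Measure (ℝ × ℝ)) (a b : ℝ × ℝ) : Prop :=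
  (∀ n, (S n).Within a b) ∧
  Tendsto (fun n => eLpNorm (fun p => (S n).toFun p - φ p) 2 (m.restrict (Icc a b))) atTop (𝓝 0)

/-- `Y` is (a version of) the integral `∬_{[a,b]} φ dX` of a deterministic `φ` against a random
field `X` with control measure `m`: `φ` can be approximated in `L²(m)` by step functions, and along
every such approximation the integrals of the step functions converge to `Y` in probability. -/
def HasFieldIntegral (P : Measure Ω) (X : ℝ × ℝ → Ω → ℝ) (m : Measure (ℝ × ℝ)) (φ : ℝ × ℝ → ℝ)
    (a b : ℝ × ℝ) (Y : Ω → ℝ) : Prop :=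
  (∃ S, Approximates S φ m a b) ∧
  ∀ S, Approximates S φ m a b → TendstoInMeasure P (fun n => (S n).integral X) atTop Y

/-- `J(t)` is a jointly measurable version of the vector process
`∫_δ^T ∫_t^T q(s',t') dX(s',t')`, `t ∈ [δ,T)`. -/
def IsScoreIntegral (P : Measure Ω) (X : ℝ × ℝ → Ω → ℝ) (m : Measure (ℝ × ℝ))
    (q : ℝ × ℝ → Fin 6 ⊕ Fin d → ℝ) (δ T : ℝ) (J : ℝ → Ω → Fin 6 ⊕ Fin d → ℝ) : Prop :=
  Measurable (fun z : ℝ × Ω => J z.1 z.2) ∧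
  ∀ t ∈ Ico δ T, ∀ j, HasFieldIntegral P X m (fun p => q p j) (δ, t) (T, T) (fun ω => J t ω j)

/-- The integrand `qᵀ(s,t) I⁻¹(t) J(t)` of the compensator. -/
def drift (q : ℝ × ℝ → Fin 6 ⊕ Fin d → ℝ) (m : Measure (ℝ × ℝ)) (δ T : ℝ)
    (J : ℝ → Ω → Fin 6 ⊕ Fin d → ℝ) (p : ℝ × ℝ) (ω : Ω) : ℝ :=
  q p ⬝ᵥ ((fisher q m δ T p.2)⁻¹ *ᵥ J p.2 ω)

/-- The transformed process `W_R([δ,x]×[δ,y])`. -/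
def transformed (X : ℝ × ℝ → Ω → ℝ) (q : ℝ × ℝ → Fin 6 ⊕ Fin d → ℝ) (m : Measure (ℝ × ℝ))
    (δ T : ℝ) (J : ℝ → Ω → Fin 6 ⊕ Fin d → ℝ) (p : ℝ × ℝ) (ω : Ω) : ℝ :=
  increment X (δ, δ) p ω - ∫ u in Icc (δ, δ) p, drift q m δ T J u ω ∂m

end TailCopula

end

/-!
The increments of the limit process `η` over rectangles are those of the Wiener process `V` plus
`∑ ξ_k ∫ q_k dm`, where the coefficients `ξ` are the random variables `A`, `B`, `Γ`, `ζ`: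
integrating the mixed derivatives of `∂ₓR ψ(x)`, `∂_yR ψ(y)` and `∂R/∂θᵢ` over a rectangle gives
exactly the scores times the density (`increment_etaHat`). On `[δ,T]²` the measure `m` has a
bounded density, and `V` generates a linear isometry `iso` from `L²(m)` into the Gaussian elements
of `L²(P)` (`IsIsonormalOn`). Hence an integral `∫ φ dη` exists for square integrable `φ` and
equals `iso φ + ∑ ξ_k ∫ φ q_k dm` (`ScoreModel.hasFieldIntegral_iff`).

Applied to the scores, this gives `J(t) = N(t) + I(t) ξ` with `N_j(t) = iso (q_j
1_{[δ,T]×[t,T]})`, which is Hölder continuous in `L²` and so has a jointly measurable version. The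
compensating integrand is therefore `qᵀ I⁻¹ N + qᵀ ξ` (`ScoreModel.drift_eq`): its second term
removes the drift of `η`, and the transformed process depends on `V` only. By a stochastic Fubini
theorem (`ScoreModel.integral_mul_noise`), the integral of `φ` over `[δ,p]` against the
transformed process is `iso (e_p - K_p)`, where `e_p = φ 1_{[δ,p]}`, `K_p = ∫ e_p(u) κ(u) dm(u)`
and `κ(u) = ∑ (qᵀ(u) I(u₂)⁻¹)_j q_j 1_{[δ,T]×[u₂,T]}`. In particular it is centred Gaussian.

It remains to compute covariances. Since `I(t)` is the Gram matrix of the functions `q_j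
1_{[δ,T]×[t,T]}`, the kernel has the reproducing property `⟨κ(u), κ(v)⟩ = κ(u)(v) + κ(v)(u)` for
`u₂ ≠ v₂` (`inner_kernelLp`). Integrating it against `e_p` and `e_{p'}` gives `⟨K_p, K_{p'}⟩ =
⟨e_p, K_{p'}⟩ + ⟨K_p, e_{p'}⟩`, so that `⟨e_p - K_p, e_{p'} - K_{p'}⟩ = ⟨e_p, e_{p'}⟩`
(`ScoreModel.inner_innovLp`). For `φ = r^{-1/2}` the right side is the Lebesgue measure of `[δ,p]
∩ [δ,p']`.
-/

namespace TailCopula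

/-! ### Rectangle increments as integrals of mixed derivatives -/

theorem isOpen_quadrant : IsOpen quadrant := isOpen_Ioi.prod isOpen_Ioi

theorem mem_quadrant_of_le {a b : ℝ × ℝ} (ha : a ∈ quadrant) (hab : a ≤ b) : b ∈ quadrant :=
  ⟨lt_of_lt_of_le ha.1 hab.1, lt_of_lt_of_le ha.2 hab.2⟩

theorem Icc_subset_quadrant {a : ℝ × ℝ} (ha : a ∈ quadrant) (b : ℝ × ℝ) :
    Icc a b ⊆ quadrant := fun _ hp => mem_quadrant_of_le ha hp.1

theorem Ioc_prod_subset_Icc (a b : ℝ × ℝ) :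
    Ioc a.1 b.1 ×ˢ Ioc a.2 b.2 ⊆ Icc a b := fun _ hp =>
  ⟨⟨hp.1.1.le, hp.2.1.le⟩, ⟨hp.1.2, hp.2.2⟩⟩

/-- Freezing the arguments at a level `ε > 0` extends a function that is continuous on the open
quadrant to a continuous function on the plane. -/
theorem continuous_clamp {h : ℝ × ℝ → ℝ} (hh : ContinuousOn h quadrant) {ε : ℝ} (hε : 0 < ε) :
    Continuous fun p : ℝ × ℝ => h (max ε p.1, max ε p.2) :=
  hh.comp_continuous (by fun_prop) fun _ =>
    ⟨lt_max_of_lt_left hε, lt_max_of_lt_left hε⟩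

theorem continuousOn_slice_fst {h : ℝ × ℝ → ℝ} (hh : ContinuousOn h quadrant) {y : ℝ}
    (hy : 0 < y) : ContinuousOn (fun x => h (x, y)) (Ioi 0) :=
  hh.comp (by fun_prop) fun _ hx => ⟨hx, hy⟩

theorem continuousOn_slice_snd {h : ℝ × ℝ → ℝ} (hh : ContinuousOn h quadrant) {x : ℝ}
    (hx : 0 < x) : ContinuousOn (fun y => h (x, y)) (Ioi 0) :=
  hh.comp (by fun_prop) fun _ hy => ⟨hx, hy⟩

theorem integrableOn_Icc_of_continuousOn {h : ℝ × ℝ → ℝ} (hh : ContinuousOn h quadrant)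
    {a : ℝ × ℝ} (ha : a ∈ quadrant) (b : ℝ × ℝ) : IntegrableOn h (Icc a b) volume :=
  (hh.mono (Icc_subset_quadrant ha b)).integrableOn_compact isCompact_Icc

/-- If the rectangle increments of `F` are the integrals of `ρ`, then the increments of `∂ₓF` in
the second variable are the integrals of `ρ` along vertical segments. -/
theorem deriv_sub_deriv_eq_integral {F : ℝ → ℝ → ℝ} {ρ : ℝ × ℝ → ℝ}
    (hρ : ContinuousOn ρ quadrant)
    (hF : ∀ a b : ℝ × ℝ, a ∈ quadrant → a ≤ b →
      F b.1 b.2 - F a.1 b.2 - F b.1 a.2 + F a.1 a.2 =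
        ∫ p in Ioc a.1 b.1 ×ˢ Ioc a.2 b.2, ρ p)
    (hFx : ∀ p ∈ quadrant, DifferentiableAt ℝ (fun s => F s p.2) p.1)
    {x c d : ℝ} (hx : 0 < x) (hc : 0 < c) (hcd : c ≤ d) :
    deriv (fun s => F s d) x - deriv (fun s => F s c) x = ∫ y in c..d, ρ (x, y) := by
  -- below the level `ε` the arguments play no role, so `ρ` may be frozen there
  set ε := min (x / 2) c with hε
  have hε0 : 0 < ε := lt_min (by linarith) hc
  have hcont := continuous_clamp hρ hε0
  have hinner : Continuous fun u : ℝ => ∫ y in c..d, ρ (max ε u, max ε y) :=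
    intervalIntegral.continuous_parametric_intervalIntegral_of_continuous' hcont c d
  have hd : HasDerivAt (fun s => ∫ u in (x / 2)..s, ∫ y in c..d, ρ (max ε u, max ε y))
      (∫ y in c..d, ρ (max ε x, max ε y)) x :=
    hinner.integral_hasStrictDerivAt _ _ |>.hasDerivAt
  have hval : ∀ s, x / 2 < s → ∫ y in c..d, ρ (max ε s, max ε y) = ∫ y in c..d, ρ (s, y) := by
    intro s hs
    refine intervalIntegral.integral_congr fun y hy => ?_
    rw [uIcc_of_le hcd] at hy
    have h1 : ε ≤ s := (min_le_left _ _).trans hs.le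
    have h2 : ε ≤ y := (min_le_right _ _).trans hy.1
    simp only [max_eq_right h1, max_eq_right h2]
  rw [hval x (by linarith)] at hd
  have heq : (fun s => F s d - F s c) =ᶠ[𝓝 x] fun s => (F (x / 2) d - F (x / 2) c) +
      ∫ u in (x / 2)..s, ∫ y in c..d, ρ (max ε u, max ε y) := by
    filter_upwards [Ioi_mem_nhds (show x / 2 < x by linarith)] with s hs
    have hs' : x / 2 < s := hs
    have h := hF (x / 2, c) (s, d) ⟨by simpa using hx, hc⟩ ⟨hs'.le, hcd⟩
    have hint : IntegrableOn ρ (Ioc (x / 2) s ×ˢ Ioc c d) volume :=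
      (integrableOn_Icc_of_continuousOn hρ (a := (x / 2, c)) ⟨by simpa using hx, hc⟩
        (s, d)).mono_set (Ioc_prod_subset_Icc (x / 2, c) (s, d))
    have h2 : ∫ p in Ioc (x / 2) s ×ˢ Ioc c d, ρ p =
        ∫ u in (x / 2)..s, ∫ y in c..d, ρ (max ε u, max ε y) := by
      rw [Measure.volume_eq_prod, setIntegral_prod _ hint, intervalIntegral.integral_of_le hs'.le]
      refine setIntegral_congr_fun measurableSet_Ioc fun u hu => ?_
      simp only [hval u hu.1]
      rw [intervalIntegral.integral_of_le hcd]
    simp only at h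
    rw [h2] at h
    linarith
  have hd' := (hd.const_add (F (x / 2) d - F (x / 2) c)).congr_of_eventuallyEq heq
  have h1 := hFx (x, d) ⟨hx, hc.trans_le hcd⟩
  have h2 := hFx (x, c) ⟨hx, hc⟩
  exact (h1.hasDerivAt.sub h2.hasDerivAt).unique hd'

/-- If the rectangle increments of `F` are the integrals of `ρ`, then those of
`(x, y) ↦ ∂ₓF(x,y) ψ(x)` are the integrals of `∂ₓ(ψ ρ)`. -/
theorem increment_deriv_mul_eq_integral {F : ℝ → ℝ → ℝ} {ρ : ℝ × ℝ → ℝ} {ψ : ℝ → ℝ}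
    (hρ : ContinuousOn ρ quadrant)
    (hF : ∀ a b : ℝ × ℝ, a ∈ quadrant → a ≤ b →
      F b.1 b.2 - F a.1 b.2 - F b.1 a.2 + F a.1 a.2 =
        ∫ p in Ioc a.1 b.1 ×ˢ Ioc a.2 b.2, ρ p)
    (hFx : ∀ p ∈ quadrant, DifferentiableAt ℝ (fun s => F s p.2) p.1)
    (hρx : ∀ p ∈ quadrant, DifferentiableAt ℝ (fun s => ρ (s, p.2)) p.1)
    (hρx' : ContinuousOn (fun p : ℝ × ℝ => deriv (fun s => ρ (s, p.2)) p.1) quadrant)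
    (hψ : ∀ x, 0 < x → DifferentiableAt ℝ ψ x) (hψ' : ContinuousOn (deriv ψ) (Ioi 0))
    {a b : ℝ × ℝ} (ha : a ∈ quadrant) (hab : a ≤ b) :
    deriv (fun s => F s b.2) b.1 * ψ b.1 - deriv (fun s => F s b.2) a.1 * ψ a.1
        - deriv (fun s => F s a.2) b.1 * ψ b.1 + deriv (fun s => F s a.2) a.1 * ψ a.1 =
      ∫ p in Ioc a.1 b.1 ×ˢ Ioc a.2 b.2,
        (deriv ψ p.1 * ρ p + ψ p.1 * deriv (fun s => ρ (s, p.2)) p.1) := by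
  obtain ⟨a₁, a₂⟩ := a
  obtain ⟨b₁, b₂⟩ := b
  obtain ⟨h1 : a₁ ≤ b₁, h2 : a₂ ≤ b₂⟩ := hab
  have ha1 : 0 < a₁ := ha.1
  have ha2 : 0 < a₂ := ha.2
  have hψc : ContinuousOn ψ (Ioi 0) := fun x hx => (hψ x hx).continuousAt.continuousWithinAt
  have hgc : ContinuousOn (fun p : ℝ × ℝ => deriv ψ p.1 * ρ p +
      ψ p.1 * deriv (fun s => ρ (s, p.2)) p.1) quadrant := by
    have e1 : ContinuousOn (fun p : ℝ × ℝ => deriv ψ p.1) quadrant :=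
      hψ'.comp continuousOn_fst fun p hp => hp.1
    have e2 : ContinuousOn (fun p : ℝ × ℝ => ψ p.1) quadrant :=
      hψc.comp continuousOn_fst fun p hp => hp.1
    exact (e1.mul hρ).add (e2.mul hρx')
  have hint := (integrableOn_Icc_of_continuousOn hgc ha (b₁, b₂)).mono_set
    (Ioc_prod_subset_Icc (a₁, a₂) (b₁, b₂))
  have key : ∫ p in Ioc a₁ b₁ ×ˢ Ioc a₂ b₂, (deriv ψ p.1 * ρ p +
      ψ p.1 * deriv (fun s => ρ (s, p.2)) p.1) =
      ∫ y in a₂..b₂, (ψ b₁ * ρ (b₁, y) - ψ a₁ * ρ (a₁, y)) := by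
    rw [IntegrableOn, Measure.volume_eq_prod, ← Measure.prod_restrict] at hint
    rw [Measure.volume_eq_prod, ← Measure.prod_restrict, integral_prod_symm _ hint,
      intervalIntegral.integral_of_le h2]
    refine setIntegral_congr_fun measurableSet_Ioc fun y hy => ?_
    have hy0 : 0 < y := ha2.trans hy.1
    rw [← intervalIntegral.integral_of_le h1]
    refine intervalIntegral.integral_eq_sub_of_hasDerivAt (f := fun x => ψ x * ρ (x, y))
      (fun x hx => ?_) ?_
    · rw [uIcc_of_le h1] at hx
      have hx0 : 0 < x := ha1.trans_le hx.1
      exact (hψ x hx0).hasDerivAt.mul (hρx (x, y) ⟨hx0, hy0⟩).hasDerivAt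
    · refine ContinuousOn.intervalIntegrable ?_
      refine (continuousOn_slice_fst hgc hy0).mono fun x hx => ?_
      rw [uIcc_of_le h1] at hx
      exact ha1.trans_le hx.1
  have hii : ∀ x, 0 < x → IntervalIntegrable (fun y => ρ (x, y)) volume a₂ b₂ := fun x hx =>
    ((continuousOn_slice_snd hρ hx).mono fun y hy => by
      rw [uIcc_of_le h2] at hy; exact ha2.trans_le hy.1).intervalIntegrable
  rw [key, intervalIntegral.integral_sub ((hii b₁ (ha1.trans_le h1)).const_mul _)
      ((hii a₁ ha1).const_mul _), intervalIntegral.integral_const_mul,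
    intervalIntegral.integral_const_mul,
    ← deriv_sub_deriv_eq_integral hρ hF hFx ha1 ha2 h2,
    ← deriv_sub_deriv_eq_integral hρ hF hFx (ha1.trans_le h1) ha2 h2]
  ring

/-- The counterpart of `increment_deriv_mul_eq_integral` with the roles of the variables
exchanged. -/
theorem increment_deriv_mul_eq_integral' {F : ℝ → ℝ → ℝ} {ρ : ℝ × ℝ → ℝ} {ψ : ℝ → ℝ}
    (hρ : ContinuousOn ρ quadrant)
    (hF : ∀ a b : ℝ × ℝ, a ∈ quadrant → a ≤ b →
      F b.1 b.2 - F a.1 b.2 - F b.1 a.2 + F a.1 a.2 =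
        ∫ p in Ioc a.1 b.1 ×ˢ Ioc a.2 b.2, ρ p)
    (hFy : ∀ p ∈ quadrant, DifferentiableAt ℝ (fun t => F p.1 t) p.2)
    (hρy : ∀ p ∈ quadrant, DifferentiableAt ℝ (fun t => ρ (p.1, t)) p.2)
    (hρy' : ContinuousOn (fun p : ℝ × ℝ => deriv (fun t => ρ (p.1, t)) p.2) quadrant)
    (hψ : ∀ x, 0 < x → DifferentiableAt ℝ ψ x) (hψ' : ContinuousOn (deriv ψ) (Ioi 0))
    {a b : ℝ × ℝ} (ha : a ∈ quadrant) (hab : a ≤ b) :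
    deriv (fun t => F b.1 t) b.2 * ψ b.2 - deriv (fun t => F a.1 t) b.2 * ψ b.2
        - deriv (fun t => F b.1 t) a.2 * ψ a.2 + deriv (fun t => F a.1 t) a.2 * ψ a.2 =
      ∫ p in Ioc a.1 b.1 ×ˢ Ioc a.2 b.2,
        (deriv ψ p.2 * ρ p + ψ p.2 * deriv (fun t => ρ (p.1, t)) p.2) := by
  have hsw : ∀ p : ℝ × ℝ, p ∈ quadrant → p.swap ∈ quadrant := fun p hp => ⟨hp.2, hp.1⟩
  have hI : ∀ (g : ℝ × ℝ → ℝ) (s t : Set ℝ),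
      ∫ p in s ×ˢ t, g p.swap = ∫ p in t ×ˢ s, g p := fun g s t => by
    rw [Measure.volume_eq_prod]
    exact setIntegral_prod_swap t s g
  have h := increment_deriv_mul_eq_integral (F := fun x y => F y x) (ρ := fun p => ρ p.swap)
    (ψ := ψ) (hρ.comp continuous_swap.continuousOn hsw)
    (fun a b ha hab => by
      have := hF a.swap b.swap (hsw a ha) ⟨hab.2, hab.1⟩
      simp only [Prod.fst_swap, Prod.snd_swap] at this
      rw [hI, ← this]; ring)
    (fun p hp => hFy p.swap (hsw p hp)) (fun p hp => hρy p.swap (hsw p hp))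
    (hρy'.comp continuous_swap.continuousOn hsw) hψ hψ'
    (a := a.swap) (b := b.swap) (hsw a ha) ⟨hab.2, hab.1⟩
  have h3 := hI (fun p => deriv ψ p.2 * ρ p + ψ p.2 * deriv (fun t => ρ (p.1, t)) p.2)
    (Ioc a.2 b.2) (Ioc a.1 b.1)
  simp only [Prod.fst_swap, Prod.snd_swap] at h h3
  rw [← h3]
  exact (show _ = _ by ring).trans h

/-- A function on the quadrant with continuous partial derivatives is continuous. -/
theorem continuousOn_of_partials {ρ : ℝ × ℝ → ℝ}
    (hx : ∀ p ∈ quadrant, DifferentiableAt ℝ (fun s => ρ (s, p.2)) p.1)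
    (hy : ∀ p ∈ quadrant, DifferentiableAt ℝ (fun t => ρ (p.1, t)) p.2)
    (hx' : ContinuousOn (fun p : ℝ × ℝ => deriv (fun s => ρ (s, p.2)) p.1) quadrant) :
    ContinuousOn ρ quadrant := by
  intro p hp
  refine ContinuousAt.continuousWithinAt ?_
  have hb := hx'.continuousAt (isOpen_quadrant.mem_nhds hp)
  set C := |deriv (fun s => ρ (s, p.2)) p.1| + 1 with hC
  have hbd : ∀ᶠ z in 𝓝 p, ‖deriv (fun s => ρ (s, z.2)) z.1‖ < C ∧ z ∈ quadrant :=
    ((hb.norm.eventually_lt continuousAt_const (by simp [hC])).and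
      (isOpen_quadrant.mem_nhds hp))
  obtain ⟨ε, hε, hball⟩ := Metric.eventually_nhds_iff_ball.1 hbd
  -- the mean value inequality in the first variable, with a locally bounded derivative
  have hmv : ∀ z ∈ Metric.ball p ε, ‖ρ z - ρ (p.1, z.2)‖ ≤ C * ‖z.1 - p.1‖ := by
    intro z hz
    rw [← ball_prod_same] at hz
    refine (convex_ball p.1 ε).norm_image_sub_le_of_norm_deriv_le (f := fun s => ρ (s, z.2))
      (fun s hs => ?_) (fun s hs => ?_) (Metric.mem_ball_self hε) hz.1
    · exact hx (s, z.2) (hball (s, z.2) (by rw [← ball_prod_same]; exact ⟨hs, hz.2⟩)).2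
    · exact (hball (s, z.2) (by rw [← ball_prod_same]; exact ⟨hs, hz.2⟩)).1.le
  have h1 : Tendsto (fun z : ℝ × ℝ => ρ z - ρ (p.1, z.2)) (𝓝 p) (𝓝 0) := by
    refine squeeze_zero_norm' (eventually_of_mem (Metric.ball_mem_nhds p hε) hmv) ?_
    have : Tendsto (fun z : ℝ × ℝ => C * ‖z.1 - p.1‖) (𝓝 p) (𝓝 (C * ‖p.1 - p.1‖)) :=
      (Continuous.tendsto (by fun_prop) p)
    simpa using this
  have h2 : Tendsto (fun z : ℝ × ℝ => ρ (p.1, z.2)) (𝓝 p) (𝓝 (ρ p)) :=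
    (hy p hp).continuousAt.tendsto.comp continuous_snd.continuousAt
  simpa [ContinuousAt] using h1.add h2

/-! ### Corner sets and the measure of rectangles -/

/-- The set `[0,x] × [0,y]` whose `R`-mass is `R(x,y)`. -/
def corner (p : ℝ × ℝ) : Set (ℝ≥0∞ × ℝ≥0∞) :=
  Iic (ENNReal.ofReal p.1) ×ˢ Iic (ENNReal.ofReal p.2)

/-- A function on the real plane, transported to `[0,∞)²` and extended by zero to `[0,∞]²`. -/
noncomputable def liftFin (φ : ℝ × ℝ → ℝ) : ℝ≥0∞ × ℝ≥0∞ → ℝ :=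
  {p : ℝ≥0∞ × ℝ≥0∞ | p.1 ≠ ⊤ ∧ p.2 ≠ ⊤}.indicator fun p => φ (p.1.toReal, p.2.toReal)

theorem measurableSet_corner (p : ℝ × ℝ) : MeasurableSet (corner p) :=
  measurableSet_Iic.prod measurableSet_Iic

theorem measurableSet_finite :
    MeasurableSet {p : ℝ≥0∞ × ℝ≥0∞ | p.1 ≠ ⊤ ∧ p.2 ≠ ⊤} := by
  apply MeasurableSet.inter
  · exact measurable_fst (measurableSet_singleton ⊤).compl
  · exact measurable_snd (measurableSet_singleton ⊤).compl

theorem integral_liftFin (R : Measure (ℝ≥0∞ × ℝ≥0∞)) {φ : ℝ × ℝ → ℝ} (hφ : Measurable φ) :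
    ∫ z, liftFin φ z ∂ R = ∫ p, φ p ∂(finitePart R) := by
  rw [liftFin, integral_indicator measurableSet_finite, finitePart, integral_map]
  · exact (by fun_prop : Measurable fun p : ℝ≥0∞ × ℝ≥0∞ =>
      (p.1.toReal, p.2.toReal)).aemeasurable
  · exact hφ.aestronglyMeasurable

theorem corner_lt_top {R : Measure (ℝ≥0∞ × ℝ≥0∞)} (hR : IsTailCopula R) (p : ℝ × ℝ) :
    R (corner p) < ⊤ := by
  have h : corner p ⊆ Iic (ENNReal.ofReal (max p.1 0)) ×ˢ univ := fun z hz =>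
    ⟨le_trans hz.1 (ENNReal.ofReal_le_ofReal (le_max_left _ _)), trivial⟩
  refine (measure_mono h).trans_lt ?_
  rw [hR.margin₁ _ (le_max_right _ _)]
  exact ENNReal.ofReal_lt_top

/-- The increment of the corner indicators over a rectangle is the indicator of that rectangle. -/
theorem corner_increment {a b : ℝ × ℝ} (ha : 0 ≤ a) (hab : a ≤ b) (z : ℝ≥0∞ × ℝ≥0∞) :
    (corner b).indicator (1 : ℝ≥0∞ × ℝ≥0∞ → ℝ) z - (corner (a.1, b.2)).indicator 1 z
        - (corner (b.1, a.2)).indicator 1 z + (corner a).indicator 1 z =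
      liftFin ((Ioc a.1 b.1 ×ˢ Ioc a.2 b.2).indicator 1) z := by
  obtain ⟨a₁, a₂⟩ := a
  obtain ⟨b₁, b₂⟩ := b
  obtain ⟨z₁, z₂⟩ := z
  have h1 : a₁ ≤ b₁ := hab.1
  have h2 : a₂ ≤ b₂ := hab.2
  have ha1 : 0 ≤ a₁ := ha.1
  have ha2 : 0 ≤ a₂ := ha.2
  have hb1 := ha1.trans h1
  have hb2 := ha2.trans h2
  rcases eq_or_ne z₁ ⊤ with rfl | hz1
  · simp [corner, liftFin, indicator]
  rcases eq_or_ne z₂ ⊤ with rfl | hz2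
  · simp [corner, liftFin, indicator]
  lift z₁ to NNReal using hz1
  lift z₂ to NNReal using hz2
  have hle : ∀ (s : NNReal) (c : ℝ), 0 ≤ c → ((s : ℝ≥0∞) ≤ ENNReal.ofReal c ↔ (s : ℝ) ≤ c) := by
    intro s c hc
    rw [ENNReal.le_ofReal_iff_toReal_le ENNReal.coe_ne_top hc, ENNReal.coe_toReal]
  simp only [corner, liftFin, indicator, mem_prod, mem_Iic, mem_Ioc, mem_ofPred_eq,
    hle _ _ ha1, hle _ _ ha2, hle _ _ hb1, hle _ _ hb2, ENNReal.coe_ne_top, ne_eq,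
    not_false_eq_true, and_self, if_true, ENNReal.coe_toReal, Pi.one_apply, ← not_le]
  have e1 := @le_trans ℝ _ (z₁ : ℝ) a₁ b₁
  have e2 := @le_trans ℝ _ (z₂ : ℝ) a₂ b₂
  by_cases c1 : (z₁ : ℝ) ≤ a₁ <;> by_cases c2 : (z₁ : ℝ) ≤ b₁ <;>
    by_cases c3 : (z₂ : ℝ) ≤ a₂ <;> by_cases c4 : (z₂ : ℝ) ≤ b₂ <;>
    first
    | exact absurd (e1 c1 h1) c2
    | exact absurd (e2 c3 h2) c4
    | simp [c1, c2, c3, c4]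

theorem integrable_corner {R : Measure (ℝ≥0∞ × ℝ≥0∞)} (hR : IsTailCopula R) (p : ℝ × ℝ) :
    Integrable ((corner p).indicator (1 : ℝ≥0∞ × ℝ≥0∞ → ℝ)) R :=
  (integrable_indicator_iff (measurableSet_corner p)).2
    (integrableOn_const (corner_lt_top hR p).ne)

theorem integral_corner (R : Measure (ℝ≥0∞ × ℝ≥0∞)) (p : ℝ × ℝ) :
    ∫ z, (corner p).indicator (1 : ℝ≥0∞ × ℝ≥0∞ → ℝ) z ∂ R = fn R p.1 p.2 :=
  integral_indicator_one (measurableSet_corner p)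

theorem measurableSet_Ioc_prod (a b : ℝ × ℝ) : MeasurableSet (Ioc a.1 b.1 ×ˢ Ioc a.2 b.2) :=
  measurableSet_Ioc.prod measurableSet_Ioc

theorem fn_increment {R : Measure (ℝ≥0∞ × ℝ≥0∞)} (hR : IsTailCopula R) {a b : ℝ × ℝ}
    (ha : 0 ≤ a) (hab : a ≤ b) :
    fn R b.1 b.2 - fn R a.1 b.2 - fn R b.1 a.2 + fn R a.1 a.2 =
      (finitePart R).real (Ioc a.1 b.1 ×ˢ Ioc a.2 b.2) := by
  have h := integral_liftFin R
    (φ := (Ioc a.1 b.1 ×ˢ Ioc a.2 b.2).indicator 1)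
    (measurable_one.indicator (measurableSet_Ioc_prod a b))
  rw [integral_indicator_one (measurableSet_Ioc_prod a b)] at h
  rw [← h, ← integral_congr_ae (Eventually.of_forall (corner_increment ha hab))]
  have i := integrable_corner hR
  have h1 := integral_corner R
  have hb := h1 b
  have hab' := h1 (a.1, b.2)
  have hba := h1 (b.1, a.2)
  have haa := h1 a
  rw [integral_add, integral_sub, integral_sub, hb, hab', hba, haa]
  · exact i b
  · exact i (a.1, b.2)
  · exact (i b).sub (i (a.1, b.2))
  · exact i (b.1, a.2)
  · exact ((i b).sub (i (a.1, b.2))).sub (i (b.1, a.2))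
  · exact i a

/-! ### The Wiener process with time `R` on step functions -/

section Wiener

variable {Ω : Type*} [MeasurableSpace Ω] {P : Measure Ω}

theorem pt_memLp {V : {p : ℝ≥0∞ × ℝ≥0∞ // p ≠ (⊤, ⊤)} → Ω → ℝ}
    {R : Measure (ℝ≥0∞ × ℝ≥0∞)} (hV : IsWienerWithTime V R P) (p) : MemLp (V p) 2 P :=
  (hV.gaussian.hasGaussianLaw_eval p).memLp_two

theorem integral_sq_sum_wiener {V : {p : ℝ≥0∞ × ℝ≥0∞ // p ≠ (⊤, ⊤)} → Ω → ℝ}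
    {R : Measure (ℝ≥0∞ × ℝ≥0∞)} (hR : IsTailCopula R) (hV : IsWienerWithTime V R P)
    {κ : Type*} [Fintype κ] (w : κ → ℝ) (p : κ → ℝ × ℝ) :
    ∫ ω, (∑ k, w k * V (pt (p k)) ω) ^ 2 ∂P =
      ∫ z, (∑ k, w k * (corner (p k)).indicator (1 : ℝ≥0∞ × ℝ≥0∞ → ℝ) z) ^ 2 ∂ R := by
  have hi1 : ∀ i j, Integrable
      (fun ω => w i * V (pt (p i)) ω * (w j * V (pt (p j)) ω)) P := fun i j =>
    ((pt_memLp hV _).const_mul (w i)).integrable_mul ((pt_memLp hV _).const_mul (w j))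
  have hprod : ∀ i j z, (corner (p i)).indicator (1 : ℝ≥0∞ × ℝ≥0∞ → ℝ) z *
      (corner (p j)).indicator (1 : ℝ≥0∞ × ℝ≥0∞ → ℝ) z =
      (corner (p i) ∩ corner (p j)).indicator (1 : ℝ≥0∞ × ℝ≥0∞ → ℝ) z := fun i j z => by
    rw [inter_indicator_one, Pi.mul_apply]
  have hms : ∀ i j, MeasurableSet (corner (p i) ∩ corner (p j)) := fun i j =>
    (measurableSet_corner _).inter (measurableSet_corner _)
  have hi2 : ∀ i j, Integrable
      (fun z => w i * (corner (p i)).indicator (1 : ℝ≥0∞ × ℝ≥0∞ → ℝ) z *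
        (w j * (corner (p j)).indicator (1 : ℝ≥0∞ × ℝ≥0∞ → ℝ) z)) R := fun i j => by
    have : Integrable ((corner (p i) ∩ corner (p j)).indicator (1 : ℝ≥0∞ × ℝ≥0∞ → ℝ)) R :=
      (integrable_indicator_iff (hms i j)).2 (integrableOn_const
        ((measure_mono inter_subset_left).trans_lt (corner_lt_top hR (p i))).ne)
    refine (this.const_mul (w i * w j)).congr (Eventually.of_forall fun z => ?_)
    simp only [← hprod]; ring
  simp only [sq, Finset.sum_mul_sum]
  rw [integral_finsetSum _ fun i _ => integrable_finsetSum _ fun j _ => hi1 i j,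
    integral_finsetSum _ fun i _ => integrable_finsetSum _ fun j _ => hi2 i j]
  refine Finset.sum_congr rfl fun i _ => ?_
  rw [integral_finsetSum _ fun j _ => hi1 i j, integral_finsetSum _ fun j _ => hi2 i j]
  refine Finset.sum_congr rfl fun j _ => ?_
  have e1 : ∀ ω, w i * V (pt (p i)) ω * (w j * V (pt (p j)) ω) =
      w i * w j * (V (pt (p i)) ω * V (pt (p j)) ω) := fun ω => by ring
  have e2 : ∀ z, w i * (corner (p i)).indicator (1 : ℝ≥0∞ × ℝ≥0∞ → ℝ) z *
        (w j * (corner (p j)).indicator (1 : ℝ≥0∞ × ℝ≥0∞ → ℝ) z) =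
      w i * w j * (corner (p i) ∩ corner (p j)).indicator (1 : ℝ≥0∞ × ℝ≥0∞ → ℝ) z :=
    fun z => by rw [← hprod]; ring
  simp only [e1, e2, integral_const_mul, hV.cov, integral_indicator_one (hms i j)]
  congr 2
  simp only [corner, pt, prod_inter_prod, Iic_inter_Iic]

theorem RectStep.toFun_measurable (S : RectStep) : Measurable S.toFun :=
  Finset.measurable_sum _ fun _ _ => measurable_const.indicator (measurableSet_Ioc_prod _ _)

/-- Isometry: the integral of a step function against a Wiener process with time `R` has the
second moment `∫ S² dR`. -/
theorem integral_sq_step {V : {p : ℝ≥0∞ × ℝ≥0∞ // p ≠ (⊤, ⊤)} → Ω → ℝ}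
    {R : Measure (ℝ≥0∞ × ℝ≥0∞)} (hR : IsTailCopula R) (hV : IsWienerWithTime V R P)
    (S : RectStep) {a b : ℝ × ℝ} (ha : 0 ≤ a) (hS : S.Within a b) :
    ∫ ω, (S.integral (fun p => V (pt p)) ω) ^ 2 ∂P =
      ∫ p, S.toFun p ^ 2 ∂(finitePart R) := by
  -- each rectangle contributes its four corners, indexed by `Bool × Bool`, with alternating signs
  let sg : Bool → ℝ := fun b => if b then 1 else -1
  let w : Fin S.n × Bool × Bool → ℝ := fun k => S.coef k.1 * (sg k.2.1 * sg k.2.2)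
  let c : Fin S.n × Bool × Bool → ℝ × ℝ := fun k =>
    (if k.2.1 then (S.hi k.1).1 else (S.lo k.1).1, if k.2.2 then (S.hi k.1).2 else (S.lo k.1).2)
  have e1 : ∀ ω, S.integral (fun p => V (pt p)) ω = ∑ k, w k * V (pt (c k)) ω := fun ω => by
    simp only [RectStep.integral, increment, Fintype.sum_prod_type, Fintype.sum_bool, w, c, sg]
    refine Finset.sum_congr rfl fun i _ => ?_
    simp
    ring
  have e2 : ∀ z, ∑ k, w k * (corner (c k)).indicator (1 : ℝ≥0∞ × ℝ≥0∞ → ℝ) z =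
      liftFin S.toFun z := fun z => by
    have h : liftFin S.toFun z = ∑ i, S.coef i * liftFin
        ((Ioc (S.lo i).1 (S.hi i).1 ×ˢ Ioc (S.lo i).2 (S.hi i).2).indicator 1) z := by
      by_cases hz : z ∈ {p : ℝ≥0∞ × ℝ≥0∞ | p.1 ≠ ⊤ ∧ p.2 ≠ ⊤}
      · simp only [liftFin, indicator_of_mem hz, RectStep.toFun]
        refine Finset.sum_congr rfl fun i _ => ?_
        simp [indicator]
      · simp only [liftFin, indicator_of_notMem hz, mul_zero, Finset.sum_const_zero]
    rw [h]
    simp only [Fintype.sum_prod_type, Fintype.sum_bool, w, c, sg]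
    refine Finset.sum_congr rfl fun i _ => ?_
    rw [← corner_increment (ha.trans (hS i).1) (hS i).2.1]
    simp
    ring
  simp only [e1, integral_sq_sum_wiener hR hV, e2]
  rw [← integral_liftFin R (S.toFun_measurable.pow_const 2)]
  refine integral_congr_ae (Eventually.of_forall fun z => ?_)
  by_cases hz : z ∈ {p : ℝ≥0∞ × ℝ≥0∞ | p.1 ≠ ⊤ ∧ p.2 ≠ ⊤}
  · simp only [liftFin, indicator_of_mem hz]
  · simp [liftFin, indicator_of_notMem hz]

end Wiener

/-! ### The density and its derivatives in the parameter -/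

section Density

variable {d : ℕ} {R : (Fin d → ℝ) → Measure (ℝ≥0∞ × ℝ≥0∞)} {r : (Fin d → ℝ) → ℝ × ℝ → ℝ}
  {Θ B : Set (Fin d → ℝ)} {θ₀ : Fin d → ℝ}

theorem SmoothDensityAt.continuousOn (hB4 : SmoothDensityAt R r Θ B θ₀) :
    ContinuousOn (r θ₀) quadrant :=
  continuousOn_of_partials hB4.diff_x hB4.diff_y hB4.cont_x

theorem SmoothDensityAt.continuousOn_dTheta (hB4 : SmoothDensityAt R r Θ B θ₀) (i : Fin d) :
    ContinuousOn (fun p => dTheta (fun θ => r θ p) i θ₀) quadrant := fun p hp =>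
  ((hB4.cont_θ i p hp).comp (f := fun p : ℝ × ℝ => (p, θ₀))
    (by fun_prop)).continuousWithinAt

theorem SmoothDensityAt.restrict_finitePart (hB4 : SmoothDensityAt R r Θ B θ₀)
    {θ : Fin d → ℝ} (hθ : θ ∈ B) {A : Set (ℝ × ℝ)} (hA : MeasurableSet A) (hAq : A ⊆ quadrant) :
    (finitePart (R θ)).restrict A =
      (volume.restrict A).withDensity fun p => ENNReal.ofReal (r θ p) := by
  rw [hB4.density θ hθ, restrict_withDensity hA, Measure.restrict_restrict hA,
    inter_eq_left.2 hAq]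

theorem SmoothDensityAt.setIntegral_finitePart (hB4 : SmoothDensityAt R r Θ B θ₀)
    {θ : Fin d → ℝ} (hθ : θ ∈ B) {A : Set (ℝ × ℝ)} (hA : MeasurableSet A) (hAq : A ⊆ quadrant)
    (g : ℝ × ℝ → ℝ) :
    ∫ p in A, g p ∂(finitePart (R θ)) = ∫ p in A, r θ p * g p := by
  rw [hB4.restrict_finitePart hθ hA hAq, integral_withDensity_eq_integral_toReal_smul₀]
  · refine setIntegral_congr_fun hA fun p hp => ?_
    simp only [smul_eq_mul, ENNReal.toReal_ofReal (hB4.pos θ hθ p (hAq hp)).le]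
  · exact ((hB4.meas θ hθ).mono_measure (Measure.restrict_mono hAq le_rfl)).ennreal_ofReal
  · exact Eventually.of_forall fun _ => ENNReal.ofReal_lt_top

theorem SmoothDensityAt.fn_increment (hB4 : SmoothDensityAt R r Θ B θ₀)
    (hR : ∀ θ ∈ Θ, IsTailCopula (R θ)) {θ : Fin d → ℝ} (hθ : θ ∈ B) {a b : ℝ × ℝ}
    (ha : a ∈ quadrant) (hab : a ≤ b) :
    fn (R θ) b.1 b.2 - fn (R θ) a.1 b.2 - fn (R θ) b.1 a.2 + fn (R θ) a.1 a.2 =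
      ∫ p in Ioc a.1 b.1 ×ˢ Ioc a.2 b.2, r θ p := by
  have hA := measurableSet_Ioc_prod a b
  have hAq : Ioc a.1 b.1 ×ˢ Ioc a.2 b.2 ⊆ quadrant :=
    (Ioc_prod_subset_Icc a b).trans (Icc_subset_quadrant ha b)
  rw [TailCopula.fn_increment (hR θ (hB4.subset hθ)) ⟨ha.1.le, ha.2.le⟩ hab]
  have := hB4.setIntegral_finitePart hθ hA hAq 1
  simpa using this

/-- Differentiation under the integral sign: the increments of `∂R_θ/∂θᵢ` are the integrals of
`∂r_θ/∂θᵢ`. -/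
theorem increment_dTheta (hB2 : SmoothCopulaAt R θ₀) (hB4 : SmoothDensityAt R r Θ B θ₀)
    (hR : ∀ θ ∈ Θ, IsTailCopula (R θ)) (i : Fin d) {a b : ℝ × ℝ}
    (ha : a ∈ quadrant) (hab : a ≤ b) :
    dTheta (fun θ => fn (R θ) b.1 b.2) i θ₀ - dTheta (fun θ => fn (R θ) a.1 b.2) i θ₀
        - dTheta (fun θ => fn (R θ) b.1 a.2) i θ₀ + dTheta (fun θ => fn (R θ) a.1 a.2) i θ₀ =
      ∫ p in Ioc a.1 b.1 ×ˢ Ioc a.2 b.2, dTheta (fun θ => r θ p) i θ₀ := by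
  set A := Ioc a.1 b.1 ×ˢ Ioc a.2 b.2 with hA
  have hAm : MeasurableSet A := measurableSet_Ioc_prod a b
  have hAc : A ⊆ Icc a b := Ioc_prod_subset_Icc a b
  have hAq : A ⊆ quadrant := hAc.trans (Icc_subset_quadrant ha b)
  have hupd : Continuous fun u : ℝ => Function.update θ₀ i u :=
    continuous_const.update i continuous_id
  have hupd0 : Function.update θ₀ i (θ₀ i) = θ₀ := Function.update_eq_self i θ₀
  have hcont := hB4.continuousOn_dTheta i
  obtain ⟨C, hC⟩ := isCompact_Icc.exists_bound_of_continuousOn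
    (hcont.mono (Icc_subset_quadrant ha b))
  -- a uniform bound on `∂r/∂θᵢ` for parameters near `θ₀`, by compactness of the rectangle
  have hev : ∀ᶠ θ in 𝓝 θ₀, ∀ p ∈ Icc a b, ‖dTheta (fun θ => r θ p) i θ‖ < C + 1 := by
    refine isCompact_Icc.eventually_forall_of_forall_eventually fun p hp => ?_
    have h := hB4.cont_θ i p (Icc_subset_quadrant ha b hp)
    have h2 : ContinuousAt (fun z : (Fin d → ℝ) × (ℝ × ℝ) =>
        ‖dTheta (fun θ => r θ z.2) i z.1‖) (θ₀, p) :=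
      (ContinuousAt.comp (f := Prod.swap) (x := (θ₀, p)) h
        continuous_swap.continuousAt).norm
    have := h2.eventually_lt (continuousAt_const (y := C + 1)) (by
      have := hC p hp; simp only at this ⊢; linarith)
    exact this
  have hs : {u : ℝ | Function.update θ₀ i u ∈ B ∧ ∀ p ∈ Icc a b,
      ‖dTheta (fun θ => r θ p) i (Function.update θ₀ i u)‖ < C + 1} ∈ 𝓝 (θ₀ i) := by
    have h1 : Tendsto (fun u : ℝ => Function.update θ₀ i u) (𝓝 (θ₀ i)) (𝓝 θ₀) := by
      have := hupd.tendsto (θ₀ i)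
      rwa [hupd0] at this
    exact h1.eventually ((hB4.isOpen.eventually_mem hB4.mem).and hev)
  have hdom := (hasDerivAt_integral_of_dominated_loc_of_deriv_le (μ := volume.restrict A)
    (F := fun u p => r (Function.update θ₀ i u) p)
    (F' := fun u p => dTheta (fun θ => r θ p) i (Function.update θ₀ i u))
    (x₀ := θ₀ i) (bound := fun _ => C + 1) hs
    (by
      filter_upwards [hs] with u hu
      exact ((hB4.meas _ hu.1).mono_measure
        (Measure.restrict_mono hAq le_rfl)).aestronglyMeasurable)
    (by
      simp only [hupd0]
      exact (integrableOn_Icc_of_continuousOn hB4.continuousOn ha b).mono_set hAc)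
    (by
      simp only [hupd0]
      exact (hcont.mono hAq).aestronglyMeasurable hAm)
    ((ae_restrict_iff' hAm).2 (Eventually.of_forall fun p hp u hu => (hu.2 p (hAc hp)).le))
    (integrableOn_const
      ((measure_mono hAc).trans_lt isCompact_Icc.measure_lt_top).ne)
    ((ae_restrict_iff' hAm).2 (Eventually.of_forall fun p hp u hu => by
      have := (hB4.diff_θ i _ hu.1 p (hAq hp)).hasDerivAt
      simpa only [dTheta, Function.update_idem, Function.update_self] using this))).2
  have e := hdom.congr_of_eventuallyEq (f₁ := fun u =>
      fn (R (Function.update θ₀ i u)) b.1 b.2 - fn (R (Function.update θ₀ i u)) a.1 b.2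
        - fn (R (Function.update θ₀ i u)) b.1 a.2 + fn (R (Function.update θ₀ i u)) a.1 a.2) (by
    filter_upwards [hs] with u hu
    exact hB4.fn_increment hR hu.1 ha hab)
  have hd := fun p hp => (hB2.diff_θ i p hp).hasDerivAt
  have hbq := mem_quadrant_of_le ha hab
  have e2 := (((hd b hbq).sub (hd (a.1, b.2) ⟨ha.1, hbq.2⟩)).sub
    (hd (b.1, a.2) ⟨hbq.1, ha.2⟩)).add (hd a ha)
  have := e2.unique e
  simpa only [hupd0, dTheta] using this

end Density

/-! ### The functions `f`, `g`, `h` and the scores -/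

theorem contDiffOn_fFun (γ : ℝ) : ContDiffOn ℝ 1 (fFun γ) (Ioi 0) := by
  have hid : ContDiffOn ℝ 1 (fun x : ℝ => x) (Ioi 0) := contDiffOn_id
  have hne : ∀ x ∈ Ioi (0 : ℝ), x ≠ 0 := fun x hx => ne_of_gt hx
  unfold fFun
  split_ifs with h
  · exact hid.mul (hid.log hne)
  · exact (hid.mul ((hid.rpow_const_of_ne hne).sub contDiffOn_const)).div_const _

theorem contDiffOn_gFun (γ : ℝ) : ContDiffOn ℝ 1 (gFun γ) (Ioi 0) := by
  have hid : ContDiffOn ℝ 1 (fun x : ℝ => x) (Ioi 0) := contDiffOn_id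
  exact (hid.rpow_const_of_ne fun x hx => ne_of_gt hx).neg

theorem contDiffOn_hFun (γ : ℝ) : ContDiffOn ℝ 1 (hFun γ) (Ioi 0) := by
  have hid : ContDiffOn ℝ 1 (fun x : ℝ => x) (Ioi 0) := contDiffOn_id
  have hne : ∀ x ∈ Ioi (0 : ℝ), x ≠ 0 := fun x hx => ne_of_gt hx
  unfold hFun
  split_ifs with h
  · exact ((hid.mul ((hid.log hne).pow 2)).neg).div_const _
  · exact ((hid.mul (contDiffOn_const.sub (hid.rpow_const_of_ne hne))).div_const _).add
      ((hid.mul (hid.log hne)).div_const _)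

section Scores

variable {d : ℕ} {R : (Fin d → ℝ) → Measure (ℝ≥0∞ × ℝ≥0∞)} {r : (Fin d → ℝ) → ℝ × ℝ → ℝ}
  {Θ B : Set (Fin d → ℝ)} {θ₀ : Fin d → ℝ}

theorem continuousOn_deriv_of_contDiffOn {ψ : ℝ → ℝ} (h : ContDiffOn ℝ 1 ψ (Ioi 0)) :
    ContinuousOn (deriv ψ) (Ioi 0) := h.continuousOn_deriv_of_isOpen isOpen_Ioi le_rfl

theorem differentiableAt_of_contDiffOn {ψ : ℝ → ℝ} (h : ContDiffOn ℝ 1 ψ (Ioi 0)) (x : ℝ)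
    (hx : 0 < x) : DifferentiableAt ℝ ψ x :=
  (h.contDiffAt (isOpen_Ioi.mem_nhds hx)).differentiableAt one_ne_zero

/-- The scores multiplied by the density: the mixed derivatives `∂ₓ(φ r)`, `∂_y(φ r)`, `∂r/∂θᵢ`. -/
theorem density_mul_score (hB4 : SmoothDensityAt R r Θ B θ₀) (γ₁ γ₂ : ℝ) {p : ℝ × ℝ}
    (hp : p ∈ quadrant) :
    (fun k => r θ₀ p * score r θ₀ γ₁ γ₂ p k) = Sum.elim
      ![deriv (fFun γ₁) p.1 * r θ₀ p + fFun γ₁ p.1 * deriv (fun s => r θ₀ (s, p.2)) p.1,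
        deriv (gFun γ₁) p.1 * r θ₀ p + gFun γ₁ p.1 * deriv (fun s => r θ₀ (s, p.2)) p.1,
        deriv (hFun γ₁) p.1 * r θ₀ p + hFun γ₁ p.1 * deriv (fun s => r θ₀ (s, p.2)) p.1,
        deriv (fFun γ₂) p.2 * r θ₀ p + fFun γ₂ p.2 * deriv (fun t => r θ₀ (p.1, t)) p.2,
        deriv (gFun γ₂) p.2 * r θ₀ p + gFun γ₂ p.2 * deriv (fun t => r θ₀ (p.1, t)) p.2,
        deriv (hFun γ₂) p.2 * r θ₀ p + hFun γ₂ p.2 * deriv (fun t => r θ₀ (p.1, t)) p.2]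
      (fun i => dTheta (fun θ => r θ p) i θ₀) := by
  have hr : r θ₀ p ≠ 0 := (hB4.pos θ₀ hB4.mem p hp).ne'
  have e1 : r θ₀ p * deriv (fun s => Real.log (r θ₀ (s, p.2))) p.1 =
      deriv (fun s => r θ₀ (s, p.2)) p.1 := by
    rw [deriv.log (hB4.diff_x p hp) hr]
    field_simp
  have e2 : r θ₀ p * deriv (fun t => Real.log (r θ₀ (p.1, t))) p.2 =
      deriv (fun t => r θ₀ (p.1, t)) p.2 := by
    rw [deriv.log (hB4.diff_y p hp) hr]
    field_simp
  have hk : ∀ A F ρ D : ℝ, r θ₀ p * ρ = D → r θ₀ p * (A + F * ρ) = A * r θ₀ p + F * D := by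
    rintro A F ρ D rfl; ring
  funext k
  rcases k with k | i
  · fin_cases k
    · exact hk _ _ _ _ e1
    · exact hk _ _ _ _ e1
    · exact hk _ _ _ _ e1
    · exact hk _ _ _ _ e2
    · exact hk _ _ _ _ e2
    · exact hk _ _ _ _ e2
  · have h0 : Function.update θ₀ i (θ₀ i) = θ₀ := Function.update_eq_self i θ₀
    simp only [score, Sum.elim_inr, dTheta]
    rw [deriv.log (hB4.diff_θ i θ₀ hB4.mem p hp) (by rwa [h0]), h0]
    field_simp

theorem continuousOn_density_mul_score (hB4 : SmoothDensityAt R r Θ B θ₀) (γ₁ γ₂ : ℝ)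
    (k : Fin 6 ⊕ Fin d) :
    ContinuousOn (fun p => r θ₀ p * score r θ₀ γ₁ γ₂ p k) quadrant := by
  have h1 : ∀ ψ : ℝ → ℝ, ContDiffOn ℝ 1 ψ (Ioi 0) → ContinuousOn (fun p : ℝ × ℝ =>
      deriv ψ p.1 * r θ₀ p + ψ p.1 * deriv (fun s => r θ₀ (s, p.2)) p.1) quadrant :=
    fun ψ hψ => (((continuousOn_deriv_of_contDiffOn hψ).comp continuousOn_fst
      fun p hp => hp.1).mul hB4.continuousOn).add
      ((hψ.continuousOn.comp continuousOn_fst fun p hp => hp.1).mul hB4.cont_x)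
  have h2 : ∀ ψ : ℝ → ℝ, ContDiffOn ℝ 1 ψ (Ioi 0) → ContinuousOn (fun p : ℝ × ℝ =>
      deriv ψ p.2 * r θ₀ p + ψ p.2 * deriv (fun t => r θ₀ (p.1, t)) p.2) quadrant :=
    fun ψ hψ => (((continuousOn_deriv_of_contDiffOn hψ).comp continuousOn_snd
      fun p hp => hp.2).mul hB4.continuousOn).add
      ((hψ.continuousOn.comp continuousOn_snd fun p hp => hp.2).mul hB4.cont_y)
  have key := fun p hp => congrFun (density_mul_score hB4 γ₁ γ₂ (p := p) hp) k
  rcases k with k | i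
  · fin_cases k
    · exact (h1 _ (contDiffOn_fFun γ₁)).congr key
    · exact (h1 _ (contDiffOn_gFun γ₁)).congr key
    · exact (h1 _ (contDiffOn_hFun γ₁)).congr key
    · exact (h2 _ (contDiffOn_fFun γ₂)).congr key
    · exact (h2 _ (contDiffOn_gFun γ₂)).congr key
    · exact (h2 _ (contDiffOn_hFun γ₂)).congr key
  · exact (hB4.continuousOn_dTheta i).congr key

theorem continuousOn_score (hB4 : SmoothDensityAt R r Θ B θ₀) (γ₁ γ₂ : ℝ)
    (k : Fin 6 ⊕ Fin d) : ContinuousOn (fun p => score r θ₀ γ₁ γ₂ p k) quadrant := by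
  have hne : ∀ p ∈ quadrant, r θ₀ p ≠ 0 := fun p hp => (hB4.pos θ₀ hB4.mem p hp).ne'
  refine ((continuousOn_density_mul_score hB4 γ₁ γ₂ k).div hB4.continuousOn hne).congr
    fun p hp => ?_
  exact (mul_div_cancel_left₀ _ (hne p hp)).symm

variable {Ω : Type*}

/-- The increments of the limit process: those of the Wiener process, plus a random linear
combination of the integrals of the scores. -/
theorem increment_etaHat (hB2 : SmoothCopulaAt R θ₀) (hB4 : SmoothDensityAt R r Θ B θ₀)
    (hR : ∀ θ ∈ Θ, IsTailCopula (R θ)) (γ₁ γ₂ : ℝ)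
    (V : {p : ℝ≥0∞ × ℝ≥0∞ // p ≠ (⊤, ⊤)} → Ω → ℝ)
    (A₁ A₂ B₁ B₂ Γ₁ Γ₂ : Ω → ℝ) (ζ : Fin d → Ω → ℝ) {a b : ℝ × ℝ}
    (ha : a ∈ quadrant) (hab : a ≤ b) (ω : Ω) :
    increment (etaHat R θ₀ γ₁ γ₂ V A₁ A₂ B₁ B₂ Γ₁ Γ₂ ζ) a b ω =
      increment (fun p => V (pt p)) a b ω +
        ∑ k, (Sum.elim ![A₁, B₁, Γ₁, A₂, B₂, Γ₂] ζ : Fin 6 ⊕ Fin d → Ω → ℝ) k ω *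
          ∫ p in Ioc a.1 b.1 ×ˢ Ioc a.2 b.2, score r θ₀ γ₁ γ₂ p k ∂(finitePart (R θ₀)) := by
  have hAm := measurableSet_Ioc_prod a b
  have hAq : Ioc a.1 b.1 ×ˢ Ioc a.2 b.2 ⊆ quadrant :=
    (Ioc_prod_subset_Icc a b).trans (Icc_subset_quadrant ha b)
  have key := fun k => (hB4.setIntegral_finitePart hB4.mem hAm hAq
    (fun p => score r θ₀ γ₁ γ₂ p k)).trans (setIntegral_congr_fun hAm fun p hp =>
      congrFun (density_mul_score hB4 γ₁ γ₂ (hAq hp)) k)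
  have hF := fun (a b : ℝ × ℝ) (ha : a ∈ quadrant) (hab : a ≤ b) =>
    hB4.fn_increment hR hB4.mem ha hab
  have hx := fun (ψ : ℝ → ℝ) (hψ : ContDiffOn ℝ 1 ψ (Ioi 0)) =>
    increment_deriv_mul_eq_integral hB4.continuousOn hF hB2.diff_x hB4.diff_x hB4.cont_x
      (differentiableAt_of_contDiffOn hψ) (continuousOn_deriv_of_contDiffOn hψ) ha hab
  have hy := fun (ψ : ℝ → ℝ) (hψ : ContDiffOn ℝ 1 ψ (Ioi 0)) =>
    increment_deriv_mul_eq_integral' hB4.continuousOn hF hB2.diff_y hB4.diff_y hB4.cont_y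
      (differentiableAt_of_contDiffOn hψ) (continuousOn_deriv_of_contDiffOn hψ) ha hab
  have k0 := (key (Sum.inl 0)).trans (hx _ (contDiffOn_fFun γ₁)).symm
  have k1 := (key (Sum.inl 1)).trans (hx _ (contDiffOn_gFun γ₁)).symm
  have k2 := (key (Sum.inl 2)).trans (hx _ (contDiffOn_hFun γ₁)).symm
  have k3 := (key (Sum.inl 3)).trans (hy _ (contDiffOn_fFun γ₂)).symm
  have k4 := (key (Sum.inl 4)).trans (hy _ (contDiffOn_gFun γ₂)).symm
  have k5 := (key (Sum.inl 5)).trans (hy _ (contDiffOn_hFun γ₂)).symm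
  have kθ := fun i => (key (Sum.inr i)).trans (increment_dTheta hB2 hB4 hR i ha hab).symm
  simp only [Fintype.sum_sum_type, Fin.sum_univ_six, k0, k1, k2, k3, k4, k5, kθ]
  simp only [Sum.elim_inl, Sum.elim_inr, Matrix.cons_val, increment, etaHat]
  have hs : ∑ i, ζ i ω * (dTheta (fun θ => fn (R θ) b.1 b.2) i θ₀
      - dTheta (fun θ => fn (R θ) a.1 b.2) i θ₀
        - dTheta (fun θ => fn (R θ) b.1 a.2) i θ₀ + dTheta (fun θ => fn (R θ) a.1 a.2) i θ₀) =
      ∑ i, dTheta (fun θ => fn (R θ) b.1 b.2) i θ₀ * ζ i ω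
        - ∑ i, dTheta (fun θ => fn (R θ) a.1 b.2) i θ₀ * ζ i ω
        - ∑ i, dTheta (fun θ => fn (R θ) b.1 a.2) i θ₀ * ζ i ω
        + ∑ i, dTheta (fun θ => fn (R θ) a.1 a.2) i θ₀ * ζ i ω := by
    rw [← Finset.sum_sub_distrib, ← Finset.sum_sub_distrib, ← Finset.sum_add_distrib]
    exact Finset.sum_congr rfl fun i _ => by ring
  rw [hs]
  ring

end Scores

/-! ### Density of step functions -/

/-- The rectangles contained in `[a,b]`, given by their lower and upper corners. -/
abbrev SubRect (a b : ℝ × ℝ) := {K : (ℝ × ℝ) × (ℝ × ℝ) // a ≤ K.1 ∧ K.1 ≤ K.2 ∧ K.2 ≤ b}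

/-- The half-open rectangle with given corners. -/
def SubRect.box {a b : ℝ × ℝ} (K : SubRect a b) : Set (ℝ × ℝ) :=
  Ioc K.1.1.1 K.1.2.1 ×ˢ Ioc K.1.1.2 K.1.2.2

theorem SubRect.measurableSet_box {a b : ℝ × ℝ} (K : SubRect a b) : MeasurableSet K.box :=
  measurableSet_Ioc_prod K.1.1 K.1.2

theorem volume_fst_eq (c : ℝ) : volume {p : ℝ × ℝ | p.1 = c} = 0 := by
  have : {p : ℝ × ℝ | p.1 = c} = {c} ×ˢ univ := by ext; simp
  rw [this, Measure.volume_eq_prod, Measure.prod_prod]; simp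

theorem volume_snd_eq (c : ℝ) : volume {p : ℝ × ℝ | p.2 = c} = 0 := by
  have : {p : ℝ × ℝ | p.2 = c} = univ ×ˢ {c} := by ext; simp
  rw [this, Measure.volume_eq_prod, Measure.prod_prod]; simp

theorem ae_ne_corner {ν : Measure (ℝ × ℝ)} (hν : ν ≪ volume) (c : ℝ × ℝ) :
    ∀ᵐ p ∂ν, p.1 ≠ c.1 ∧ p.2 ≠ c.2 := by
  refine hν.ae_le ?_
  have h1 : ∀ᵐ p : ℝ × ℝ, p.1 ≠ c.1 := by
    rw [ae_iff]; simpa using volume_fst_eq c.1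
  have h2 : ∀ᵐ p : ℝ × ℝ, p.2 ≠ c.2 := by
    rw [ae_iff]; simpa using volume_snd_eq c.2
  exact h1.and h2

/-- An integrable function on `[a,b]` whose integrals over all subrectangles vanish is zero. -/
theorem ae_eq_zero_of_forall_box {m : Measure (ℝ × ℝ)} {a b : ℝ × ℝ} (hab : a ≤ b)
    (hν : m.restrict (Icc a b) ≪ volume) {g : ℝ × ℝ → ℝ}
    (hg : Integrable g (m.restrict (Icc a b)))
    (h : ∀ K : SubRect a b, ∫ p in K.box, g p ∂(m.restrict (Icc a b)) = 0) :
    g =ᵐ[m.restrict (Icc a b)] 0 := by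
  set ν := m.restrict (Icc a b) with hνdef
  have hIcc : ∀ᵐ p ∂ν, p ∈ Icc a b := ae_restrict_mem measurableSet_Icc
  have huniv : ∫ p, g p ∂ν = 0 := by
    have := h ⟨(a, b), le_rfl, hab, le_rfl⟩
    rw [← setIntegral_univ, ← this]
    refine setIntegral_congr_set ?_
    filter_upwards [hIcc, ae_ne_corner hν a] with p hp hne
    refine propext ⟨fun _ => ?_, fun _ => trivial⟩
    exact ⟨⟨lt_of_le_of_ne hp.1.1 hne.1.symm, hp.2.1⟩, ⟨lt_of_le_of_ne hp.1.2 hne.2.symm, hp.2.2⟩⟩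
  have hspan : IsCountablySpanning (range (Iic : ℝ → Set ℝ)) := by
    refine ⟨fun n : ℕ => Iic (n : ℝ), fun n => ⟨n, rfl⟩, ?_⟩
    exact iUnion_eq_univ_iff.2 fun x => exists_nat_ge x
  have hgen : (inferInstance : MeasurableSpace (ℝ × ℝ)) =
      MeasurableSpace.generateFrom (image2 (· ×ˢ ·) (range Iic) (range (Iic : ℝ → Set ℝ))) :=
    (generateFrom_eq_prod ((borel_eq_generateFrom_Iic ℝ).symm.trans
      BorelSpace.measurable_eq.symm) ((borel_eq_generateFrom_Iic ℝ).symm.trans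
      BorelSpace.measurable_eq.symm) hspan hspan).symm
  -- a `π`-`λ` argument: up to null sets, the sets `Iic x ×ˢ Iic y` meet `[a,b]` in subrectangles
  have key : ∀ s, MeasurableSet s → ∫ p in s, g p ∂ν = 0 := by
    refine MeasurableSpace.induction_on_inter hgen
      (isPiSystem_Iic.prod isPiSystem_Iic) ?_ ?_ ?_ ?_
    · simp
    · rintro _ ⟨_, ⟨x, rfl⟩, _, ⟨y, rfl⟩, rfl⟩
      have hK := h ⟨(a, (max a.1 (min x b.1), max a.2 (min y b.2))), le_rfl,
        ⟨le_max_left _ _, le_max_left _ _⟩,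
        ⟨max_le hab.1 (min_le_right _ _), max_le hab.2 (min_le_right _ _)⟩⟩
      rw [← hK]
      refine setIntegral_congr_set ?_
      filter_upwards [hIcc, ae_ne_corner hν a] with p hp hne
      have h1 : a.1 < p.1 := lt_of_le_of_ne hp.1.1 hne.1.symm
      have h2 : a.2 < p.2 := lt_of_le_of_ne hp.1.2 hne.2.symm
      refine propext ⟨fun hm => ?_, fun hm => ?_⟩
      · exact ⟨⟨h1, le_max_of_le_right (le_min hm.1 hp.2.1)⟩,
          ⟨h2, le_max_of_le_right (le_min hm.2 hp.2.2)⟩⟩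
      · refine ⟨?_, ?_⟩
        · rcases le_max_iff.1 hm.1.2 with h' | h'
          · exact absurd h' (not_le.2 h1)
          · exact h'.trans (min_le_left _ _)
        · rcases le_max_iff.1 hm.2.2 with h' | h'
          · exact absurd h' (not_le.2 h2)
          · exact h'.trans (min_le_left _ _)
    · intro t ht hz
      have := integral_add_compl ht hg
      rw [hz, huniv, zero_add] at this
      exact this
    · intro f hd hm hz
      have := integral_iUnion (μ := ν) hm hd hg.integrableOn
      simpa [hz] using this
  exact hg.ae_eq_zero_of_forall_setIntegral_eq_zero fun s hs _ => key s hs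

section Steps

variable {a b : ℝ × ℝ}

/-- The step function encoded by finitely many weighted rectangles. -/
noncomputable def toStep (x : SubRect a b →₀ ℝ) : RectStep where
  n := x.support.card
  coef i := x (x.support.equivFin.symm i)
  lo i := (x.support.equivFin.symm i).1.1.1
  hi i := (x.support.equivFin.symm i).1.1.2

theorem toStep_within (x : SubRect a b →₀ ℝ) : (toStep x).Within a b := fun i =>
  (x.support.equivFin.symm i).1.2

theorem toStep_sum (x : SubRect a b →₀ ℝ) (F : ℝ → SubRect a b → ℝ) :
    ∑ i, F ((toStep x).coef i) (x.support.equivFin.symm i).1 =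
      x.sum fun K c => F c K := by
  rw [Finsupp.sum, ← Finset.sum_coe_sort x.support]
  exact Equiv.sum_comp x.support.equivFin.symm fun K : x.support => F (x K.1) K.1

theorem toStep_toFun (x : SubRect a b →₀ ℝ) (p : ℝ × ℝ) :
    (toStep x).toFun p = x.sum fun K c => c * K.box.indicator 1 p := by
  rw [← toStep_sum x fun c K => c * K.box.indicator 1 p]
  refine Finset.sum_congr rfl fun i _ => ?_
  simp only [SubRect.box, toStep, indicator, Pi.one_apply]
  split_ifs <;> simp

theorem toStep_integral {Ω : Type*} (x : SubRect a b →₀ ℝ) (X : ℝ × ℝ → Ω → ℝ) (ω : Ω) :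
    (toStep x).integral X ω = x.sum fun K c => c * increment X K.1.1 K.1.2 ω := by
  rw [← toStep_sum x fun c K => c * increment X K.1.1 K.1.2 ω]
  rfl

/-- The rectangles of a step function on `[a,b]`, as weighted subrectangles. -/
noncomputable def ofStep (S : RectStep) (hS : S.Within a b) : SubRect a b →₀ ℝ :=
  ∑ i, Finsupp.single ⟨(S.lo i, S.hi i), hS i⟩ (S.coef i)

variable {m : Measure (ℝ × ℝ)} [IsFiniteMeasure (m.restrict (Icc a b))]

/-- Step functions as elements of `L²`. -/
noncomputable def stepLp (m : Measure (ℝ × ℝ)) (a b : ℝ × ℝ)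
    [IsFiniteMeasure (m.restrict (Icc a b))] :
    (SubRect a b →₀ ℝ) →ₗ[ℝ] Lp ℝ 2 (m.restrict (Icc a b)) :=
  Finsupp.linearCombination ℝ fun K =>
    indicatorConstLp 2 K.measurableSet_box (measure_ne_top _ _) (1 : ℝ)

theorem coeFn_linearCombination {α ι : Type*} [MeasurableSpace α] {ν : Measure α}
    (v : ι → Lp ℝ 2 ν) (w : ι → α → ℝ) (hvw : ∀ i, v i =ᵐ[ν] w i) (x : ι →₀ ℝ) :
    (Finsupp.linearCombination ℝ v x : α → ℝ) =ᵐ[ν] fun p => x.sum fun i c => c * w i p := by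
  rw [Finsupp.linearCombination_apply, Finsupp.sum]
  refine (Lp.coeFn_finsetSum _ _).trans ?_
  have h1 : ∀ᵐ p ∂ν, ∀ i ∈ x.support, (x i • v i : Lp ℝ 2 ν) p = x i * w i p := by
    refine (ae_ball_iff x.support.countable_toSet).2 ?_
    intro i _
    filter_upwards [Lp.coeFn_smul (x i) (v i), hvw i] with p h1 h2
    rw [h1, Pi.smul_apply, h2, smul_eq_mul]
  filter_upwards [h1] with p hp
  rw [Finset.sum_apply]
  exact Finset.sum_congr rfl hp

theorem stepLp_coeFn (x : SubRect a b →₀ ℝ) :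
    (stepLp m a b x : ℝ × ℝ → ℝ) =ᵐ[m.restrict (Icc a b)] (toStep x).toFun := by
  refine (coeFn_linearCombination _ (fun K : SubRect a b => K.box.indicator 1)
    (fun K => indicatorConstLp_coeFn) x).trans ?_
  exact Eventually.of_forall fun p => (toStep_toFun x p).symm

theorem ofStep_sum (S : RectStep) (hS : S.Within a b) (F : SubRect a b → ℝ) :
    ((ofStep S hS).sum fun K c => c * F K) =
      ∑ i, S.coef i * F ⟨(S.lo i, S.hi i), hS i⟩ := by
  rw [ofStep, ← Finsupp.sum_finsetSum_index (fun _ => zero_mul _) fun _ _ _ => add_mul _ _ _]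
  exact Finset.sum_congr rfl fun i _ => Finsupp.sum_single_index (zero_mul _)

theorem toStep_ofStep_integral {Ω : Type*} (S : RectStep) (hS : S.Within a b)
    (X : ℝ × ℝ → Ω → ℝ) (ω : Ω) :
    (toStep (ofStep S hS)).integral X ω = S.integral X ω := by
  rw [toStep_integral, ofStep_sum S hS fun K => increment X K.1.1 K.1.2 ω]
  rfl

theorem stepLp_ofStep (S : RectStep) (hS : S.Within a b) :
    (stepLp m a b (ofStep S hS) : ℝ × ℝ → ℝ) =ᵐ[m.restrict (Icc a b)] S.toFun := by
  refine (stepLp_coeFn _).trans (Eventually.of_forall fun p => ?_)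
  rw [toStep_toFun, ofStep_sum S hS fun K => K.box.indicator 1 p]
  refine Finset.sum_congr rfl fun i _ => ?_
  change S.coef i * (Ioc (S.lo i).1 (S.hi i).1 ×ˢ Ioc (S.lo i).2 (S.hi i).2).indicator 1 p = _
  by_cases hp : p ∈ Ioc (S.lo i).1 (S.hi i).1 ×ˢ Ioc (S.lo i).2 (S.hi i).2
  · simp only [indicator_of_mem hp, Pi.one_apply, mul_one]
  · simp only [indicator_of_notMem hp, mul_zero]

/-- Step functions are dense in `L²`: a function orthogonal to all of them has vanishing integrals
over all subrectangles. -/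
theorem denseRange_stepLp (hab : a ≤ b) (hν : m.restrict (Icc a b) ≪ volume) :
    DenseRange (stepLp m a b) := by
  have hcl : (LinearMap.range (stepLp m a b)).topologicalClosure = ⊤ := by
    rw [Submodule.topologicalClosure_eq_top_iff, Submodule.eq_bot_iff]
    intro g hg
    have hint : Integrable g (m.restrict (Icc a b)) :=
      (Lp.memLp g).integrable (by norm_num)
    have := ae_eq_zero_of_forall_box hab hν hint fun K => ?_
    · exact (Lp.eq_zero_iff_ae_eq_zero).2 this
    · have h1 := (Submodule.mem_orthogonal _ g).1 hg (stepLp m a b (Finsupp.single K 1)) ⟨_, rfl⟩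
      rw [stepLp, Finsupp.linearCombination_single, one_smul, L2.inner_indicatorConstLp_one] at h1
      exact h1
  rw [DenseRange, ← LinearMap.coe_range, dense_iff_closure_eq,
    ← Submodule.topologicalClosure_coe, hcl, Submodule.top_coe]

theorem exists_approximates {φ : ℝ × ℝ → ℝ} (hν : m.restrict (Icc a b) ≪ volume)
    (hφ : MemLp φ 2 (m.restrict (Icc a b))) : ∃ S, Approximates S φ m a b := by
  by_cases hab : a ≤ b
  · have hd := denseRange_stepLp hab hν
    obtain ⟨y, hy, hlim⟩ := mem_closure_iff_seq_limit.1 (hd (hφ.toLp φ))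
    choose x hx using hy
    refine ⟨fun n => toStep (x n), fun n => toStep_within _, ?_⟩
    have h2 := (Lp.tendsto_Lp_iff_tendsto_eLpNorm' _ _).1 hlim
    refine h2.congr fun n => eLpNorm_congr_ae ?_
    have e := stepLp_coeFn (m := m) (x n)
    rw [hx n] at e
    filter_upwards [e, hφ.coeFn_toLp] with p h3 h4
    rw [Pi.sub_apply, h3, h4]
  · refine ⟨fun _ => ⟨0, 0, 0, 0⟩, fun _ i => i.elim0, ?_⟩
    simp [Icc_eq_empty hab]

end Steps

/-! ### The isometry generated by a Gaussian random field -/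

section Isonormal

variable {Ω : Type*} [MeasurableSpace Ω] {P : Measure Ω}

/-- The characteristic function depends continuously on the random variable, in `L²`. -/
theorem continuous_charFun_Lp [IsProbabilityMeasure P] (t : ℝ) :
    Continuous fun Y : Lp ℝ 2 P => charFun (P.map Y) t := by
  have hexp : ∀ Y : Lp ℝ 2 P, charFun (P.map Y) t =
      ∫ ω, Complex.exp (t * Y ω * Complex.I) ∂P := fun Y => by
    rw [charFun_apply_real, integral_map (Lp.aestronglyMeasurable Y).aemeasurable]
    exact (by fun_prop : Continuous fun x : ℝ =>
      Complex.exp (t * x * Complex.I)).aestronglyMeasurable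
  have hint : ∀ Y : Lp ℝ 2 P, Integrable (fun ω => Complex.exp (t * Y ω * Complex.I)) P :=
    fun Y => by
      refine Integrable.of_bound (C := 1) ?_ (Eventually.of_forall fun ω => ?_)
      · exact (by fun_prop : Continuous fun x : ℝ =>
          Complex.exp (t * x * Complex.I)).comp_aestronglyMeasurable (Lp.aestronglyMeasurable Y)
      · have := Complex.norm_exp_ofReal_mul_I (t * Y ω)
        push_cast at this
        exact this.le
  have hpt : ∀ x y : ℝ, ‖Complex.exp (t * x * Complex.I) - Complex.exp (t * y * Complex.I)‖
      ≤ |t| * ‖x - y‖ := fun x y => by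
    have e : Complex.exp (t * x * Complex.I) - Complex.exp (t * y * Complex.I) =
        Complex.exp (t * y * Complex.I) *
          (Complex.exp (Complex.I * ((t * (x - y) : ℝ) : ℂ)) - 1) := by
      rw [mul_sub, ← Complex.exp_add, mul_one]
      congr 2
      push_cast; ring
    have h1 : ‖Complex.exp (t * y * Complex.I)‖ = 1 := by
      have := Complex.norm_exp_ofReal_mul_I (t * y)
      push_cast at this
      exact this
    rw [e, norm_mul, h1, one_mul]
    refine Real.norm_exp_I_mul_ofReal_sub_one_le.trans ?_
    rw [norm_mul, Real.norm_eq_abs]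
  refine LipschitzWith.continuous (K := ⟨|t|, abs_nonneg t⟩) (LipschitzWith.of_dist_le_mul
    fun Y Z => ?_)
  have hYZ : Integrable (fun ω => ‖Y ω - Z ω‖) P :=
    (((Lp.memLp Y).sub (Lp.memLp Z)).integrable (by norm_num)).norm
  have hL1 : ∫ ω, ‖Y ω - Z ω‖ ∂P ≤ dist Y Z := by
    have h1 : eLpNorm (Y - Z : Ω → ℝ) 1 P ≤ eLpNorm (Y - Z : Ω → ℝ) 2 P :=
      eLpNorm_le_eLpNorm_of_exponent_le (by norm_num)
        ((Lp.aestronglyMeasurable Y).sub (Lp.aestronglyMeasurable Z))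
    have h2 : ∫ ω, ‖Y ω - Z ω‖ ∂P = (eLpNorm (Y - Z : Ω → ℝ) 1 P).toReal := by
      rw [eLpNorm_one_eq_lintegral_enorm]
      exact integral_norm_eq_lintegral_enorm (f := fun ω => Y ω - Z ω)
        ((Lp.aestronglyMeasurable Y).sub (Lp.aestronglyMeasurable Z))
    rw [h2, Lp.dist_def]
    exact ENNReal.toReal_mono ((Lp.memLp Y).sub (Lp.memLp Z)).2.ne h1
  rw [hexp, hexp, dist_eq_norm, ← integral_sub (hint Y) (hint Z)]
  calc ‖∫ ω, Complex.exp (t * Y ω * Complex.I) - Complex.exp (t * Z ω * Complex.I) ∂P‖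
      ≤ ∫ ω, |t| * ‖Y ω - Z ω‖ ∂P :=
        norm_integral_le_of_norm_le (hYZ.const_mul _)
          (Eventually.of_forall fun ω => hpt (Y ω) (Z ω))
    _ = |t| * ∫ ω, ‖Y ω - Z ω‖ ∂P := integral_const_mul _ _
    _ ≤ |t| * dist Y Z := by gcongr

/-- A centred Gaussian random field whose increments over subrectangles of `[a,b]` have the
covariances of a white noise with control measure `m`, which is finite and absolutely continuous
on `[a,b]`. -/
structure IsIsonormalOn (P : Measure Ω) (X : ℝ × ℝ → Ω → ℝ) (m : Measure (ℝ × ℝ))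
    (a b : ℝ × ℝ) : Prop where
  le : a ≤ b
  finite : IsFiniteMeasure (m.restrict (Icc a b))
  ac : m.restrict (Icc a b) ≪ volume
  memLp : ∀ p, MemLp (X p) 2 P
  isometry : ∀ S : RectStep, S.Within a b →
    ∫ ω, S.integral X ω ^ 2 ∂P = ∫ p in Icc a b, S.toFun p ^ 2 ∂m
  gaussian : ∀ S : RectStep, S.Within a b → HasGaussianLaw (S.integral X) P
  mean : ∀ p, ∫ ω, X p ω ∂P = 0

namespace IsIsonormalOn

variable {X : ℝ × ℝ → Ω → ℝ} {m : Measure (ℝ × ℝ)} {a b : ℝ × ℝ}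

theorem memLp_increment (h : IsIsonormalOn P X m a b) (c d : ℝ × ℝ) :
    MemLp (increment X c d) 2 P :=
  (((h.memLp _).sub (h.memLp _)).sub (h.memLp _)).add (h.memLp _)

theorem memLp_integral (h : IsIsonormalOn P X m a b) (S : RectStep) :
    MemLp (S.integral X) 2 P :=
  memLp_finsetSum _ fun i _ => (h.memLp_increment (S.lo i) (S.hi i)).const_mul (S.coef i)

theorem integral_integral_step [IsProbabilityMeasure P] (h : IsIsonormalOn P X m a b)
    (S : RectStep) : ∫ ω, S.integral X ω ∂P = 0 := by
  have hi : ∀ p, Integrable (X p) P := fun p => (h.memLp p).integrable (by norm_num)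
  simp only [RectStep.integral]
  rw [integral_finsetSum _ fun i _ =>
    ((h.memLp_increment (S.lo i) (S.hi i)).integrable (by norm_num)).const_mul _]
  refine Finset.sum_eq_zero fun i _ => ?_
  rw [integral_const_mul]
  simp only [increment]
  rw [integral_add, integral_sub, integral_sub, h.mean, h.mean, h.mean, h.mean]
  · simp
  · exact hi _
  · exact hi _
  · exact (hi _).sub (hi _)
  · exact hi _
  · exact ((hi _).sub (hi _)).sub (hi _)
  · exact hi _

/-- The integrals of step functions, as elements of `L²(P)`. -/
noncomputable def incLp (h : IsIsonormalOn P X m a b) :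
    (SubRect a b →₀ ℝ) →ₗ[ℝ] Lp ℝ 2 P :=
  Finsupp.linearCombination ℝ fun K => (h.memLp_increment K.1.1 K.1.2).toLp _

theorem incLp_coeFn (h : IsIsonormalOn P X m a b) (x : SubRect a b →₀ ℝ) :
    (h.incLp x : Ω → ℝ) =ᵐ[P] (toStep x).integral X := by
  refine (coeFn_linearCombination _ (fun K : SubRect a b => increment X K.1.1 K.1.2)
    (fun K => (h.memLp_increment K.1.1 K.1.2).coeFn_toLp) x).trans ?_
  exact Eventually.of_forall fun ω => (toStep_integral x X ω).symm

theorem norm_sq_eq_integral {α : Type*} [MeasurableSpace α] {ν : Measure α} (f : Lp ℝ 2 ν) :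
    ‖f‖ ^ 2 = ∫ x, f x ^ 2 ∂ν := by
  rw [← real_inner_self_eq_norm_sq, L2.inner_def]
  simp [sq]

variable [hfin : IsFiniteMeasure (m.restrict (Icc a b))]

theorem norm_incLp (h : IsIsonormalOn P X m a b) (x : SubRect a b →₀ ℝ) :
    ‖h.incLp x‖ = ‖stepLp m a b x‖ := by
  rw [← sq_eq_sq₀ (norm_nonneg _) (norm_nonneg _), norm_sq_eq_integral, norm_sq_eq_integral]
  have e1 : ∫ ω, h.incLp x ω ^ 2 ∂P = ∫ ω, (toStep x).integral X ω ^ 2 ∂P :=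
    integral_congr_ae ((h.incLp_coeFn x).fun_comp (· ^ 2))
  have e2 : ∫ p in Icc a b, stepLp m a b x p ^ 2 ∂m = ∫ p in Icc a b, (toStep x).toFun p ^ 2 ∂m :=
    integral_congr_ae ((stepLp_coeFn x).fun_comp (· ^ 2))
  rw [e1, e2, h.isometry _ (toStep_within x)]

/-- The integral of square integrable functions on `[a,b]` against the random field: the extension
by density of the integral of step functions. -/
noncomputable def iso (h : IsIsonormalOn P X m a b) :
    Lp ℝ 2 (m.restrict (Icc a b)) →L[ℝ] Lp ℝ 2 P :=
  h.incLp.extendOfNorm (stepLp m a b)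

theorem iso_stepLp (h : IsIsonormalOn P X m a b) (x : SubRect a b →₀ ℝ) :
    h.iso (stepLp m a b x) = h.incLp x :=
  LinearMap.extendOfNorm_eq (denseRange_stepLp h.le h.ac)
    ⟨1, fun y => by rw [one_mul, h.norm_incLp]⟩ x

theorem iso_of_step (h : IsIsonormalOn P X m a b) {S : RectStep} (hS : S.Within a b)
    {g : Lp ℝ 2 (m.restrict (Icc a b))} (hg : g =ᵐ[m.restrict (Icc a b)] S.toFun) :
    (h.iso g : Ω → ℝ) =ᵐ[P] S.integral X := by
  have e : g = stepLp m a b (ofStep S hS) := Lp.ext (hg.trans (stepLp_ofStep S hS).symm)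
  rw [e, h.iso_stepLp]
  exact (h.incLp_coeFn _).trans (Eventually.of_forall fun ω => toStep_ofStep_integral S hS X ω)

theorem norm_iso (h : IsIsonormalOn P X m a b) (g : Lp ℝ 2 (m.restrict (Icc a b))) :
    ‖h.iso g‖ = ‖g‖ := by
  refine (denseRange_stepLp h.le h.ac).induction_on g
    (isClosed_eq (by fun_prop) (by fun_prop)) fun x => ?_
  rw [h.iso_stepLp, h.norm_incLp]

theorem inner_iso (h : IsIsonormalOn P X m a b) (f g : Lp ℝ 2 (m.restrict (Icc a b))) :
    inner ℝ (h.iso f) (h.iso g) = inner ℝ f g :=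
  (⟨h.iso.toLinearMap, h.norm_iso⟩ : _ →ₗᵢ[ℝ] _).inner_map_map f g

/-- The integrals have centred Gaussian laws: this holds for step functions, and the identity of
characteristic functions passes to limits in `L²`. -/
theorem map_iso [IsProbabilityMeasure P] (h : IsIsonormalOn P X m a b)
    (g : Lp ℝ 2 (m.restrict (Icc a b))) :
    P.map (h.iso g) = gaussianReal 0 (‖g‖ ^ 2).toNNReal := by
  have hm : ∀ Y : Lp ℝ 2 P, IsProbabilityMeasure (P.map Y) := fun Y =>
    Measure.isProbabilityMeasure_map (Lp.aestronglyMeasurable Y).aemeasurable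
  have := hm (h.iso g)
  refine Measure.ext_of_charFun (funext fun t => ?_)
  rw [charFun_gaussianReal]
  have hnn : ∀ f : Lp ℝ 2 (m.restrict (Icc a b)), (((‖f‖ ^ 2).toNNReal : ℝ) : ℂ) =
      ((‖f‖ ^ 2 : ℝ) : ℂ) := fun f => by rw [Real.coe_toNNReal _ (sq_nonneg _)]
  rw [hnn]
  refine (denseRange_stepLp h.le h.ac).induction_on
    (p := fun f : Lp ℝ 2 (m.restrict (Icc a b)) => charFun (P.map (h.iso f)) t =
      Complex.exp (t * (0 : ℝ) * Complex.I - ((‖f‖ ^ 2 : ℝ) : ℂ) * t ^ 2 / 2)) g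
    (isClosed_eq ((continuous_charFun_Lp t).comp h.iso.continuous) (by fun_prop)) fun x => ?_
  rw [h.iso_stepLp, Measure.map_congr (h.incLp_coeFn x),
    (h.gaussian _ (toStep_within x)).map_eq_gaussianReal, charFun_gaussianReal,
    h.integral_integral_step, Real.coe_toNNReal _ (variance_nonneg _ _),
    variance_eq_sub (h.memLp_integral _), h.integral_integral_step, ← h.norm_incLp,
    norm_sq_eq_integral]
  have e1 : ∫ ω, h.incLp x ω ^ 2 ∂P = ∫ ω, ((toStep x).integral X ^ 2) ω ∂P :=
    integral_congr_ae ((h.incLp_coeFn x).fun_comp (· ^ 2))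
  rw [e1]
  simp

theorem integral_iso [IsProbabilityMeasure P] (h : IsIsonormalOn P X m a b)
    (g : Lp ℝ 2 (m.restrict (Icc a b))) : ∫ ω, h.iso g ω ∂P = 0 := by
  have hl := h.map_iso g
  have := integral_map (Lp.aestronglyMeasurable (h.iso g)).aemeasurable
    (f := fun x : ℝ => x) (μ := P) aestronglyMeasurable_id
  rw [← this, hl]
  exact integral_id_gaussianReal

/-- Integrals against an isonormal random field form a Gaussian process. -/
theorem isGaussianProcess_iso [IsProbabilityMeasure P] (h : IsIsonormalOn P X m a b)
    {ι : Type*} (g : ι → Lp ℝ 2 (m.restrict (Icc a b))) {W : ι → Ω → ℝ}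
    (hW : ∀ i, W i =ᵐ[P] h.iso (g i)) : IsGaussianProcess W P := by
  refine IsGaussianProcess.congr (X := fun i => (h.iso (g i) : Ω → ℝ)) ⟨fun I => ?_⟩
    fun i => (hW i).symm
  have hmeas : AEMeasurable (fun ω => I.restrict fun i => h.iso (g i) ω) P :=
    aemeasurable_pi_lambda _ fun i => (Lp.aestronglyMeasurable (h.iso (g i))).aemeasurable
  -- a linear functional of the integrals is the integral of a linear combination
  refine ⟨isGaussian_of_map_eq_gaussianReal fun L => ?_⟩
  classical
  set w : I → ℝ := fun i => L (fun j => if i = j then 1 else 0) with hw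
  refine ⟨0, (‖∑ i : I, w i • g i‖ ^ 2).toNNReal, ?_⟩
  rw [← h.map_iso, AEMeasurable.map_map_of_aemeasurable L.continuous.aemeasurable hmeas]
  refine Measure.map_congr ?_
  rw [map_sum]
  have e : ∀ᵐ ω ∂P, ∀ i : I, (h.iso (w i • g i) : Ω → ℝ) ω = w i * h.iso (g i) ω := by
    refine ae_all_iff.2 fun i => ?_
    rw [map_smul]
    filter_upwards [Lp.coeFn_smul (w i) (h.iso (g i))] with ω hω
    rw [hω, Pi.smul_apply, smul_eq_mul]
  filter_upwards [e, Lp.coeFn_finsetSum Finset.univ fun i : I => h.iso (w i • g i)] with ω h1 h2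
  rw [h2, Finset.sum_apply]
  simp only [h1, Function.comp_apply]
  refine (L.toLinearMap.pi_apply_eq_sum_univ _).trans (Finset.sum_congr rfl fun i _ => ?_)
  exact mul_comm _ _

end IsIsonormalOn

end Isonormal

/-! ### Integrals of square integrable functions against random fields -/

section FieldIntegral

variable {Ω : Type*} [MeasurableSpace Ω] {P : Measure Ω}

theorem RectStep.Within.mono {S : RectStep} {a b c d : ℝ × ℝ} (h : S.Within c d) (hac : a ≤ c)
    (hdb : d ≤ b) : S.Within a b := fun i =>
  ⟨hac.trans (h i).1, (h i).2.1, (h i).2.2.trans hdb⟩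

theorem RectStep.Within.toFun_eq_zero {S : RectStep} {a b : ℝ × ℝ} (h : S.Within a b)
    {p : ℝ × ℝ} (hp : p ∉ Icc a b) : S.toFun p = 0 :=
  Finset.sum_eq_zero fun i _ => indicator_of_notMem (fun hm => hp
    ⟨(h i).1.trans (Ioc_prod_subset_Icc _ _ hm).1,
      (Ioc_prod_subset_Icc _ _ hm).2.trans (h i).2.2⟩) _

theorem RectStep.memLp_toFun (S : RectStep) (ν : Measure (ℝ × ℝ)) [IsFiniteMeasure ν] :
    MemLp S.toFun 2 ν :=
  memLp_finsetSum _ fun _ _ => (memLp_const _).indicator (measurableSet_Ioc_prod _ _)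

/-- A Wiener process with time `R` is isonormal on the rectangles of the open quadrant. -/
theorem IsWienerWithTime.isIsonormalOn [IsProbabilityMeasure P]
    {V : {p : ℝ≥0∞ × ℝ≥0∞ // p ≠ (⊤, ⊤)} → Ω → ℝ}
    {R : Measure (ℝ≥0∞ × ℝ≥0∞)} (hV : IsWienerWithTime V R P) (hR : IsTailCopula R)
    {a b : ℝ × ℝ} (ha : 0 ≤ a) (hab : a ≤ b)
    (hfin : IsFiniteMeasure ((finitePart R).restrict (Icc a b)))
    (hac : (finitePart R).restrict (Icc a b) ≪ volume) :
    IsIsonormalOn P (fun p => V (pt p)) (finitePart R) a b where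
  le := hab
  finite := hfin
  ac := hac
  memLp p := pt_memLp hV _
  mean p := hV.mean _
  isometry S hS := by
    rw [integral_sq_step hR hV S ha hS]
    refine (setIntegral_eq_integral_of_forall_compl_eq_zero fun p hp => ?_).symm
    rw [hS.toFun_eq_zero hp, sq, zero_mul]
  gaussian S hS := by
    let c : Fin S.n × Bool × Bool → ℝ × ℝ := fun k =>
      (if k.2.1 then (S.hi k.1).1 else (S.lo k.1).1, if k.2.2 then (S.hi k.1).2 else (S.lo k.1).2)
    let sg : Bool → ℝ := fun b => if b then 1 else -1
    let w : Fin S.n × Bool × Bool → ℝ := fun k => S.coef k.1 * (sg k.2.1 * sg k.2.2)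
    have h := ((hV.gaussian.comp_right fun k => pt (c k)).smul w).hasGaussianLaw_fun_sum
      (I := Finset.univ)
    refine h.congr (Eventually.of_forall fun ω => ?_)
    simp only [RectStep.integral, increment, Fintype.sum_prod_type, Fintype.sum_bool, w, c, sg,
      Function.comp_apply, smul_eq_mul]
    refine Finset.sum_congr rfl fun i _ => ?_
    simp
    ring

/-- The class in `L²(ν)` of `φ 1_{[c,d]}`. -/
noncomputable def indLp {ν : Measure (ℝ × ℝ)} {φ : ℝ × ℝ → ℝ} (hφ : MemLp φ 2 ν) (c d : ℝ × ℝ) :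
    Lp ℝ 2 ν :=
  (hφ.indicator (measurableSet_Icc (a := c) (b := d))).toLp _

theorem indLp_coeFn {ν : Measure (ℝ × ℝ)} {φ : ℝ × ℝ → ℝ} (hφ : MemLp φ 2 ν) (c d : ℝ × ℝ) :
    (indLp hφ c d : ℝ × ℝ → ℝ) =ᵐ[ν] (Icc c d).indicator φ :=
  MemLp.coeFn_toLp _

theorem inner_indLp {ν : Measure (ℝ × ℝ)} {φ : ℝ × ℝ → ℝ} (hφ : MemLp φ 2 ν) (c d : ℝ × ℝ)
    (g : Lp ℝ 2 ν) : inner ℝ (indLp hφ c d) g = ∫ p in Icc c d, φ p * g p ∂ν := by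
  rw [L2.inner_def, ← integral_indicator measurableSet_Icc]
  refine integral_congr_ae ?_
  filter_upwards [indLp_coeFn hφ c d] with p hp
  rw [hp]
  by_cases h : p ∈ Icc c d
  · simp [indicator_of_mem h, mul_comm]
  · simp [indicator_of_notMem h]

theorem Approximates.tendsto_indLp {m : Measure (ℝ × ℝ)} {a b c d : ℝ × ℝ}
    [IsFiniteMeasure (m.restrict (Icc a b))] {S : ℕ → RectStep} {φ : ℝ × ℝ → ℝ}
    (hS : Approximates S φ m c d) (hac : a ≤ c) (hdb : d ≤ b)
    (hφ : MemLp φ 2 (m.restrict (Icc a b))) :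
    Tendsto (fun n => ((S n).memLp_toFun (m.restrict (Icc a b))).toLp (S n).toFun) atTop
      (𝓝 (indLp hφ c d)) := by
  refine (Lp.tendsto_Lp_iff_tendsto_eLpNorm'' _ _ _ _).2 (hS.2.congr fun n => ?_)
  have hsub : Icc c d ⊆ Icc a b := Icc_subset_Icc hac hdb
  have e : (S n).toFun - (Icc c d).indicator φ =
      (Icc c d).indicator fun p => (S n).toFun p - φ p := by
    funext p
    by_cases h : p ∈ Icc c d
    · simp [indicator_of_mem h]
    · simp [indicator_of_notMem h, (hS.1 n).toFun_eq_zero h]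
  rw [e, eLpNorm_indicator_eq_eLpNorm_restrict measurableSet_Icc,
    Measure.restrict_restrict measurableSet_Icc, inter_eq_left.2 hsub]

/-- The integrals of approximating step functions against a square integrable function converge. -/
theorem Approximates.tendsto_setIntegral_mul {m : Measure (ℝ × ℝ)} {c d : ℝ × ℝ}
    [IsFiniteMeasure (m.restrict (Icc c d))] {S : ℕ → RectStep} {φ g : ℝ × ℝ → ℝ}
    (hS : Approximates S φ m c d) (hφ : MemLp φ 2 (m.restrict (Icc c d)))
    (hg : MemLp g 2 (m.restrict (Icc c d))) :
    Tendsto (fun n => ∫ p in Icc c d, (S n).toFun p * g p ∂m) atTop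
      (𝓝 (∫ p in Icc c d, φ p * g p ∂m)) := by
  have hlim : Tendsto (fun n => ((S n).memLp_toFun (m.restrict (Icc c d))).toLp (S n).toFun) atTop
      (𝓝 (hφ.toLp φ)) := (Lp.tendsto_Lp_iff_tendsto_eLpNorm'' _ _ _ _).2 hS.2
  have hin : ∀ {f : ℝ × ℝ → ℝ} (hf : MemLp f 2 (m.restrict (Icc c d))),
      inner ℝ (hf.toLp f) (hg.toLp g) = ∫ p in Icc c d, f p * g p ∂m := fun {f} hf => by
    rw [L2.inner_def]
    refine integral_congr_ae ?_
    filter_upwards [hf.coeFn_toLp, hg.coeFn_toLp] with p h1 h2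
    simp [h1, h2, mul_comm]
  have := hlim.inner (𝕜 := ℝ) (tendsto_const_nhds (x := hg.toLp g))
  simpa only [hin] using this

theorem IsIsonormalOn.tendstoInMeasure_integral {X : ℝ × ℝ → Ω → ℝ} {m : Measure (ℝ × ℝ)}
    {a b c d : ℝ × ℝ} [IsFiniteMeasure (m.restrict (Icc a b))] (h : IsIsonormalOn P X m a b)
    {S : ℕ → RectStep} {φ : ℝ × ℝ → ℝ} (hS : Approximates S φ m c d) (hac : a ≤ c) (hdb : d ≤ b)
    (hφ : MemLp φ 2 (m.restrict (Icc a b))) :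
    TendstoInMeasure P (fun n => (S n).integral X) atTop (h.iso (indLp hφ c d)) := by
  have h1 := tendstoInMeasure_of_tendsto_Lp
    ((h.iso.continuous.tendsto _).comp (hS.tendsto_indLp hac hdb hφ))
  exact h1.congr (fun n => h.iso_of_step ((hS.1 n).mono hac hdb) (MemLp.coeFn_toLp _)) .rfl

theorem tendstoInMeasure_add_of_ae [IsFiniteMeasure P] {f g : ℕ → Ω → ℝ} {F G : Ω → ℝ}
    (hf : ∀ n, AEStronglyMeasurable (f n) P) (hg : ∀ n, AEStronglyMeasurable (g n) P)
    (hF : TendstoInMeasure P f atTop F) (hG : ∀ᵐ ω ∂P, Tendsto (fun n => g n ω) atTop (𝓝 (G ω))) :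
    TendstoInMeasure P (fun n => f n + g n) atTop (F + G) := by
  refine (exists_seq_tendstoInMeasure_atTop_iff fun n => (hf n).add (hg n)).2 fun ns hns => ?_
  obtain ⟨ns', hns', h⟩ := (hF.comp hns.tendsto_atTop).exists_seq_tendsto_ae
  refine ⟨ns', hns', ?_⟩
  filter_upwards [h, hG] with ω h1 h2
  exact h1.add (h2.comp (hns.tendsto_atTop.comp hns'.tendsto_atTop))

/-- Integrals against a field `X'` that differs from an isonormal one by a term whose contribution
`D` to the integrals of step functions converges almost surely to `D'` along every approximating
sequence. -/
theorem IsIsonormalOn.hasFieldIntegral_iff [IsProbabilityMeasure P] {X X' : ℝ × ℝ → Ω → ℝ}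
    {m : Measure (ℝ × ℝ)} {a b c d : ℝ × ℝ} [IsFiniteMeasure (m.restrict (Icc a b))]
    (h : IsIsonormalOn P X m a b) (hac : a ≤ c) (hdb : d ≤ b)
    {φ : ℝ × ℝ → ℝ} (hφ : MemLp φ 2 (m.restrict (Icc a b)))
    {D : RectStep → Ω → ℝ} {D' : Ω → ℝ} (hDm : ∀ S, AEStronglyMeasurable (D S) P)
    (hX : ∀ S : RectStep, S.Within c d → S.integral X' =ᵐ[P] S.integral X + D S)
    (hD : ∀ S, Approximates S φ m c d →
      ∀ᵐ ω ∂P, Tendsto (fun n => D (S n) ω) atTop (𝓝 (D' ω))) {Y : Ω → ℝ} :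
    HasFieldIntegral P X' m φ c d Y ↔ Y =ᵐ[P] h.iso (indLp hφ c d) + D' := by
  have hsub : Icc c d ⊆ Icc a b := Icc_subset_Icc hac hdb
  have hle : m.restrict (Icc c d) ≤ m.restrict (Icc a b) := Measure.restrict_mono hsub le_rfl
  have hfin : IsFiniteMeasure (m.restrict (Icc c d)) := isFiniteMeasure_of_le _ hle
  have hex : ∃ S, Approximates S φ m c d :=
    exists_approximates ((Measure.absolutelyContinuous_of_le hle).trans h.ac)
      (hφ.mono_measure hle)
  have hlim : ∀ S, Approximates S φ m c d → TendstoInMeasure P (fun n => (S n).integral X') atTop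
      (h.iso (indLp hφ c d) + D') := fun S hS => by
    refine TendstoInMeasure.congr (fun n => (hX (S n) (hS.1 n)).symm) .rfl ?_
    exact tendstoInMeasure_add_of_ae (fun n => (h.memLp_integral (S n)).aestronglyMeasurable)
      (fun n => hDm (S n)) (h.tendstoInMeasure_integral hS hac hdb hφ) (hD S hS)
  constructor
  · rintro ⟨-, hY⟩
    obtain ⟨S, hS⟩ := hex
    exact tendstoInMeasure_ae_unique (hY S hS) (hlim S hS)
  · intro hY
    exact ⟨hex, fun S hS => (hlim S hS).congr (fun n => .rfl) hY.symm⟩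

end FieldIntegral

/-! ### Jointly measurable versions and pointwise integration of `L²`-valued functions -/

section Versions

variable {Ω : Type*} [MeasurableSpace Ω] {P : Measure Ω}

theorem lintegral_enorm_le_enorm [IsProbabilityMeasure P] (Y : Lp ℝ 2 P) :
    ∫⁻ ω, ‖Y ω‖ₑ ∂P ≤ ‖Y‖ₑ := by
  rw [← eLpNorm_one_eq_lintegral_enorm, Lp.enorm_def]
  exact eLpNorm_le_eLpNorm_of_exponent_le (by norm_num) (Lp.aestronglyMeasurable Y)

/-- A process indexed by the line that is Hölder continuous in `L²` has a jointly measurable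
version: the almost sure limit of the processes frozen at dyadic times. -/
theorem exists_measurable_version [IsProbabilityMeasure P] (G : ℝ → Lp ℝ 2 P) {K : ℝ}
    (hG : ∀ s t, ‖G s - G t‖ ^ 2 ≤ K * |s - t|) :
    ∃ N : ℝ × Ω → ℝ, Measurable N ∧ ∀ t, (fun ω => N (t, ω)) =ᵐ[P] G t := by
  have hK : 0 ≤ K := by
    have := (sq_nonneg _).trans (hG 1 0)
    simpa using this
  -- with mesh `4⁻ⁿ` the `L²` distances are of order `2⁻ⁿ`, hence summable
  let fr : ℕ → ℝ → ℝ := fun n t => (⌊t * 4 ^ n⌋ : ℝ) / 4 ^ n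
  have hfr : ∀ n t, |fr n t - t| ≤ (1 / 4) ^ n := fun n t => by
    have h4 : (0 : ℝ) < 4 ^ n := by positivity
    have h1 := Int.floor_le (t * 4 ^ n)
    have h2 := Int.lt_floor_add_one (t * 4 ^ n)
    have e : fr n t - t = (⌊t * 4 ^ n⌋ - t * 4 ^ n) / 4 ^ n := by
      simp only [fr]; field_simp
    rw [e, abs_div, abs_of_pos h4, div_le_iff₀ h4, ← mul_pow]
    norm_num
    rw [abs_le]; constructor <;> linarith
  let Nn : ℕ → ℝ × Ω → ℝ := fun n z => G (fr n z.1) z.2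
  have hNn : ∀ n, Measurable (Nn n) := fun n => by
    have h1 : Measurable fun z : ℤ × Ω => G ((z.1 : ℝ) / 4 ^ n) z.2 :=
      measurable_from_prod_countable_right fun k =>
        (Lp.stronglyMeasurable (G ((k : ℝ) / 4 ^ n))).measurable
    have h2 : Measurable fun z : ℝ × Ω => (⌊z.1 * 4 ^ n⌋, z.2) :=
      (Int.measurable_floor.comp (measurable_fst.mul_const _)).prodMk measurable_snd
    exact h1.comp h2
  refine ⟨fun z => limUnder atTop fun n => Nn n z,
    (StronglyMeasurable.limUnder fun n => (hNn n).stronglyMeasurable).measurable, fun t => ?_⟩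
  have hnorm : ∀ n, ‖G (fr n t) - G t‖ ≤ √K * (1 / 2) ^ n := fun n => by
    refine le_of_sq_le_sq ?_ (by positivity)
    calc ‖G (fr n t) - G t‖ ^ 2 ≤ K * |fr n t - t| := hG _ _
      _ ≤ K * (1 / 4) ^ n := by gcongr; exact hfr n t
      _ = (√K * (1 / 2) ^ n) ^ 2 := by
        rw [mul_pow, Real.sq_sqrt hK, ← pow_mul, mul_comm n 2, pow_mul]; norm_num
  have hsum : ∑' n, ∫⁻ ω, ‖(G (fr n t) - G t : Lp ℝ 2 P) ω‖ₑ ∂P ≠ ⊤ := by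
    have hs : Summable fun n => √K * (1 / 2 : ℝ) ^ n :=
      (summable_geometric_of_lt_one (by norm_num) (by norm_num)).mul_left _
    refine ne_top_of_le_ne_top hs.tsum_ofReal_ne_top (ENNReal.tsum_le_tsum fun n => ?_)
    refine (lintegral_enorm_le_enorm _).trans ?_
    rw [← ofReal_norm]
    exact ENNReal.ofReal_le_ofReal (hnorm n)
  rw [← lintegral_tsum fun n => (Lp.aestronglyMeasurable _).enorm] at hsum
  have hae := ae_lt_top' (AEMeasurable.tsum fun n =>
    (Lp.aestronglyMeasurable (G (fr n t) - G t)).enorm) hsum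
  have hsub : ∀ᵐ ω ∂P, ∀ n, (G (fr n t) - G t : Lp ℝ 2 P) ω = G (fr n t) ω - G t ω :=
    ae_all_iff.2 fun n => Lp.coeFn_sub _ _
  filter_upwards [hae, hsub] with ω h1 h2
  refine Tendsto.limUnder_eq ?_
  have h3 := ENNReal.tendsto_atTop_zero_of_tsum_ne_top h1.ne
  rw [tendsto_iff_edist_tendsto_0]
  refine h3.congr fun n => ?_
  rw [h2, edist_eq_enorm_sub]

variable {A : Type*} [MeasurableSpace A] {ν : Measure A}

theorem integrable_sq_prod_of_coeFn [IsFiniteMeasure P] [IsFiniteMeasure ν] {κ : A → Lp ℝ 2 P}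
    {F : A × Ω → ℝ} (hFm : AEStronglyMeasurable F (ν.prod P))
    (hF : ∀ᵐ u ∂ν, (κ u : Ω → ℝ) =ᵐ[P] fun ω => F (u, ω)) {C : ℝ}
    (hC : ∀ᵐ u ∂ν, ‖κ u‖ ≤ C) : Integrable (fun z => F z ^ 2) (ν.prod P) := by
  refine (integrable_prod_iff (hFm.pow 2)).2 ⟨?_, ?_⟩
  · filter_upwards [hF] with u hu
    refine (Lp.memLp (κ u)).integrable_sq.congr ?_
    filter_upwards [hu] with ω hω
    rw [hω]; rfl
  · refine Integrable.of_bound (C := C ^ 2) (hFm.pow 2).norm.integral_prod_right' ?_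
    filter_upwards [hF, hC] with u hu hCu
    have e : ∫ ω, ‖F (u, ω) ^ 2‖ ∂P = ‖κ u‖ ^ 2 := by
      rw [IsIsonormalOn.norm_sq_eq_integral]
      refine integral_congr_ae ?_
      filter_upwards [hu] with ω hω
      rw [hω, Real.norm_of_nonneg (sq_nonneg _)]
    have e' : ∫ ω, ‖(F ^ 2) (u, ω)‖ ∂P = ‖κ u‖ ^ 2 := e
    rw [e', Real.norm_of_nonneg (sq_nonneg _)]
    gcongr

/-- The Bochner integral of an `L²`-valued function is the integral of its values at almost every
point: both sides have the same integrals over measurable sets, by Fubini's theorem. -/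
theorem coeFn_integral_Lp [IsFiniteMeasure P] [IsFiniteMeasure ν] {κ : A → Lp ℝ 2 P}
    (hκ : Integrable κ ν) {F : A × Ω → ℝ} (hFi : Integrable F (ν.prod P))
    (hF : ∀ᵐ u ∂ν, (κ u : Ω → ℝ) =ᵐ[P] fun ω => F (u, ω)) :
    ((∫ u, κ u ∂ν : Lp ℝ 2 P) : Ω → ℝ) =ᵐ[P] fun ω => ∫ u, F (u, ω) ∂ν := by
  refine Integrable.ae_eq_of_forall_setIntegral_eq _ _
    ((Lp.memLp _).integrable (by norm_num)) hFi.integral_prod_right fun s hs _ => ?_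
  rw [← L2.inner_indicatorConstLp_one (𝕜 := ℝ) hs (measure_ne_top _ _), ← integral_inner hκ]
  have e : ∀ᵐ u ∂ν, inner ℝ (indicatorConstLp 2 hs (measure_ne_top P s) (1 : ℝ)) (κ u) =
      ∫ ω in s, F (u, ω) ∂P := by
    filter_upwards [hF] with u hu
    rw [L2.inner_indicatorConstLp_one]
    exact setIntegral_congr_ae₀ hs.nullMeasurableSet (hu.mono fun ω h _ => h)
  rw [integral_congr_ae e]
  have hFs : Integrable (Function.uncurry fun u ω => F (u, ω)) (ν.prod (P.restrict s)) :=
    hFi.mono_measure (Measure.prod_mono le_rfl Measure.restrict_le_self)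
  exact integral_integral_swap hFs

end Versions

/-! ### The scores as elements of `L²` -/

section Scores

variable {Ω' : Type*} {d : ℕ} {m : Measure (ℝ × ℝ)} {δ T : ℝ} {q : ℝ × ℝ → Fin 6 ⊕ Fin d → ℝ}

/-- The class of `q_j 1_{[δ,T] × [t,T]}`. -/
noncomputable def scoreLp (hq : ∀ j, MemLp (fun p => q p j) 2 (m.restrict (Icc (δ, δ) (T, T))))
    (t : ℝ) (j : Fin 6 ⊕ Fin d) : Lp ℝ 2 (m.restrict (Icc (δ, δ) (T, T))) :=
  indLp (hq j) (δ, t) (T, T)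

theorem inner_scoreLp (hq : ∀ j, MemLp (fun p => q p j) 2 (m.restrict (Icc (δ, δ) (T, T))))
    {s t : ℝ} (hs : δ ≤ s) (i j : Fin 6 ⊕ Fin d) :
    inner ℝ (scoreLp hq s i) (scoreLp hq t j) = fisher q m δ T (max s t) i j := by
  rw [scoreLp, inner_indLp]
  have e : ∀ᵐ p ∂((m.restrict (Icc (δ, δ) (T, T))).restrict (Icc (δ, s) (T, T))),
      q p i * scoreLp hq t j p = (Icc (δ, t) (T, T)).indicator (fun p => q p i * q p j) p := by
    filter_upwards [ae_restrict_of_ae (indLp_coeFn (hq j) (δ, t) (T, T))] with p hp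
    rw [scoreLp, hp]
    by_cases h : p ∈ Icc (δ, t) (T, T)
    · simp [indicator_of_mem h]
    · simp [indicator_of_notMem h]
  rw [integral_congr_ae e, setIntegral_indicator measurableSet_Icc,
    Measure.restrict_restrict (measurableSet_Icc.inter measurableSet_Icc), Icc_inter_Icc,
    Icc_inter_Icc]
  simp [fisher, hs]

/-- The scores on `[δ,T] × [t,T]` are `1/2`-Hölder continuous in `t`, in `L²`, when `m` has a
bounded density. -/
theorem exists_norm_scoreLp_sub_le
    (hq : ∀ j, MemLp (fun p => q p j) 2 (m.restrict (Icc (δ, δ) (T, T)))) {C : ℝ}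
    (hm : m.restrict (Icc (δ, δ) (T, T)) ≤ ENNReal.ofReal C • volume) (hδT : δ ≤ T) (hC : 0 ≤ C)
    (j : Fin 6 ⊕ Fin d) (hqc : ContinuousOn (fun p => q p j) (Icc (δ, δ) (T, T)))
    [IsFiniteMeasure (m.restrict (Icc (δ, δ) (T, T)))] :
    ∃ K, ∀ s t, ‖scoreLp hq s j - scoreLp hq t j‖ ^ 2 ≤ K * |s - t| := by
  obtain ⟨Q, hQ⟩ := isCompact_Icc.exists_bound_of_continuousOn hqc
  refine ⟨Q ^ 2 * (C * (T - δ)), fun s t => ?_⟩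
  set μ := m.restrict (Icc (δ, δ) (T, T)) with hμ
  have hstripm : MeasurableSet ((univ : Set ℝ) ×ˢ uIcc s t) :=
    MeasurableSet.univ.prod measurableSet_uIcc
  have hstrip : μ.real ((univ : Set ℝ) ×ˢ uIcc s t) ≤ C * (T - δ) * |s - t| := by
    have h1 : μ ((univ : Set ℝ) ×ˢ uIcc s t) ≤ ENNReal.ofReal (C * (T - δ) * |s - t|) := by
      rw [hμ, Measure.restrict_apply hstripm, ← inter_self (Icc (δ, δ) (T, T)), ← inter_assoc,
        ← Measure.restrict_apply (hstripm.inter measurableSet_Icc)]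
      refine (hm _).trans ?_
      rw [Measure.smul_apply, smul_eq_mul]
      have h2 : (univ : Set ℝ) ×ˢ uIcc s t ∩ Icc (δ, δ) (T, T) ⊆ Icc δ T ×ˢ uIcc s t :=
        fun p hp => ⟨⟨hp.2.1.1, hp.2.2.1⟩, hp.1.2⟩
      refine (mul_le_mul_right (measure_mono h2) _).trans (le_of_eq ?_)
      rw [Measure.volume_eq_prod, Measure.prod_prod, Real.volume_Icc, Real.volume_interval,
        ← ENNReal.ofReal_mul (by linarith), ← ENNReal.ofReal_mul hC, abs_sub_comm t s, mul_assoc]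
    refine ENNReal.toReal_le_of_le_ofReal ?_ h1
    exact mul_nonneg (mul_nonneg hC (by linarith)) (abs_nonneg _)
  rw [IsIsonormalOn.norm_sq_eq_integral]
  have hpt : ∀ᵐ p ∂μ, (scoreLp hq s j - scoreLp hq t j : Lp ℝ 2 μ) p ^ 2 ≤
      ((univ : Set ℝ) ×ˢ uIcc s t).indicator (fun _ => Q ^ 2) p := by
    filter_upwards [Lp.coeFn_sub (scoreLp hq s j) (scoreLp hq t j),
      indLp_coeFn (hq j) (δ, s) (T, T), indLp_coeFn (hq j) (δ, t) (T, T),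
      ae_restrict_mem measurableSet_Icc] with p h1 h2 h3 hp
    have hQp : q p j ^ 2 ≤ Q ^ 2 := by
      rw [← sq_abs]
      exact pow_le_pow_left₀ (abs_nonneg _) (hQ p hp) 2
    rw [h1, Pi.sub_apply, scoreLp, scoreLp, h2, h3]
    have hmem : ∀ c, p ∈ Icc (δ, c) (T, T) ↔ c ≤ p.2 := fun c =>
      ⟨fun h => h.1.2, fun h => ⟨⟨hp.1.1, h⟩, hp.2⟩⟩
    by_cases hin : p ∈ (univ : Set ℝ) ×ˢ uIcc s t
    · rw [indicator_of_mem hin]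
      simp only [indicator, hmem]
      split_ifs <;> simp <;> first | exact hQp | exact sq_nonneg _
    · rw [indicator_of_notMem hin]
      have hiff : s ≤ p.2 ↔ t ≤ p.2 := by
        have hin' : p.2 ∉ uIcc s t := fun h => hin ⟨trivial, h⟩
        rw [mem_uIcc] at hin'
        push Not at hin'
        constructor
        · intro h; by_contra h'; push Not at h'
          exact absurd (hin'.1 h) (by linarith)
        · intro h; by_contra h'; push Not at h'
          exact absurd (hin'.2 h) (by linarith)
      simp only [indicator, hmem, hiff, sub_self, sq, mul_zero, le_refl]
  have hint : Integrable (((univ : Set ℝ) ×ˢ uIcc s t).indicator (fun _ => Q ^ 2)) μ :=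
    (integrable_const _).indicator hstripm
  refine (integral_mono_ae (Lp.memLp _).integrable_sq hint hpt).trans ?_
  rw [integral_indicator_const _ hstripm, smul_eq_mul]
  nlinarith [sq_nonneg Q]

theorem continuous_of_norm_sub_sq_le {E : Type*} [SeminormedAddCommGroup E] {G : ℝ → E} {K : ℝ}
    (hG : ∀ s t, ‖G s - G t‖ ^ 2 ≤ K * |s - t|) : Continuous G := by
  refine continuous_iff_continuousAt.2 fun t => tendsto_iff_norm_sub_tendsto_zero.2 ?_
  have h1 : Tendsto (fun s => K * |s - t|) (𝓝 t) (𝓝 0) := by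
    have : Tendsto (fun s => K * |s - t|) (𝓝 t) (𝓝 (K * |t - t|)) :=
      Continuous.tendsto (by fun_prop) t
    simpa using this
  have h2 : Tendsto (fun s => ‖G s - G t‖ ^ 2) (𝓝 t) (𝓝 0) :=
    squeeze_zero (fun _ => sq_nonneg _) (fun s => hG s t) h1
  have h3 := h2.sqrt
  simpa [Real.sqrt_sq] using h3

/-- The row vector `qᵀ(s,t) I(t)⁻¹` of the compensator. -/
noncomputable def weight (q : ℝ × ℝ → Fin 6 ⊕ Fin d → ℝ) (m : Measure (ℝ × ℝ)) (δ T : ℝ)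
    (u : ℝ × ℝ) : Fin 6 ⊕ Fin d → ℝ :=
  q u ᵥ* (fisher q m δ T u.2)⁻¹

theorem drift_eq_weight (J : ℝ → Ω' → Fin 6 ⊕ Fin d → ℝ) (u : ℝ × ℝ) (ω : Ω') :
    q u ⬝ᵥ ((fisher q m δ T u.2)⁻¹ *ᵥ J u.2 ω) = weight q m δ T u ⬝ᵥ J u.2 ω :=
  Matrix.dotProduct_mulVec _ _ _

theorem weight_vecMul (hI : ∀ t ∈ Ico δ T, IsUnit (fisher q m δ T t)) {u : ℝ × ℝ}
    (hu : u.2 ∈ Ico δ T) : weight q m δ T u ᵥ* fisher q m δ T u.2 = q u := by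
  rw [weight, Matrix.vecMul_vecMul, Matrix.nonsing_inv_mul _
    ((Matrix.isUnit_iff_isUnit_det _).1 (hI _ hu)), Matrix.vecMul_one]

theorem continuousOn_fisher
    (hq : ∀ j, MemLp (fun p => q p j) 2 (m.restrict (Icc (δ, δ) (T, T))))
    (hcont : ∀ j, Continuous fun t => scoreLp hq t j) :
    ContinuousOn (fun t => fisher q m δ T t) (Ici δ) := by
  refine continuousOn_pi.2 fun i => continuousOn_pi.2 fun j => ?_
  have : Continuous fun t => (inner ℝ (scoreLp hq t i) (scoreLp hq t j) : ℝ) :=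
    (hcont i).inner (hcont j)
  refine this.continuousOn.congr fun t ht => ?_
  have e := inner_scoreLp hq (t := t) ht i j
  rw [max_self] at e
  exact e.symm

theorem continuousOn_weight
    (hq : ∀ j, MemLp (fun p => q p j) 2 (m.restrict (Icc (δ, δ) (T, T))))
    (hcont : ∀ j, Continuous fun t => scoreLp hq t j)
    (hqc : ∀ j, ContinuousOn (fun p => q p j) (Icc (δ, δ) (T, T)))
    (hI : ∀ t ∈ Ico δ T, IsUnit (fisher q m δ T t)) {p : ℝ × ℝ} (hp1 : p.1 ≤ T) (hp2 : p.2 < T) :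
    ContinuousOn (weight q m δ T) (Icc (δ, δ) p) := by
  have hF : ContinuousOn (fun u : ℝ × ℝ => fisher q m δ T u.2) (Icc (δ, δ) p) :=
    (continuousOn_fisher hq hcont).comp continuousOn_snd fun u hu => hu.1.2
  have hinv : ContinuousOn (fun u : ℝ × ℝ => (fisher q m δ T u.2)⁻¹) (Icc (δ, δ) p) := by
    simp only [Matrix.inv_def, Ring.inverse_eq_inv']
    have hdet : Continuous fun M : Matrix (Fin 6 ⊕ Fin d) (Fin 6 ⊕ Fin d) ℝ => M.det :=
      Continuous.matrix_det continuous_id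
    have hadj : Continuous fun M : Matrix (Fin 6 ⊕ Fin d) (Fin 6 ⊕ Fin d) ℝ => M.adjugate :=
      Continuous.matrix_adjugate continuous_id
    have hne : ∀ u ∈ Icc (δ, δ) p, (fisher q m δ T u.2).det ≠ 0 := fun u hu =>
      ((Matrix.isUnit_iff_isUnit_det _).1 (hI u.2 ⟨hu.1.2, hu.2.2.trans_lt hp2⟩)).ne_zero
    exact ((hdet.comp_continuousOn hF).inv₀ hne).smul (hadj.comp_continuousOn hF)
  have hq' : ContinuousOn q (Icc (δ, δ) p) := continuousOn_pi.2 fun j =>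
    (hqc j).mono (Icc_subset_Icc le_rfl ⟨hp1, hp2.le⟩)
  have hmul : Continuous fun z : (Fin 6 ⊕ Fin d → ℝ) × Matrix (Fin 6 ⊕ Fin d) (Fin 6 ⊕ Fin d) ℝ =>
      z.1 ᵥ* z.2 := Continuous.matrix_vecMul continuous_fst continuous_snd
  exact hmul.comp_continuousOn (hq'.prodMk hinv)

/-- The element `∑ w_j(u) q_j 1_{[δ,T] × [u₂,T]}` of `L²` whose integral against the random field is
the compensating integrand at `u`. -/
noncomputable def kernelLp
    (hq : ∀ j, MemLp (fun p => q p j) 2 (m.restrict (Icc (δ, δ) (T, T)))) (u : ℝ × ℝ) :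
    Lp ℝ 2 (m.restrict (Icc (δ, δ) (T, T))) :=
  ∑ j, weight q m δ T u j • scoreLp hq u.2 j

theorem continuousOn_kernelLp
    (hq : ∀ j, MemLp (fun p => q p j) 2 (m.restrict (Icc (δ, δ) (T, T))))
    (hcont : ∀ j, Continuous fun t => scoreLp hq t j)
    (hqc : ∀ j, ContinuousOn (fun p => q p j) (Icc (δ, δ) (T, T)))
    (hI : ∀ t ∈ Ico δ T, IsUnit (fisher q m δ T t)) {p : ℝ × ℝ} (hp1 : p.1 ≤ T) (hp2 : p.2 < T) :
    ContinuousOn (kernelLp hq) (Icc (δ, δ) p) := by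
  have hw := continuousOn_pi.1 (continuousOn_weight hq hcont hqc hI hp1 hp2)
  exact continuousOn_finsetSum _ fun j _ =>
    (hw j).smul ((hcont j).comp continuous_snd).continuousOn

/-- The pointwise values of `kernelLp`. -/
noncomputable def kernelFun (q : ℝ × ℝ → Fin 6 ⊕ Fin d → ℝ) (m : Measure (ℝ × ℝ)) (δ T : ℝ)
    (z : (ℝ × ℝ) × (ℝ × ℝ)) : ℝ :=
  if z.1.2 ≤ z.2.2 then weight q m δ T z.1 ⬝ᵥ q z.2 else 0

theorem coeFn_sum_smul {α ι : Type*} [MeasurableSpace α] [Fintype ι] {ν : Measure α} (c : ι → ℝ)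
    (v : ι → Lp ℝ 2 ν) (w : ι → α → ℝ) (hvw : ∀ i, v i =ᵐ[ν] w i) :
    ((∑ i, c i • v i : Lp ℝ 2 ν) : α → ℝ) =ᵐ[ν] fun p => ∑ i, c i * w i p := by
  have h1 : ∀ᵐ p ∂ν, ∀ i, (c i • v i : Lp ℝ 2 ν) p = c i * w i p := by
    refine ae_all_iff.2 fun i => ?_
    filter_upwards [Lp.coeFn_smul (c i) (v i), hvw i] with p h1 h2
    rw [h1, Pi.smul_apply, h2, smul_eq_mul]
  filter_upwards [Lp.coeFn_finsetSum Finset.univ fun i => c i • v i, h1] with p h2 h3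
  rw [h2, Finset.sum_apply]
  exact Finset.sum_congr rfl fun i _ => h3 i

theorem kernelLp_coeFn
    (hq : ∀ j, MemLp (fun p => q p j) 2 (m.restrict (Icc (δ, δ) (T, T)))) (u : ℝ × ℝ) :
    (kernelLp hq u : ℝ × ℝ → ℝ) =ᵐ[m.restrict (Icc (δ, δ) (T, T))]
      fun p => kernelFun q m δ T (u, p) := by
  refine (coeFn_sum_smul _ _ _ fun j => indLp_coeFn (hq j) (δ, u.2) (T, T)).trans ?_
  filter_upwards [ae_restrict_mem measurableSet_Icc] with p hp
  have hmem : p ∈ Icc (δ, u.2) (T, T) ↔ u.2 ≤ p.2 :=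
    ⟨fun h => h.1.2, fun h => ⟨⟨hp.1.1, h⟩, hp.2⟩⟩
  simp only [indicator, hmem, kernelFun, dotProduct]
  split_ifs <;> simp

/-- The reproducing property behind the innovation transform: `⟨κ(u), κ(v)⟩ = κ(u)(v) + κ(v)(u)`
when `u₂ ≠ v₂`. -/
theorem inner_kernelLp
    (hq : ∀ j, MemLp (fun p => q p j) 2 (m.restrict (Icc (δ, δ) (T, T))))
    (hI : ∀ t ∈ Ico δ T, IsUnit (fisher q m δ T t)) {u v : ℝ × ℝ} (hu : u.2 ∈ Ico δ T)
    (hv : v.2 ∈ Ico δ T) (huv : v.2 ≠ u.2) :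
    inner ℝ (kernelLp hq u) (kernelLp hq v) =
      kernelFun q m δ T (u, v) + kernelFun q m δ T (v, u) := by
  have hlt : ∀ {u v : ℝ × ℝ}, u.2 ∈ Ico δ T → v.2 ∈ Ico δ T → u.2 < v.2 →
      inner ℝ (kernelLp hq u) (kernelLp hq v) = weight q m δ T u ⬝ᵥ q v := by
    intro u v hu hv h
    have hsum : inner ℝ (kernelLp hq u) (kernelLp hq v) =
        ∑ i, ∑ j, weight q m δ T u i * (weight q m δ T v j * fisher q m δ T v.2 j i) := by
      simp only [kernelLp, sum_inner, inner_sum, real_inner_smul_left, real_inner_smul_right]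
      rw [Finset.sum_comm]
      refine Finset.sum_congr rfl fun i _ => Finset.sum_congr rfl fun j _ => ?_
      rw [real_inner_comm, inner_scoreLp hq hv.1, max_eq_left h.le]
      ring
    rw [hsum, ← weight_vecMul hI hv]
    simp only [dotProduct, Matrix.vecMul, Finset.mul_sum]
  rcases lt_or_gt_of_ne huv with h | h
  · rw [real_inner_comm, hlt hv hu h]
    simp [kernelFun, h.le, not_le.2 h]
  · rw [hlt hu hv h]
    simp [kernelFun, h.le, not_le.2 h]

end Scores

/-! ### The innovation transform -/

section Innovation

theorem RectStep.sum_setIntegral {m : Measure (ℝ × ℝ)} {c d : ℝ × ℝ} {S : RectStep}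
    (hS : S.Within c d) {g : ℝ × ℝ → ℝ} (hg : IntegrableOn g (Icc c d) m) :
    ∑ i, S.coef i * ∫ u in Ioc (S.lo i).1 (S.hi i).1 ×ˢ Ioc (S.lo i).2 (S.hi i).2, g u ∂m =
      ∫ u in Icc c d, S.toFun u * g u ∂m := by
  have hsub : ∀ i, Ioc (S.lo i).1 (S.hi i).1 ×ˢ Ioc (S.lo i).2 (S.hi i).2 ⊆ Icc c d := fun i =>
    (Ioc_prod_subset_Icc _ _).trans (Icc_subset_Icc (hS i).1 (hS i).2.2)
  have e : ∀ u, S.toFun u * g u = ∑ i, S.coef i *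
      (Ioc (S.lo i).1 (S.hi i).1 ×ˢ Ioc (S.lo i).2 (S.hi i).2).indicator g u := fun u => by
    rw [RectStep.toFun, Finset.sum_mul]
    refine Finset.sum_congr rfl fun i _ => ?_
    by_cases h : u ∈ Ioc (S.lo i).1 (S.hi i).1 ×ˢ Ioc (S.lo i).2 (S.hi i).2
    · simp only [indicator_of_mem h]
    · simp only [indicator_of_notMem h, zero_mul, mul_zero]
  simp only [e]
  rw [integral_finsetSum _ fun i _ =>
    (Integrable.indicator hg (measurableSet_Ioc_prod _ _)).const_mul _]
  refine Finset.sum_congr rfl fun i _ => ?_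
  rw [integral_const_mul, setIntegral_indicator (measurableSet_Ioc_prod _ _),
    inter_eq_right.2 (hsub i)]

/-- The increments of an indefinite integral. -/
theorem increment_setIntegral {m : Measure (ℝ × ℝ)} {a p c d : ℝ × ℝ} (hac : a ≤ c) (hcd : c ≤ d)
    (hdp : d ≤ p) {g : ℝ × ℝ → ℝ} (hg : IntegrableOn g (Icc a p) m) :
    (∫ u in Icc a d, g u ∂m) - (∫ u in Icc a (c.1, d.2), g u ∂m)
        - (∫ u in Icc a (d.1, c.2), g u ∂m) + ∫ u in Icc a c, g u ∂m =
      ∫ u in Ioc c.1 d.1 ×ˢ Ioc c.2 d.2, g u ∂m := by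
  have hi : ∀ e : ℝ × ℝ, Integrable ((Icc a e).indicator g) (m.restrict (Icc a p)) := fun e =>
    Integrable.indicator hg measurableSet_Icc
  have hI : ∀ e ≤ p, ∫ u in Icc a e, g u ∂m = ∫ u in Icc a p, (Icc a e).indicator g u ∂m :=
    fun e he => by
      rw [setIntegral_indicator measurableSet_Icc, inter_eq_right.2 (Icc_subset_Icc le_rfl he)]
  have hsub : Ioc c.1 d.1 ×ˢ Ioc c.2 d.2 ⊆ Icc a p :=
    (Ioc_prod_subset_Icc _ _).trans (Icc_subset_Icc hac hdp)
  rw [hI d hdp, hI (c.1, d.2) ⟨hcd.1.trans hdp.1, hdp.2⟩, hI (d.1, c.2) ⟨hdp.1, hcd.2.trans hdp.2⟩,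
    hI c (hcd.trans hdp), ← inter_eq_right.2 hsub, ← setIntegral_indicator
    (measurableSet_Ioc_prod _ _), ← integral_sub, ← integral_sub, ← integral_add]
  · refine setIntegral_congr_fun measurableSet_Icc fun u hu => ?_
    have hm : ∀ e : ℝ × ℝ, u ∈ Icc a e ↔ u.1 ≤ e.1 ∧ u.2 ≤ e.2 := fun e =>
      ⟨fun h => h.2, fun h => ⟨hu.1, h⟩⟩
    have e1 : u.1 ≤ c.1 → u.1 ≤ d.1 := fun h => h.trans hcd.1
    have e2 : u.2 ≤ c.2 → u.2 ≤ d.2 := fun h => h.trans hcd.2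
    simp only [indicator, hm, mem_prod, mem_Ioc, ← not_le]
    by_cases c1 : u.1 ≤ c.1 <;> by_cases c2 : u.1 ≤ d.1 <;>
      by_cases c3 : u.2 ≤ c.2 <;> by_cases c4 : u.2 ≤ d.2 <;>
      first
      | exact absurd (e1 c1) c2
      | exact absurd (e2 c3) c4
      | simp [c1, c2, c3, c4]
  · exact ((hi d).sub (hi (c.1, d.2))).sub (hi (d.1, c.2))
  · exact hi c
  · exact (hi d).sub (hi (c.1, d.2))
  · exact hi (d.1, c.2)
  · exact hi d
  · exact hi (c.1, d.2)

variable {Ω : Type*} [MeasurableSpace Ω] {P : Measure Ω} {d : ℕ}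

/-- A random field `η` whose increments on `[δ,T]²` are those of an isonormal field `X` plus a
random linear combination, with coefficients `ξ`, of the integrals of the scores `q`. -/
structure ScoreModel (P : Measure Ω) (X η : ℝ × ℝ → Ω → ℝ) (ξ : Fin 6 ⊕ Fin d → Ω → ℝ)
    (q : ℝ × ℝ → Fin 6 ⊕ Fin d → ℝ) (m : Measure (ℝ × ℝ)) (δ T : ℝ) : Prop where
  isonormal : IsIsonormalOn P X m (δ, δ) (T, T)
  bounded : ∃ C, 0 ≤ C ∧ m.restrict (Icc (δ, δ) (T, T)) ≤ ENNReal.ofReal C • volume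
  cont : ∀ j, ContinuousOn (fun p => q p j) (Icc (δ, δ) (T, T))
  isUnit : ∀ t ∈ Ico δ T, IsUnit (fisher q m δ T t)
  meas : ∀ k, Measurable (ξ k)
  increment_eq : ∀ c e : ℝ × ℝ, (δ, δ) ≤ c → c ≤ e → e ≤ (T, T) → ∀ᵐ ω ∂P,
    increment η c e ω = increment X c e ω +
      ∑ k, ξ k ω * ∫ p in Ioc c.1 e.1 ×ˢ Ioc c.2 e.2, q p k ∂m

namespace ScoreModel

variable {X η : ℝ × ℝ → Ω → ℝ} {ξ : Fin 6 ⊕ Fin d → Ω → ℝ}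
  {q : ℝ × ℝ → Fin 6 ⊕ Fin d → ℝ} {m : Measure (ℝ × ℝ)} {δ T : ℝ}

theorem memLp_of_continuousOn [IsFiniteMeasure (m.restrict (Icc (δ, δ) (T, T)))] {φ : ℝ × ℝ → ℝ}
    (hφ : ContinuousOn φ (Icc (δ, δ) (T, T))) : MemLp φ 2 (m.restrict (Icc (δ, δ) (T, T))) := by
  obtain ⟨C, hC⟩ := isCompact_Icc.exists_bound_of_continuousOn hφ
  exact MemLp.of_bound (hφ.aestronglyMeasurable measurableSet_Icc) C
    ((ae_restrict_iff' measurableSet_Icc).2 (Eventually.of_forall hC))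

theorem restrict_le {c e : ℝ × ℝ} (hc : (δ, δ) ≤ c) (he : e ≤ (T, T)) :
    m.restrict (Icc c e) ≤ m.restrict (Icc (δ, δ) (T, T)) :=
  Measure.restrict_mono (Icc_subset_Icc hc he) le_rfl

/-- The part of the compensating integrand that is due to the isonormal field: the contribution of
the coefficients `ξ` to `J` is subtracted. The time is truncated below at `δ`, where the matrices
`I(t)` are known to be continuous, so that the function is jointly measurable. -/
noncomputable def noise (ξ : Fin 6 ⊕ Fin d → Ω → ℝ) (q : ℝ × ℝ → Fin 6 ⊕ Fin d → ℝ)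
    (m : Measure (ℝ × ℝ)) (δ T : ℝ) (J : ℝ → Ω → Fin 6 ⊕ Fin d → ℝ) (z : (ℝ × ℝ) × Ω) : ℝ :=
  ∑ j, weight q m δ T z.1 j *
    (J z.1.2 z.2 j - ∑ k, ξ k z.2 * fisher q m δ T (max z.1.2 δ) j k)

/-- The compensating integrand reproduces the random drift `∑ ξ_k q_k` of the increments of `η`
exactly, since `qᵀ I⁻¹ I ξ = qᵀ ξ`. -/
theorem drift_eq (M : ScoreModel P X η ξ q m δ T) (J : ℝ → Ω → Fin 6 ⊕ Fin d → ℝ) {u : ℝ × ℝ}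
    (hu : u.2 ∈ Ico δ T) (ω : Ω) :
    drift q m δ T J u ω = noise ξ q m δ T J (u, ω) + ∑ k, ξ k ω * q u k := by
  have h : ∑ k, ξ k ω * q u k = ∑ j, weight q m δ T u j *
      ∑ k, ξ k ω * fisher q m δ T u.2 j k := by
    conv_lhs => rw [← weight_vecMul M.isUnit hu]
    simp only [Matrix.vecMul, dotProduct, Finset.mul_sum]
    rw [Finset.sum_comm]
    exact Finset.sum_congr rfl fun j _ => Finset.sum_congr rfl fun k _ => by ring
  rw [drift, drift_eq_weight, h, noise]
  simp only [max_eq_left hu.1, mul_sub, Finset.sum_sub_distrib, dotProduct, sub_add_cancel]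

variable [hfin : IsFiniteMeasure (m.restrict (Icc (δ, δ) (T, T)))]

theorem memLp (M : ScoreModel P X η ξ q m δ T) (j : Fin 6 ⊕ Fin d) :
    MemLp (fun p => q p j) 2 (m.restrict (Icc (δ, δ) (T, T))) :=
  memLp_of_continuousOn (M.cont j)

theorem exists_holder (M : ScoreModel P X η ξ q m δ T) (j : Fin 6 ⊕ Fin d) :
    ∃ K, ∀ s t, ‖scoreLp M.memLp s j - scoreLp M.memLp t j‖ ^ 2 ≤ K * |s - t| := by
  obtain ⟨C, hC, hm⟩ := M.bounded
  exact exists_norm_scoreLp_sub_le M.memLp hm M.isonormal.le.1 hC j (M.cont j)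

theorem continuous_scoreLp (M : ScoreModel P X η ξ q m δ T) (j : Fin 6 ⊕ Fin d) :
    Continuous fun t => scoreLp M.memLp t j := by
  obtain ⟨K, hK⟩ := M.exists_holder j
  exact continuous_of_norm_sub_sq_le hK

theorem isFiniteMeasure_restrict {c e : ℝ × ℝ} (hc : (δ, δ) ≤ c) (he : e ≤ (T, T)) :
    IsFiniteMeasure (m.restrict (Icc c e)) :=
  isFiniteMeasure_of_le _ (Measure.restrict_mono (Icc_subset_Icc hc he) le_rfl)

theorem ae_integral_step (M : ScoreModel P X η ξ q m δ T) {c e : ℝ × ℝ} (hc : (δ, δ) ≤ c)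
    (he : e ≤ (T, T)) {S : RectStep} (hS : S.Within c e) : ∀ᵐ ω ∂P,
    S.integral η ω = S.integral X ω +
      ∑ k, ξ k ω * ∫ p in Icc c e, S.toFun p * q p k ∂m := by
  have hi : ∀ k, IntegrableOn (fun p => q p k) (Icc c e) m := fun k =>
    ((M.memLp k).integrable (by norm_num)).mono_measure (restrict_le hc he)
  have hinc := ae_all_iff.2 fun i => M.increment_eq (S.lo i) (S.hi i) (hc.trans (hS i).1) (hS i).2.1
    ((hS i).2.2.trans he)
  filter_upwards [hinc] with ω hω
  simp only [RectStep.integral, hω, mul_add, Finset.sum_add_distrib]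
  congr 1
  simp only [← RectStep.sum_setIntegral hS (hi _), Finset.mul_sum]
  rw [Finset.sum_comm]
  exact Finset.sum_congr rfl fun k _ => Finset.sum_congr rfl fun i _ => by ring

/-- The integral of `φ` against `η`: the integral against the isonormal field, plus the integrals
against the score terms. -/
theorem hasFieldIntegral_iff [IsProbabilityMeasure P] (M : ScoreModel P X η ξ q m δ T)
    {c e : ℝ × ℝ} (hc : (δ, δ) ≤ c) (he : e ≤ (T, T)) {φ : ℝ × ℝ → ℝ}
    (hφ : MemLp φ 2 (m.restrict (Icc (δ, δ) (T, T)))) {Y : Ω → ℝ} :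
    HasFieldIntegral P η m φ c e Y ↔ Y =ᵐ[P] (M.isonormal.iso (indLp hφ c e) : Ω → ℝ) +
      fun ω => ∑ k, ξ k ω * ∫ p in Icc c e, φ p * q p k ∂m := by
  have hf := isFiniteMeasure_restrict (m := m) hc he
  refine M.isonormal.hasFieldIntegral_iff hc he hφ
    (D := fun S ω => ∑ k, ξ k ω * ∫ p in Icc c e, S.toFun p * q p k ∂m)
    (fun S => (Finset.measurable_sum _ fun k _ => (M.meas k).mul_const _).aestronglyMeasurable)
    (fun S hS => M.ae_integral_step hc he hS) fun S hS => Eventually.of_forall fun ω => ?_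
  exact tendsto_finsetSum _ fun k _ => (hS.tendsto_setIntegral_mul
    (hφ.mono_measure (restrict_le hc he)) ((M.memLp k).mono_measure
      (restrict_le hc he))).const_mul _

theorem measurable_fisher (M : ScoreModel P X η ξ q m δ T) (j k : Fin 6 ⊕ Fin d) :
    Measurable fun t => fisher q m δ T (max t δ) j k := by
  have h := (continuousOn_fisher M.memLp M.continuous_scoreLp).comp_continuous
    (f := fun t : ℝ => max t δ) (by fun_prop) fun t => mem_Ici.2 (le_max_right t δ)
  exact ((continuous_apply k).comp ((continuous_apply j).comp h)).measurable

theorem isScoreIntegral_iff_ae [IsProbabilityMeasure P] (M : ScoreModel P X η ξ q m δ T) {t : ℝ}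
    (ht : t ∈ Ico δ T) (j : Fin 6 ⊕ Fin d) {Y : Ω → ℝ} :
    HasFieldIntegral P η m (fun p => q p j) (δ, t) (T, T) Y ↔
      Y =ᵐ[P] (M.isonormal.iso (scoreLp M.memLp t j) : Ω → ℝ) +
        fun ω => ∑ k, ξ k ω * fisher q m δ T (max t δ) j k := by
  rw [max_eq_left ht.1]
  exact M.hasFieldIntegral_iff (c := (δ, t)) ⟨le_rfl, ht.1⟩ le_rfl (M.memLp j)

/-- The isonormal part of the score integrals is Hölder continuous in `L²`, hence has a jointly
measurable version; the remaining part is continuous in `t`. -/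
theorem exists_isScoreIntegral [IsProbabilityMeasure P] (M : ScoreModel P X η ξ q m δ T) :
    ∃ J : ℝ → Ω → Fin 6 ⊕ Fin d → ℝ, IsScoreIntegral P η m q δ T J := by
  have hN : ∀ j, ∃ N : ℝ × Ω → ℝ, Measurable N ∧
      ∀ t, (fun ω => N (t, ω)) =ᵐ[P] M.isonormal.iso (scoreLp M.memLp t j) := fun j => by
    obtain ⟨K, hK⟩ := M.exists_holder j
    refine exists_measurable_version (fun t => M.isonormal.iso (scoreLp M.memLp t j))
      (K := K) fun s t => ?_
    rw [← map_sub, M.isonormal.norm_iso]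
    exact hK s t
  choose N hNm hN using hN
  refine ⟨fun t ω j => N j (t, ω) + ∑ k, ξ k ω * fisher q m δ T (max t δ) j k, ?_, ?_⟩
  · refine measurable_pi_lambda _ fun j => (hNm j).add (Finset.measurable_sum _ fun k _ => ?_)
    exact ((M.meas k).comp measurable_snd).mul ((M.measurable_fisher j k).comp measurable_fst)
  · intro t ht j
    refine (M.isScoreIntegral_iff_ae ht j).2 ?_
    filter_upwards [hN j t] with ω hω
    rw [Pi.add_apply, ← hω]

section Compensator

variable {J : ℝ → Ω → Fin 6 ⊕ Fin d → ℝ} {p : ℝ × ℝ}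

theorem mem_Ico_of_mem {u : ℝ × ℝ} (hp2 : p.2 < T) (hu : u ∈ Icc (δ, δ) p) : u.2 ∈ Ico δ T :=
  ⟨hu.1.2, hu.2.2.trans_lt hp2⟩

theorem aestronglyMeasurable_noise [IsProbabilityMeasure P] (M : ScoreModel P X η ξ q m δ T)
    (hJ : IsScoreIntegral P η m q δ T J) (hp1 : p.1 ≤ T) (hp2 : p.2 < T) :
    AEStronglyMeasurable (noise ξ q m δ T J) ((m.restrict (Icc (δ, δ) p)).prod P) := by
  have hw := continuousOn_pi.1
    (continuousOn_weight M.memLp M.continuous_scoreLp M.cont M.isUnit hp1 hp2)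
  have hf := isFiniteMeasure_restrict (m := m) (c := (δ, δ)) (e := p) le_rfl ⟨hp1, hp2.le⟩
  refine Finset.aestronglyMeasurable_fun_sum _ fun j _ => ?_
  refine (((hw j).aestronglyMeasurable measurableSet_Icc).comp_fst).mul
    (Measurable.aestronglyMeasurable ?_)
  have h1 : Measurable fun z : (ℝ × ℝ) × Ω => J z.1.2 z.2 :=
    hJ.1.comp (measurable_fst.snd.prodMk measurable_snd)
  refine ((measurable_pi_apply j).comp h1).sub (Finset.measurable_sum _ fun k _ => ?_)
  exact ((M.meas k).comp measurable_snd).mul ((M.measurable_fisher j k).comp measurable_fst.snd)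

theorem iso_kernelLp [IsProbabilityMeasure P] (M : ScoreModel P X η ξ q m δ T)
    (hJ : IsScoreIntegral P η m q δ T J) {u : ℝ × ℝ} (hu : u.2 ∈ Ico δ T) :
    (M.isonormal.iso (kernelLp M.memLp u) : Ω → ℝ) =ᵐ[P]
      fun ω => noise ξ q m δ T J (u, ω) := by
  simp only [kernelLp, map_sum, map_smul]
  refine (coeFn_sum_smul _ _ (fun j ω => J u.2 ω j -
    ∑ k, ξ k ω * fisher q m δ T (max u.2 δ) j k) fun j => ?_).trans (Eventually.of_forall fun ω =>
      rfl)
  filter_upwards [(M.isScoreIntegral_iff_ae hu j).1 (hJ.2 u.2 hu j)] with ω hω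
  rw [hω, Pi.add_apply, add_sub_cancel_right]

/-- The noise is almost surely square integrable on the rectangle, because its second moment at `u`
is `‖kernelLp u‖²`, which is bounded there. -/
theorem ae_memLp_noise [IsProbabilityMeasure P] (M : ScoreModel P X η ξ q m δ T)
    (hJ : IsScoreIntegral P η m q δ T J) (hp1 : p.1 ≤ T) (hp2 : p.2 < T) : ∀ᵐ ω ∂P,
    MemLp (fun u => noise ξ q m δ T J (u, ω)) 2 (m.restrict (Icc (δ, δ) p)) := by
  have hf := isFiniteMeasure_restrict (m := m) (c := (δ, δ)) (e := p) le_rfl ⟨hp1, hp2.le⟩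
  have hκ := continuousOn_kernelLp M.memLp M.continuous_scoreLp M.cont M.isUnit hp1 hp2
  obtain ⟨C, hC⟩ := isCompact_Icc.exists_bound_of_continuousOn hκ
  have hFm := M.aestronglyMeasurable_noise hJ hp1 hp2
  have h := integrable_sq_prod_of_coeFn (κ := fun u => M.isonormal.iso (kernelLp M.memLp u))
    hFm ((ae_restrict_iff' measurableSet_Icc).2 (Eventually.of_forall fun u hu =>
      M.iso_kernelLp hJ (mem_Ico_of_mem hp2 hu))) (C := C)
    ((ae_restrict_iff' measurableSet_Icc).2 (Eventually.of_forall fun u hu => by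
      rw [M.isonormal.norm_iso]; exact hC u hu))
  filter_upwards [h.prod_left_ae, hFm.prodMk_right] with ω h1 h2
  exact (memLp_two_iff_integrable_sq h2).2 h1

/-- Stochastic Fubini theorem: the pathwise integral of the noise is the integral of a
Bochner-integrated kernel against the isonormal field. -/
theorem integral_mul_noise [IsProbabilityMeasure P] (M : ScoreModel P X η ξ q m δ T)
    (hJ : IsScoreIntegral P η m q δ T J) (hp1 : p.1 ≤ T) (hp2 : p.2 < T) {φ : ℝ × ℝ → ℝ}
    (hφ : ContinuousOn φ (Icc (δ, δ) (T, T))) :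
    (fun ω => ∫ u in Icc (δ, δ) p, φ u * noise ξ q m δ T J (u, ω) ∂m) =ᵐ[P]
      M.isonormal.iso (∫ u in Icc (δ, δ) p, φ u • kernelLp M.memLp u ∂m) := by
  have hpT : p ≤ (T, T) := ⟨hp1, hp2.le⟩
  have hf := isFiniteMeasure_restrict (m := m) (c := (δ, δ)) (e := p) le_rfl hpT
  have hφ' := hφ.mono (Icc_subset_Icc le_rfl hpT)
  have hκ : ContinuousOn (fun u => φ u • kernelLp M.memLp u) (Icc (δ, δ) p) :=
    hφ'.smul (continuousOn_kernelLp M.memLp M.continuous_scoreLp M.cont M.isUnit hp1 hp2)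
  have hκi : IntegrableOn (fun u => φ u • kernelLp M.memLp u) (Icc (δ, δ) p) m := by
    obtain ⟨C, hC⟩ := isCompact_Icc.exists_bound_of_continuousOn hκ
    exact Integrable.of_bound (hκ.aestronglyMeasurable measurableSet_Icc) C
      ((ae_restrict_iff' measurableSet_Icc).2 (Eventually.of_forall hC))
  obtain ⟨C, hC⟩ := isCompact_Icc.exists_bound_of_continuousOn hκ
  have hFm : AEStronglyMeasurable (fun z : (ℝ × ℝ) × Ω => φ z.1 * noise ξ q m δ T J z)
      ((m.restrict (Icc (δ, δ) p)).prod P) :=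
    ((hφ'.aestronglyMeasurable measurableSet_Icc).comp_fst).mul
      (M.aestronglyMeasurable_noise hJ hp1 hp2)
  have hF : ∀ᵐ u ∂(m.restrict (Icc (δ, δ) p)),
      (M.isonormal.iso (φ u • kernelLp M.memLp u) : Ω → ℝ) =ᵐ[P]
        fun ω => φ u * noise ξ q m δ T J (u, ω) := by
    refine (ae_restrict_iff' measurableSet_Icc).2 (Eventually.of_forall fun u hu => ?_)
    rw [map_smul]
    filter_upwards [Lp.coeFn_smul (φ u) (M.isonormal.iso (kernelLp M.memLp u)),
      M.iso_kernelLp hJ (mem_Ico_of_mem hp2 hu)] with ω h1 h2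
    rw [h1, Pi.smul_apply, h2, smul_eq_mul]
  have h := integrable_sq_prod_of_coeFn (κ := fun u => M.isonormal.iso (φ u • kernelLp M.memLp u))
    hFm hF (C := C) ((ae_restrict_iff' measurableSet_Icc).2 (Eventually.of_forall fun u hu => by
      rw [M.isonormal.norm_iso]; exact hC u hu))
  rw [← ContinuousLinearMap.integral_comp_comm _ hκi]
  exact (coeFn_integral_Lp (M.isonormal.iso.integrable_comp hκi)
    (((memLp_two_iff_integrable_sq hFm).2 h).integrable (by norm_num)) hF).symm

theorem ae_integral_transformed [IsProbabilityMeasure P] (M : ScoreModel P X η ξ q m δ T)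
    (hJ : IsScoreIntegral P η m q δ T J) (hp1 : p.1 ≤ T) (hp2 : p.2 < T) {S : RectStep}
    (hS : S.Within (δ, δ) p) : ∀ᵐ ω ∂P,
    S.integral (transformed η q m δ T J) ω = S.integral X ω +
      -∫ u in Icc (δ, δ) p, S.toFun u * noise ξ q m δ T J (u, ω) ∂m := by
  have hpT : p ≤ (T, T) := ⟨hp1, hp2.le⟩
  have hf := isFiniteMeasure_restrict (m := m) (c := (δ, δ)) (e := p) le_rfl hpT
  have hq2 : ∀ k, MemLp (fun u => q u k) 2 (m.restrict (Icc (δ, δ) p)) := fun k =>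
    (M.memLp k).mono_measure (restrict_le le_rfl hpT)
  filter_upwards [M.ae_memLp_noise hJ hp1 hp2, M.ae_integral_step le_rfl hpT hS] with ω h1 h2
  have hdr : ∀ u ∈ Icc (δ, δ) p, drift q m δ T J u ω =
      noise ξ q m δ T J (u, ω) + ∑ k, ξ k ω * q u k := fun u hu =>
    M.drift_eq J (mem_Ico_of_mem hp2 hu) ω
  have hdi : IntegrableOn (fun u => drift q m δ T J u ω) (Icc (δ, δ) p) m :=
    IntegrableOn.congr_fun (f := fun u => noise ξ q m δ T J (u, ω) + ∑ k, ξ k ω * q u k)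
      ((h1.integrable (by norm_num)).add (integrable_finsetSum _ fun k _ =>
        ((hq2 k).integrable (by norm_num)).const_mul _))
      (fun u hu => (hdr u hu).symm) measurableSet_Icc
  -- the corner terms of the increments of the first summand cancel
  have e1 : ∀ c e : ℝ × ℝ, (δ, δ) ≤ c → c ≤ e → e ≤ p →
      increment (transformed η q m δ T J) c e ω = increment η c e ω -
        ∫ u in Ioc c.1 e.1 ×ˢ Ioc c.2 e.2, drift q m δ T J u ω ∂m := by
    intro c e hc hce hep
    rw [← increment_setIntegral hc hce hep hdi]
    simp only [increment, transformed]
    ring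
  have e2 : S.integral (transformed η q m δ T J) ω = S.integral η ω -
      ∫ u in Icc (δ, δ) p, S.toFun u * drift q m δ T J u ω ∂m := by
    rw [← RectStep.sum_setIntegral hS hdi, RectStep.integral, RectStep.integral,
      ← Finset.sum_sub_distrib]
    refine Finset.sum_congr rfl fun i _ => ?_
    rw [e1 _ _ (hS i).1 (hS i).2.1 (hS i).2.2]
    ring
  have hSm := S.memLp_toFun (m.restrict (Icc (δ, δ) p))
  have e3 : ∫ u in Icc (δ, δ) p, S.toFun u * drift q m δ T J u ω ∂m =
      (∫ u in Icc (δ, δ) p, S.toFun u * noise ξ q m δ T J (u, ω) ∂m) +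
        ∑ k, ξ k ω * ∫ u in Icc (δ, δ) p, S.toFun u * q u k ∂m := by
    have hiq : ∀ k, Integrable (fun u => ξ k ω * (S.toFun u * q u k))
        (m.restrict (Icc (δ, δ) p)) := fun k => (hSm.integrable_mul (hq2 k)).const_mul _
    have hin : Integrable (fun u => S.toFun u * noise ξ q m δ T J (u, ω))
        (m.restrict (Icc (δ, δ) p)) := hSm.integrable_mul h1
    simp only [← integral_const_mul]
    rw [← integral_finsetSum _ fun k _ => hiq k, ← integral_add hin
      (integrable_finsetSum _ fun k _ => hiq k)]
    refine setIntegral_congr_fun measurableSet_Icc fun u hu => ?_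
    simp only [hdr u hu, mul_add, Finset.mul_sum]
    congr 1
    exact Finset.sum_congr rfl fun k _ => by ring
  rw [e2, h2, e3]
  ring

/-- In integrals against the transformed process the coefficients `ξ` cancel. -/
theorem hasFieldIntegral_transformed_iff [IsProbabilityMeasure P]
    (M : ScoreModel P X η ξ q m δ T) (hJ : IsScoreIntegral P η m q δ T J)
    (hp1 : p.1 ≤ T) (hp2 : p.2 < T) {φ : ℝ × ℝ → ℝ}
    (hφ : MemLp φ 2 (m.restrict (Icc (δ, δ) (T, T)))) {Y : Ω → ℝ} :
    HasFieldIntegral P (transformed η q m δ T J) m φ (δ, δ) p Y ↔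
      Y =ᵐ[P] (M.isonormal.iso (indLp hφ (δ, δ) p) : Ω → ℝ) +
        fun ω => -∫ u in Icc (δ, δ) p, φ u * noise ξ q m δ T J (u, ω) ∂m := by
  have hpT : p ≤ (T, T) := ⟨hp1, hp2.le⟩
  have hf := isFiniteMeasure_restrict (m := m) (c := (δ, δ)) (e := p) le_rfl hpT
  refine M.isonormal.hasFieldIntegral_iff le_rfl hpT hφ
    (D := fun S ω => -∫ u in Icc (δ, δ) p, S.toFun u * noise ξ q m δ T J (u, ω) ∂m)
    (fun S => ?_) (fun S hS => M.ae_integral_transformed hJ hp1 hp2 hS) fun S hS => ?_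
  · have h1 : AEStronglyMeasurable (fun z : (ℝ × ℝ) × Ω => S.toFun z.1 * noise ξ q m δ T J z)
        ((m.restrict (Icc (δ, δ) p)).prod P) :=
      (S.toFun_measurable.comp measurable_fst).aestronglyMeasurable.mul
        (M.aestronglyMeasurable_noise hJ hp1 hp2)
    exact h1.prod_swap.integral_prod_right'.neg
  · filter_upwards [M.ae_memLp_noise hJ hp1 hp2] with ω hω
    exact (hS.tendsto_setIntegral_mul (hφ.mono_measure (restrict_le le_rfl hpT)) hω).neg

/-- The element of `L²` whose integral against the isonormal field is the transformed integral
of `φ` over `[δ,p]`. -/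
noncomputable def innovLp (M : ScoreModel P X η ξ q m δ T) {φ : ℝ × ℝ → ℝ}
    (hφ : MemLp φ 2 (m.restrict (Icc (δ, δ) (T, T)))) (p : ℝ × ℝ) :
    Lp ℝ 2 (m.restrict (Icc (δ, δ) (T, T))) :=
  indLp hφ (δ, δ) p - ∫ u in Icc (δ, δ) p, φ u • kernelLp M.memLp u ∂m

theorem ae_eq_iso_innovLp [IsProbabilityMeasure P] (M : ScoreModel P X η ξ q m δ T)
    (hJ : IsScoreIntegral P η m q δ T J) (hp1 : p.1 ≤ T) (hp2 : p.2 < T) {φ : ℝ × ℝ → ℝ}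
    (hφ : ContinuousOn φ (Icc (δ, δ) (T, T))) {Y : Ω → ℝ}
    (hY : HasFieldIntegral P (transformed η q m δ T J) m φ (δ, δ) p Y) :
    Y =ᵐ[P] M.isonormal.iso (M.innovLp (memLp_of_continuousOn hφ) p) := by
  rw [innovLp, map_sub]
  filter_upwards [(M.hasFieldIntegral_transformed_iff hJ hp1 hp2 (memLp_of_continuousOn hφ)).1 hY,
    M.integral_mul_noise hJ hp1 hp2 hφ, Lp.coeFn_sub
      (M.isonormal.iso (indLp (memLp_of_continuousOn (m := m) hφ) (δ, δ) p))
      (M.isonormal.iso (∫ u in Icc (δ, δ) p, φ u • kernelLp M.memLp u ∂m))] with ω h1 h2 h3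
  rw [h1, h3, Pi.add_apply, Pi.sub_apply, h2, sub_eq_add_neg]

end Compensator

end ScoreModel

end Innovation

/-! ### Covariance of the transformed process -/

namespace ScoreModel

variable {Ω : Type*} [MeasurableSpace Ω] {P : Measure Ω} {d : ℕ}
  {X η : ℝ × ℝ → Ω → ℝ} {ξ : Fin 6 ⊕ Fin d → Ω → ℝ}
  {q : ℝ × ℝ → Fin 6 ⊕ Fin d → ℝ} {m : Measure (ℝ × ℝ)} {δ T : ℝ}
  [hfin : IsFiniteMeasure (m.restrict (Icc (δ, δ) (T, T)))]
  {J : ℝ → Ω → Fin 6 ⊕ Fin d → ℝ} {p : ℝ × ℝ}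

theorem continuousOn_smul_kernelLp (M : ScoreModel P X η ξ q m δ T) (hp1 : p.1 ≤ T) (hp2 : p.2 < T)
    {φ : ℝ × ℝ → ℝ} (hφ : ContinuousOn φ (Icc (δ, δ) (T, T))) :
    ContinuousOn (fun u => φ u • kernelLp M.memLp u) (Icc (δ, δ) p) :=
  (hφ.mono (Icc_subset_Icc le_rfl ⟨hp1, hp2.le⟩)).smul
    (continuousOn_kernelLp M.memLp M.continuous_scoreLp M.cont M.isUnit hp1 hp2)

theorem integrableOn_smul_kernelLp (M : ScoreModel P X η ξ q m δ T) (hp1 : p.1 ≤ T) (hp2 : p.2 < T)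
    {φ : ℝ × ℝ → ℝ} (hφ : ContinuousOn φ (Icc (δ, δ) (T, T))) :
    IntegrableOn (fun u => φ u • kernelLp M.memLp u) (Icc (δ, δ) p) m := by
  have hf := isFiniteMeasure_restrict (m := m) (c := (δ, δ)) (e := p) le_rfl ⟨hp1, hp2.le⟩
  have hκ := M.continuousOn_smul_kernelLp hp1 hp2 hφ
  obtain ⟨C, hC⟩ := isCompact_Icc.exists_bound_of_continuousOn hκ
  exact Integrable.of_bound (hκ.aestronglyMeasurable measurableSet_Icc) C
    ((ae_restrict_iff' measurableSet_Icc).2 (Eventually.of_forall hC))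

theorem coeFn_integral_kernelLp (M : ScoreModel P X η ξ q m δ T) (hp1 : p.1 ≤ T) (hp2 : p.2 < T)
    {φ : ℝ × ℝ → ℝ} (hφ : ContinuousOn φ (Icc (δ, δ) (T, T))) :
    ((∫ v in Icc (δ, δ) p, φ v • kernelLp M.memLp v ∂m : Lp ℝ 2 _) : ℝ × ℝ → ℝ)
      =ᵐ[m.restrict (Icc (δ, δ) (T, T))]
        fun u => ∫ v in Icc (δ, δ) p, φ v * kernelFun q m δ T (v, u) ∂m := by
  have hpT : p ≤ (T, T) := ⟨hp1, hp2.le⟩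
  have hf := isFiniteMeasure_restrict (m := m) (c := (δ, δ)) (e := p) le_rfl hpT
  have hw := continuousOn_pi.1
    (continuousOn_weight M.memLp M.continuous_scoreLp M.cont M.isUnit hp1 hp2)
  have hset : MeasurableSet {z : (ℝ × ℝ) × (ℝ × ℝ) | z.1.2 ≤ z.2.2} :=
    measurableSet_le (by fun_prop) (by fun_prop)
  have hFm : AEStronglyMeasurable (fun z : (ℝ × ℝ) × (ℝ × ℝ) => φ z.1 * kernelFun q m δ T z)
      ((m.restrict (Icc (δ, δ) p)).prod (m.restrict (Icc (δ, δ) (T, T)))) := by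
    refine (((hφ.mono (Icc_subset_Icc le_rfl hpT)).aestronglyMeasurable
      measurableSet_Icc).comp_fst).mul ?_
    have h1 : AEStronglyMeasurable (fun z : (ℝ × ℝ) × (ℝ × ℝ) => weight q m δ T z.1 ⬝ᵥ q z.2)
        ((m.restrict (Icc (δ, δ) p)).prod (m.restrict (Icc (δ, δ) (T, T)))) :=
      Finset.aestronglyMeasurable_fun_sum _ fun j _ =>
        (((hw j).aestronglyMeasurable measurableSet_Icc).comp_fst).mul
          (((M.cont j).aestronglyMeasurable measurableSet_Icc).comp_snd)
    exact h1.indicator hset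
  have hF : ∀ᵐ v ∂(m.restrict (Icc (δ, δ) p)),
      ((φ v • kernelLp M.memLp v : Lp ℝ 2 _) : ℝ × ℝ → ℝ) =ᵐ[m.restrict (Icc (δ, δ) (T, T))]
        fun u => φ v * kernelFun q m δ T (v, u) := Eventually.of_forall fun v => by
    filter_upwards [Lp.coeFn_smul (φ v) (kernelLp M.memLp v), kernelLp_coeFn M.memLp v] with u h1 h2
    rw [h1, Pi.smul_apply, h2, smul_eq_mul]
  obtain ⟨C, hC⟩ := isCompact_Icc.exists_bound_of_continuousOn
    (M.continuousOn_smul_kernelLp hp1 hp2 hφ)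
  have h := integrable_sq_prod_of_coeFn hFm hF (C := C)
    ((ae_restrict_iff' measurableSet_Icc).2 (Eventually.of_forall hC))
  exact coeFn_integral_Lp (M.integrableOn_smul_kernelLp hp1 hp2 hφ)
    (((memLp_two_iff_integrable_sq hFm).2 h).integrable (by norm_num)) hF

/-- The reproducing property, integrated over `[δ,p]`. -/
theorem inner_kernelLp_integral (M : ScoreModel P X η ξ q m δ T) (hp1 : p.1 ≤ T) (hp2 : p.2 < T)
    {φ : ℝ × ℝ → ℝ} (hφ : ContinuousOn φ (Icc (δ, δ) (T, T))) {u : ℝ × ℝ} (hu : u.2 ∈ Ico δ T) :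
    inner ℝ (kernelLp M.memLp u) ((∫ v in Icc (δ, δ) p, φ v • kernelLp M.memLp v ∂m) -
        indLp (memLp_of_continuousOn hφ) (δ, δ) p) =
      ∫ v in Icc (δ, δ) p, φ v * kernelFun q m δ T (v, u) ∂m := by
  have hpT : p ≤ (T, T) := ⟨hp1, hp2.le⟩
  have hκ := M.integrableOn_smul_kernelLp hp1 hp2 hφ
  have hrr : (m.restrict (Icc (δ, δ) (T, T))).restrict (Icc (δ, δ) p) =
      m.restrict (Icc (δ, δ) p) := by
    rw [Measure.restrict_restrict measurableSet_Icc, inter_eq_left.2 (Icc_subset_Icc le_rfl hpT)]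
  have hle := restrict_le (m := m) (δ := δ) (T := T) (c := (δ, δ)) (e := p) le_rfl hpT
  have hac : m.restrict (Icc (δ, δ) p) ≪ volume :=
    (Measure.absolutelyContinuous_of_le hle).trans M.isonormal.ac
  rw [inner_sub_right, real_inner_comm (indLp _ _ _), inner_indLp, hrr, ← integral_inner hκ,
    ← integral_sub]
  · refine integral_congr_ae ?_
    filter_upwards [ae_restrict_mem measurableSet_Icc, ae_ne_corner hac u,
      (Measure.absolutelyContinuous_of_le hle).ae_le (kernelLp_coeFn M.memLp u)] with v hv hne hk
    rw [hk, real_inner_smul_right,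
      inner_kernelLp M.memLp M.isUnit hu (mem_Ico_of_mem hp2 hv) hne.2]
    ring
  · exact hκ.const_inner _
  · exact ((memLp_of_continuousOn hφ).mono_measure hle).integrable_mul
      ((Lp.memLp (kernelLp M.memLp u)).mono_measure hle)

/-- The innovation transform is an isometry on the functions `φ 1_{[δ,p]}`: by the reproducing
property of the kernel, the cross terms with the Bochner integrals of the kernel cancel. -/
theorem inner_innovLp (M : ScoreModel P X η ξ q m δ T) {p p' : ℝ × ℝ} (hp1 : p.1 ≤ T)
    (hp2 : p.2 < T) (hp1' : p'.1 ≤ T) (hp2' : p'.2 < T)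
    {φ : ℝ × ℝ → ℝ} (hφ : ContinuousOn φ (Icc (δ, δ) (T, T))) :
    inner ℝ (M.innovLp (memLp_of_continuousOn hφ) p) (M.innovLp (memLp_of_continuousOn hφ) p') =
      ∫ u in Icc (δ, δ) p ∩ Icc (δ, δ) p', φ u * φ u ∂m := by
  have hpT : p ≤ (T, T) := ⟨hp1, hp2.le⟩
  have hrr : (m.restrict (Icc (δ, δ) (T, T))).restrict (Icc (δ, δ) p) =
      m.restrict (Icc (δ, δ) p) := by
    rw [Measure.restrict_restrict measurableSet_Icc, inter_eq_left.2 (Icc_subset_Icc le_rfl hpT)]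
  have hle := restrict_le (m := m) (δ := δ) (T := T) (c := (δ, δ)) (e := p) le_rfl hpT
  have hφ2 := memLp_of_continuousOn (m := m) hφ
  set e := indLp hφ2 (δ, δ) p with he
  set e' := indLp hφ2 (δ, δ) p' with he'
  set k := ∫ u in Icc (δ, δ) p, φ u • kernelLp M.memLp u ∂m with hk
  set k' := ∫ u in Icc (δ, δ) p', φ u • kernelLp M.memLp u ∂m with hk'
  -- the reproducing property, integrated over both arguments
  have h1 : inner ℝ k (k' - e') = inner ℝ e k' := by
    rw [real_inner_comm, hk, ← integral_inner (M.integrableOn_smul_kernelLp hp1 hp2 hφ), he,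
      inner_indLp, hrr]
    refine integral_congr_ae ?_
    filter_upwards [ae_restrict_mem measurableSet_Icc,
      (Measure.absolutelyContinuous_of_le hle).ae_le (M.coeFn_integral_kernelLp hp1' hp2' hφ)]
      with u hu hku
    rw [hk', hku, real_inner_smul_right, real_inner_comm, he',
      M.inner_kernelLp_integral hp1' hp2' hφ (mem_Ico_of_mem hp2 hu)]
  have h2 : inner ℝ e e' = ∫ u in Icc (δ, δ) p ∩ Icc (δ, δ) p', φ u * φ u ∂m := by
    rw [he, inner_indLp, hrr]
    have : ∀ᵐ u ∂(m.restrict (Icc (δ, δ) p)), φ u * e' u =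
        (Icc (δ, δ) p').indicator (fun u => φ u * φ u) u := by
      filter_upwards [(Measure.absolutelyContinuous_of_le hle).ae_le
        (indLp_coeFn hφ2 (δ, δ) p')] with u hu
      rw [he', hu]
      by_cases h : u ∈ Icc (δ, δ) p'
      · simp only [indicator_of_mem h]
      · simp only [indicator_of_notMem h, mul_zero]
    rw [integral_congr_ae this, setIntegral_indicator measurableSet_Icc]
  rw [innovLp, innovLp, ← h2]
  have h3 : inner ℝ (e - k) (e' - k') = inner ℝ e e' - inner ℝ e k' + inner ℝ k (k' - e') := by
    simp only [inner_sub_left, inner_sub_right]; ring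
  rw [h3, h1]
  ring

theorem ae_memLp_drift [IsProbabilityMeasure P] (M : ScoreModel P X η ξ q m δ T)
    (hJ : IsScoreIntegral P η m q δ T J) (hp1 : p.1 ≤ T) (hp2 : p.2 < T) : ∀ᵐ ω ∂P,
    MemLp (fun u => drift q m δ T J u ω) 2 (m.restrict (Icc (δ, δ) p)) := by
  have hle := restrict_le (m := m) (δ := δ) (T := T) (c := (δ, δ)) (e := p) le_rfl ⟨hp1, hp2.le⟩
  filter_upwards [M.ae_memLp_noise hJ hp1 hp2] with ω hω
  refine MemLp.ae_eq (f := fun u => noise ξ q m δ T J (u, ω) + ∑ k, ξ k ω * q u k) ?_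
    (hω.add (memLp_finsetSum _ fun k _ => ((M.memLp k).mono_measure hle).const_mul _))
  filter_upwards [ae_restrict_mem measurableSet_Icc] with u hu
  exact (M.drift_eq J (mem_Ico_of_mem hp2 hu) ω).symm

theorem ae_integral_mul_drift [IsProbabilityMeasure P] (M : ScoreModel P X η ξ q m δ T)
    (hJ : IsScoreIntegral P η m q δ T J) (hp1 : p.1 ≤ T) (hp2 : p.2 < T) {φ : ℝ × ℝ → ℝ}
    (hφ : MemLp φ 2 (m.restrict (Icc (δ, δ) (T, T)))) : ∀ᵐ ω ∂P,
    ∫ u in Icc (δ, δ) p, φ u * drift q m δ T J u ω ∂m =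
      (∫ u in Icc (δ, δ) p, φ u * noise ξ q m δ T J (u, ω) ∂m) +
        ∑ k, ξ k ω * ∫ u in Icc (δ, δ) p, φ u * q u k ∂m := by
  have hle := restrict_le (m := m) (δ := δ) (T := T) (c := (δ, δ)) (e := p) le_rfl ⟨hp1, hp2.le⟩
  filter_upwards [M.ae_memLp_noise hJ hp1 hp2] with ω hω
  have hiq : ∀ k, Integrable (fun u => ξ k ω * (φ u * q u k))
      (m.restrict (Icc (δ, δ) p)) := fun k =>
    ((hφ.mono_measure hle).integrable_mul ((M.memLp k).mono_measure hle)).const_mul _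
  have hin : Integrable (fun u => φ u * noise ξ q m δ T J (u, ω))
      (m.restrict (Icc (δ, δ) p)) := (hφ.mono_measure hle).integrable_mul hω
  simp only [← integral_const_mul]
  rw [← integral_finsetSum _ fun k _ => hiq k, ← integral_add hin
    (integrable_finsetSum _ fun k _ => hiq k)]
  refine setIntegral_congr_fun measurableSet_Icc fun u hu => ?_
  simp only [M.drift_eq J (mem_Ico_of_mem hp2 hu), mul_add, Finset.mul_sum]
  congr 1
  exact Finset.sum_congr rfl fun k _ => by ring

end ScoreModel

/-! ### The limit process as a score model -/

section LimitProcess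

variable {d : ℕ} {R : (Fin d → ℝ) → Measure (ℝ≥0∞ × ℝ≥0∞)} {r : (Fin d → ℝ) → ℝ × ℝ → ℝ}
  {Θ B : Set (Fin d → ℝ)} {θ₀ : Fin d → ℝ} {δ T : ℝ}

theorem Icc_diag_subset_quadrant (hδ : 0 < δ) (p : ℝ × ℝ) : Icc (δ, δ) p ⊆ quadrant :=
  Icc_subset_quadrant (a := (δ, δ)) ⟨hδ, hδ⟩ p

namespace SmoothDensityAt

theorem integrableOn_finitePart_iff (hB4 : SmoothDensityAt R r Θ B θ₀) {A : Set (ℝ × ℝ)}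
    (hA : MeasurableSet A) (hAq : A ⊆ quadrant) {g : ℝ × ℝ → ℝ} :
    IntegrableOn g A (finitePart (R θ₀)) ↔ IntegrableOn (fun p => r θ₀ p * g p) A volume := by
  rw [IntegrableOn, hB4.restrict_finitePart hB4.mem hA hAq,
    integrable_withDensity_iff_integrable_smul₀'
      ((hB4.meas θ₀ hB4.mem).mono_measure (Measure.restrict_mono hAq le_rfl)).ennreal_ofReal
      (Eventually.of_forall fun _ => ENNReal.ofReal_lt_top)]
  refine integrableOn_congr_fun (fun p hp => ?_) hA
  simp only [smul_eq_mul, ENNReal.toReal_ofReal (hB4.pos θ₀ hB4.mem p (hAq hp)).le]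

theorem exists_restrict_le (hB4 : SmoothDensityAt R r Θ B θ₀) (hδ : 0 < δ) :
    ∃ C, 0 ≤ C ∧
      (finitePart (R θ₀)).restrict (Icc (δ, δ) (T, T)) ≤ ENNReal.ofReal C • volume := by
  have hq := Icc_diag_subset_quadrant hδ (T, T)
  obtain ⟨C, hC⟩ := isCompact_Icc.exists_bound_of_continuousOn (hB4.continuousOn.mono hq)
  refine ⟨max C 0, le_max_right _ _, ?_⟩
  rw [hB4.restrict_finitePart hB4.mem measurableSet_Icc hq]
  calc _ ≤ (volume.restrict (Icc (δ, δ) (T, T))).withDensity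
        (fun _ : ℝ × ℝ => ENNReal.ofReal (max C 0)) := by
        refine withDensity_mono ((ae_restrict_iff' measurableSet_Icc).2
          (Eventually.of_forall fun p hp => ENNReal.ofReal_le_ofReal ?_))
        exact ((le_abs_self _).trans (hC p hp)).trans (le_max_left _ _)
    _ ≤ _ := by
        rw [withDensity_const]
        gcongr
        exact Measure.restrict_le_self

theorem isFiniteMeasure_restrict (hB4 : SmoothDensityAt R r Θ B θ₀) (hδ : 0 < δ) :
    IsFiniteMeasure ((finitePart (R θ₀)).restrict (Icc (δ, δ) (T, T))) := by
  obtain ⟨C, -, hC⟩ := hB4.exists_restrict_le (T := T) hδ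
  refine ⟨?_⟩
  have h := hC (Icc (δ, δ) (T, T))
  rw [Measure.restrict_apply_self, Measure.smul_apply, smul_eq_mul] at h
  rw [Measure.restrict_apply_univ]
  exact h.trans_lt (ENNReal.mul_lt_top ENNReal.ofReal_lt_top isCompact_Icc.measure_lt_top)

theorem continuousOn_one_div_sqrt (hB4 : SmoothDensityAt R r Θ B θ₀) :
    ContinuousOn (fun u => 1 / √(r θ₀ u)) quadrant :=
  continuousOn_const.div hB4.continuousOn.sqrt fun u hu =>
    (Real.sqrt_pos.2 (hB4.pos θ₀ hB4.mem u hu)).ne'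

theorem density_mul_one_div_sqrt_mul (hB4 : SmoothDensityAt R r Θ B θ₀) {u : ℝ × ℝ}
    (hu : u ∈ quadrant) (y : ℝ) : r θ₀ u * (1 / √(r θ₀ u) * y) = y * √(r θ₀ u) := by
  have h := hB4.pos θ₀ hB4.mem u hu
  have h' := (Real.sqrt_pos.2 h).ne'
  nth_rewrite 1 [← Real.mul_self_sqrt h.le]
  field_simp

end SmoothDensityAt

variable {Ω : Type*} [MeasurableSpace Ω] {P : Measure Ω}

/-- The limit process is a score model. The arbitrary random coefficients are replaced by measurable
versions, so that the decomposition of the increments holds almost surely. -/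
theorem exists_scoreModel_etaHat [IsProbabilityMeasure P] (hB2 : SmoothCopulaAt R θ₀)
    (hB4 : SmoothDensityAt R r Θ B θ₀) (hR : ∀ θ ∈ Θ, IsTailCopula (R θ)) (γ₁ γ₂ : ℝ)
    {V : {p : ℝ≥0∞ × ℝ≥0∞ // p ≠ (⊤, ⊤)} → Ω → ℝ} (hV : IsWienerWithTime V (R θ₀) P)
    {A₁ A₂ B₁ B₂ Γ₁ Γ₂ : Ω → ℝ} {ζ : Fin d → Ω → ℝ}
    (hξ : ∀ k, AEMeasurable
      ((Sum.elim ![A₁, B₁, Γ₁, A₂, B₂, Γ₂] ζ : Fin 6 ⊕ Fin d → Ω → ℝ) k) P)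
    (hδ : 0 < δ) (hδT : δ < T)
    (hI : ∀ t ∈ Ico δ T, IsUnit (fisher (score r θ₀ γ₁ γ₂) (finitePart (R θ₀)) δ T t)) :
    ∃ ξ : Fin 6 ⊕ Fin d → Ω → ℝ, ScoreModel P (fun p => V (pt p))
      (etaHat R θ₀ γ₁ γ₂ V A₁ A₂ B₁ B₂ Γ₁ Γ₂ ζ) ξ (score r θ₀ γ₁ γ₂)
      (finitePart (R θ₀)) δ T := by
  have hq := Icc_diag_subset_quadrant hδ (T, T)
  refine ⟨fun k => (hξ k).mk, ?_, hB4.exists_restrict_le hδ, fun j =>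
    (continuousOn_score hB4 γ₁ γ₂ j).mono hq, hI, fun k => (hξ k).measurable_mk, ?_⟩
  · refine hV.isIsonormalOn (hR θ₀ (hB4.subset hB4.mem)) (a := (δ, δ)) ⟨hδ.le, hδ.le⟩
      ⟨hδT.le, hδT.le⟩ (hB4.isFiniteMeasure_restrict hδ) ?_
    rw [hB4.restrict_finitePart hB4.mem measurableSet_Icc hq]
    exact (withDensity_absolutelyContinuous _ _).trans
      (Measure.absolutelyContinuous_of_le Measure.restrict_le_self)
  · intro c e hc hce _
    filter_upwards [ae_all_iff.2 fun k => (hξ k).ae_eq_mk] with ω hω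
    rw [increment_etaHat hB2 hB4 hR γ₁ γ₂ V A₁ A₂ B₁ B₂ Γ₁ Γ₂ ζ
      (mem_quadrant_of_le (a := (δ, δ)) ⟨hδ, hδ⟩ hc) hce]
    simp only [hω]

end LimitProcess

end TailCopula

/-! ### The transformed process is a standard Wiener process -/

theorem corollary3 {d : ℕ} {Ω : Type*} [MeasurableSpace Ω] (P : Measure Ω)
    [IsProbabilityMeasure P]
    -- the parametric family of tail copulas and the true parameter
    (Θ : Set (Fin d → ℝ)) (hΘ : IsOpen Θ) (θ₀ : Fin d → ℝ) (hθ₀ : θ₀ ∈ Θ)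
    (R : (Fin d → ℝ) → Measure (ℝ≥0∞ × ℝ≥0∞)) (hR : ∀ θ ∈ Θ, TailCopula.IsTailCopula (R θ))
    (hB2 : TailCopula.SmoothCopulaAt R θ₀)
    (r : (Fin d → ℝ) → ℝ × ℝ → ℝ) (B : Set (Fin d → ℝ))
    (hB4 : TailCopula.SmoothDensityAt R r Θ B θ₀)
    -- the marginal indices and the limit process
    (γ₁ γ₂ : ℝ)
    (V : {p : ℝ≥0∞ × ℝ≥0∞ // p ≠ (⊤, ⊤)} → Ω → ℝ)
    (hV : TailCopula.IsWienerWithTime V (R θ₀) P)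
    (A₁ A₂ B₁ B₂ Γ₁ Γ₂ : Ω → ℝ) (ζ : Fin d → Ω → ℝ)
    (hA₁ : AEMeasurable A₁ P) (hA₂ : AEMeasurable A₂ P)
    (hB₁ : AEMeasurable B₁ P) (hB₂ : AEMeasurable B₂ P)
    (hΓ₁ : AEMeasurable Γ₁ P) (hΓ₂ : AEMeasurable Γ₂ P)
    (hζ : ∀ i, AEMeasurable (ζ i) P)
    (η : ℝ × ℝ → Ω → ℝ)
    (hη : η = TailCopula.etaHat R θ₀ γ₁ γ₂ V A₁ A₂ B₁ B₂ Γ₁ Γ₂ ζ)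
    -- the time measure on the finite quadrant, the scores, and invertibility of `I(t)`
    (m : Measure (ℝ × ℝ)) (hm : m = TailCopula.finitePart (R θ₀))
    (q : ℝ × ℝ → Fin 6 ⊕ Fin d → ℝ) (hq : q = TailCopula.score r θ₀ γ₁ γ₂)
    (δ T : ℝ) (hδ : 0 < δ) (hδT : δ < T)
    (hI : ∀ t ∈ Ico δ T, IsUnit (TailCopula.fisher q m δ T t))
    (D : Set (ℝ × ℝ)) (hD : D = Icc δ T ×ˢ Ico δ T) :
    -- the inner integrals exist, with a jointly measurable version
    (∃ J : ℝ → Ω → Fin 6 ⊕ Fin d → ℝ, TailCopula.IsScoreIntegral P η m q δ T J) ∧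
    ∀ J : ℝ → Ω → Fin 6 ⊕ Fin d → ℝ, TailCopula.IsScoreIntegral P η m q δ T J →
      -- the compensators are almost surely well defined
      (∀ p ∈ D, ∀ᵐ ω ∂P,
        IntegrableOn (fun u => TailCopula.drift q m δ T J u ω) (Icc (δ, δ) p) m ∧
        IntegrableOn (fun u => TailCopula.drift q m δ T J u ω * √(r θ₀ u)) (Icc (δ, δ) p)
          volume) ∧
      -- the integrals of `r ^ (-1/2)` against `W_R` and against `η̂` exist
      (∃ W : ℝ × ℝ → Ω → ℝ, ∀ p ∈ D,
        TailCopula.HasFieldIntegral P (TailCopula.transformed η q m δ T J) m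
          (fun u => 1 / √(r θ₀ u)) (δ, δ) p (W p)) ∧
      (∃ E : ℝ × ℝ → Ω → ℝ, ∀ p ∈ D,
        TailCopula.HasFieldIntegral P η m (fun u => 1 / √(r θ₀ u)) (δ, δ) p (E p)) ∧
      -- the two formulas for `W` agree, and `W` is a standard Wiener process
      ∀ W E : ℝ × ℝ → Ω → ℝ,
        (∀ p ∈ D, TailCopula.HasFieldIntegral P (TailCopula.transformed η q m δ T J) m
          (fun u => 1 / √(r θ₀ u)) (δ, δ) p (W p)) →
        (∀ p ∈ D, TailCopula.HasFieldIntegral P η m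
          (fun u => 1 / √(r θ₀ u)) (δ, δ) p (E p)) →
        (∀ p ∈ D, ∀ᵐ ω ∂P, W p ω = E p ω -
          ∫ u in Icc (δ, δ) p, TailCopula.drift q m δ T J u ω * √(r θ₀ u)) ∧
        TailCopula.IsStandardWienerOn W δ D P := by
  subst hη hm hq hD
  have hξ : ∀ k, AEMeasurable
      ((Sum.elim ![A₁, B₁, Γ₁, A₂, B₂, Γ₂] ζ : Fin 6 ⊕ Fin d → Ω → ℝ) k) P := by
    rintro (k | k)
    · fin_cases k <;> assumption
    · exact hζ k
  obtain ⟨ξ, M⟩ := TailCopula.exists_scoreModel_etaHat hB2 hB4 hR γ₁ γ₂ hV hξ hδ hδT hI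
  have hfin := hB4.isFiniteMeasure_restrict (T := T) hδ
  have hφ : ContinuousOn (fun u => 1 / √(r θ₀ u)) (Icc (δ, δ) (T, T)) :=
    hB4.continuousOn_one_div_sqrt.mono (TailCopula.Icc_diag_subset_quadrant hδ _)
  have hφ2 := TailCopula.ScoreModel.memLp_of_continuousOn
    (m := TailCopula.finitePart (R θ₀)) hφ
  refine ⟨M.exists_isScoreIntegral, fun J hJ => ⟨fun p hp => ?_, ?_, ?_, fun W E hW hE => ?_⟩⟩
  · have hq := TailCopula.Icc_diag_subset_quadrant hδ p
    have hpT : p ≤ (T, T) := ⟨hp.1.2, hp.2.2.le⟩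
    have hle := TailCopula.ScoreModel.restrict_le (m := TailCopula.finitePart (R θ₀))
      (δ := δ) (T := T) (c := (δ, δ)) le_rfl hpT
    have hf := isFiniteMeasure_of_le _ hle
    filter_upwards [M.ae_memLp_drift hJ hp.1.2 hp.2.2] with ω hω
    refine ⟨hω.integrable (by norm_num), ?_⟩
    have h := (hB4.integrableOn_finitePart_iff measurableSet_Icc hq).1
      ((hφ2.mono_measure hle).integrable_mul hω)
    exact h.congr_fun (fun u hu => hB4.density_mul_one_div_sqrt_mul (hq hu) _) measurableSet_Icc
  · exact ⟨fun p => _, fun p hp =>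
      (M.hasFieldIntegral_transformed_iff hJ hp.1.2 hp.2.2 hφ2).2 EventuallyEq.rfl⟩
  · exact ⟨fun p => _, fun p hp =>
      (M.hasFieldIntegral_iff le_rfl ⟨hp.1.2, hp.2.2.le⟩ hφ2).2 EventuallyEq.rfl⟩
  · have hiso : ∀ p ∈ Icc δ T ×ˢ Ico δ T, W p =ᵐ[P] M.isonormal.iso (M.innovLp hφ2 p) :=
      fun p hp => M.ae_eq_iso_innovLp hJ hp.1.2 hp.2.2 hφ (hW p hp)
    refine ⟨fun p hp => ?_, M.isonormal.isGaussianProcess_iso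
      (fun p : Icc δ T ×ˢ Ico δ T => M.innovLp hφ2 p) fun p => hiso p p.2, fun p hp => ?_,
      fun p hp p' hp' => ?_⟩
    · -- both fields have the same isonormal part; the other parts differ by the compensator
      have hq := TailCopula.Icc_diag_subset_quadrant hδ p
      filter_upwards [(M.hasFieldIntegral_transformed_iff hJ hp.1.2 hp.2.2 hφ2).1 (hW p hp),
        (M.hasFieldIntegral_iff le_rfl ⟨hp.1.2, hp.2.2.le⟩ hφ2).1 (hE p hp),
        M.ae_integral_mul_drift hJ hp.1.2 hp.2.2 hφ2] with ω h1 h2 h3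
      rw [hB4.setIntegral_finitePart hB4.mem measurableSet_Icc hq, setIntegral_congr_fun
        measurableSet_Icc fun u hu => hB4.density_mul_one_div_sqrt_mul (hq hu) _] at h3
      rw [h1, h2, h3, Pi.add_apply, Pi.add_apply]
      ring
    · rw [integral_congr_ae (hiso p hp), M.isonormal.integral_iso]
    · have hq := TailCopula.Icc_diag_subset_quadrant hδ p
      have hA : MeasurableSet (Icc (δ, δ) p ∩ Icc (δ, δ) p') :=
        measurableSet_Icc.inter measurableSet_Icc
      have hAq : Icc (δ, δ) p ∩ Icc (δ, δ) p' ⊆ TailCopula.quadrant := inter_subset_left.trans hq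
      calc ∫ ω, W p ω * W p' ω ∂P
          = inner ℝ (M.isonormal.iso (M.innovLp hφ2 p)) (M.isonormal.iso (M.innovLp hφ2 p')) := by
            rw [L2.inner_def]
            refine integral_congr_ae ?_
            filter_upwards [hiso p hp, hiso p' hp'] with ω h1 h2
            rw [h1, h2, real_inner_comm]
            rfl
        _ = ∫ u in Icc (δ, δ) p ∩ Icc (δ, δ) p', (1 : ℝ) := by
            rw [M.isonormal.inner_iso, M.inner_innovLp hp.1.2 hp.2.2 hp'.1.2 hp'.2.2 hφ,
              hB4.setIntegral_finitePart hB4.mem hA hAq]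
            refine setIntegral_congr_fun hA fun u hu => ?_
            simp only [hB4.density_mul_one_div_sqrt_mul (hAq hu)]
            exact one_div_mul_cancel (Real.sqrt_pos.2 (hB4.pos θ₀ hB4.mem u (hAq hu))).ne'
        _ = _ := by rw [setIntegral_const, smul_eq_mul, mul_one]
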